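/- Fix a dimension $k\ge 1$. One qubit sits at each point of the grid $\mathbb Z^k$. The hardware offers a set $\mathcal G$ of one- and two-qubit unitaries and the measurement of a qubit in the computational basis (the basic operations). $\mathcal G$ is universal: every two-qubit unitary (in particular $V\otimes I$ for every one-qubit unitary $V$) is, up to a global phase, a finite product of elements of $\mathcal G$, each applied to one or both of the two qubits, in either order of the qubits. A circuit is a sequence $S_1,\dots,S_d$ of finite sets of basic operations such that the operations in each $S_i$ act on pairwise disjoint sets of qubits and every two-qubit operation acts on two neighbours in $\mathbb Z^k$ (points at $\ell^1$-distance $1$); no operation depends on a measurement outcome. Its depth is $d$, its size is $\sum_i|S_i|$, and its width is the number of qubits on which its operations act. A $k$-D NANTC family is a sequence of circuits $(C_n)_{n\ge 0}$ that uses finitely many different elements of $\mathcal G$ and for which a Turing machine computes the description of $C_n$ from $n$ (given in unary) in time polynomial in $n$. Let $U$ be a one-qubit unitary. The controlled-$U$ operation with $n$ controls is the unitary $\Lambda_n(U)$ on $n$ control qubits and one target qubit that applies $U$ to the target if all controls are $1$ and acts as the identity otherwise. $C_n$ implements it if the $n$ controls and the target can be placed at $n+1$ distinct grid points so that, for every state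 $\sigma$ of these $n+1$ qubits, $C_n$ maps $\sigma$ (with all other qubits in $|0\rangle$) to $\Lambda_n(U)\,\sigma\,\Lambda_n(U)^\dagger$ (with all other qubits again in $|0\rangle$). **Theorem.** For every $k\ge1$, every universal $\mathcal G$ and every one-qubit unitary $U$ there are a constant $C$ and a $k$-D NANTC family $(C_n)$ with basic operations from $\mathcal G$ and measurements such that, for every $n\ge 0$, $C_n$ implements the controlled-$U$ operation with $n$ controls and, for every $n\ge1$, $C_n$ has depth at most $C\,n^{1/k}$, size at most $C\,n$ and width at most $C\,n$. Moreover, if every two-qubit unitary is (up to a global phase) a product of at most $L$ elements of $\mathcal G$ as above, then $C$ can be chosen to depend only on $k$ and $L$ (and not on $\mathcal G$ or $U$). -/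

import Mathlib

open scoped Matrix Kronecker

noncomputable section

namespace NANTC

/-! ### Qubits on the grid `ℤ^k` and their states -/

/-- The points of the `k`-dimensional grid; each of them holds one qubit. -/
abbrev Site (k : ℕ) : Type := Fin k → ℤ

/-- Two grid points are neighbours if their `ℓ¹` distance is one. -/
def Adjacent {k : ℕ} (p q : Site k) : Prop := ∑ i, |p i - q i| = 1

/-- The labels of the computational basis (`true` is `|1⟩`). -/
abbrev Config (k : ℕ) : Type := Site k → Bool

/-- An operator on the qubits of the grid, given by its matrix elements
`ρ x y = ⟨x|ρ|y⟩` in the computational basis. -/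
abbrev State (k : ℕ) : Type := Config k → Config k → ℂ

/-- A single-qubit unitary, in the basis `|false⟩, |true⟩`. -/
abbrev U1 : Type := Matrix.unitaryGroup Bool ℂ

/-- A two-qubit unitary, in the basis `|a⟩ ⊗ |b⟩`. -/
abbrev U2 : Type := Matrix.unitaryGroup (Bool × Bool) ℂ

/-- `ρ ↦ V ρ V†` with `V` acting on the qubit `p`. -/
def applyOne {k : ℕ} (V : Matrix Bool Bool ℂ) (p : Site k) (ρ : State k) : State k :=
  fun x y => ∑ a : Bool, ∑ b : Bool,
    V (x p) a * ρ (Function.update x p a) (Function.update y p b) * star (V (y p) b)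

/-- Replace the values at `p` and `q` by the two components of `a`. -/
def update₂ {k : ℕ} (x : Config k) (p q : Site k) (a : Bool × Bool) : Config k :=
  Function.update (Function.update x p a.1) q a.2

/-- `ρ ↦ V ρ V†` with `V` acting on the qubits `p` (first factor) and `q` (second factor). -/
def applyTwo {k : ℕ} (V : Matrix (Bool × Bool) (Bool × Bool) ℂ) (p q : Site k)
    (ρ : State k) : State k :=
  fun x y => ∑ a : Bool × Bool, ∑ b : Bool × Bool,
    V (x p, x q) a * ρ (update₂ x p q a) (update₂ y p q b) * star (V (y p, y q) b)

/-- Measurement of the qubit `p` in the computational basis, `ρ ↦ P₀ ρ P₀ + P₁ ρ P₁`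
(there is no controller that could use the outcome). -/
def applyMeas {k : ℕ} (p : Site k) (ρ : State k) : State k :=
  fun x y => if x p = y p then ρ x y else 0

/-! ### Basic operations -/

/-- The unitary basic operations of the hardware. Measurement in the computational basis is
always a basic operation too, see `Instr.meas`. -/
structure GateSet where
  /-- the single-qubit unitaries among the basic operations -/
  one : Set U1
  /-- the two-qubit unitaries among the basic operations -/
  two : Set U2

/-- The unitaries that one unitary basic operation can induce on an ordered pair of qubits. -/
def GateSet.onPair (G : GateSet) : Set (Matrix (Bool × Bool) (Bool × Bool) ℂ) :=
  {M | (∃ V ∈ G.one, M = (V : Matrix Bool Bool ℂ) ⊗ₖ (1 : Matrix Bool Bool ℂ)) ∨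
       (∃ V ∈ G.one, M = (1 : Matrix Bool Bool ℂ) ⊗ₖ (V : Matrix Bool Bool ℂ)) ∨
       (∃ V ∈ G.two, M = (V : Matrix (Bool × Bool) (Bool × Bool) ℂ)) ∨
       (∃ V ∈ G.two, M = (V : Matrix (Bool × Bool) (Bool × Bool) ℂ).submatrix
          Prod.swap Prod.swap)}

/-- `V` is, up to a global phase, a product of at most `L` basic operations on the pair. -/
def GateSet.Constructs (G : GateSet) (L : ℕ) (V : U2) : Prop :=
  ∃ w : List (Matrix (Bool × Bool) (Bool × Bool) ℂ), w.length ≤ L ∧ (∀ M ∈ w, M ∈ G.onPair) ∧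
    ∃ c : ℂ, ‖c‖ = 1 ∧ (V : Matrix (Bool × Bool) (Bool × Bool) ℂ) = c • w.prod

/-- Every one- or two-qubit unitary can be constructed from the basic operations
(a one-qubit unitary `V` is the two-qubit unitary `V ⊗ 1`). -/
def GateSet.Universal (G : GateSet) : Prop :=
  ∀ V : U2, ∃ L : ℕ, G.Constructs L V

/-- Every one- or two-qubit unitary can be constructed from at most `L` basic operations. -/
def GateSet.UniversalWithin (G : GateSet) (L : ℕ) : Prop :=
  ∀ V : U2, G.Constructs L V

/-! ### Circuits

The gates are referred to by names in the types `A` (single-qubit) and `B` (two-qubit). -/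

/-- A basic operation together with the qubits it is applied to. -/
inductive Instr (k : ℕ) (A B : Type) : Type
  | one (a : A) (p : Site k)
  | two (b : B) (p q : Site k)
  | meas (p : Site k)

/-- The qubits that an operation acts on. -/
def Instr.support {k : ℕ} {A B : Type} : Instr k A B → Finset (Site k)
  | .one _ p => {p}
  | .two _ p q => {p, q}
  | .meas p => {p}

/-- Two-qubit operations are only allowed between neighbours. -/
def Instr.Local {k : ℕ} {A B : Type} : Instr k A B → Prop
  | .one _ _ => True
  | .two _ p q => Adjacent p q
  | .meas _ => True

/-- The effect of one operation on the state; `u₁` and `u₂` interpret the names of the gates. -/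
def Instr.apply {k : ℕ} {A B : Type} (u₁ : A → U1) (u₂ : B → U2) :
    Instr k A B → State k → State k
  | .one a p => applyOne (u₁ a : Matrix Bool Bool ℂ) p
  | .two b p q => applyTwo (u₂ b : Matrix (Bool × Bool) (Bool × Bool) ℂ) p q
  | .meas p => applyMeas p

/-- The operations performed in one timestep. -/
abbrev Layer (k : ℕ) (A B : Type) : Type := List (Instr k A B)

/-- The sequence `S₁, …, S_d` of timesteps, the first one at the head. -/
abbrev Circuit (k : ℕ) (A B : Type) : Type := List (Layer k A B)

/-- In every timestep the operations are local and act on pairwise disjoint sets of qubits. -/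
def Circuit.WellFormed {k : ℕ} {A B : Type} (c : Circuit k A B) : Prop :=
  ∀ S ∈ c, (∀ o ∈ S, o.Local) ∧ S.Pairwise fun o o' => Disjoint o.support o'.support

/-- The number of timesteps. -/
def Circuit.depth {k : ℕ} {A B : Type} (c : Circuit k A B) : ℕ := c.length

/-- The number of operations. -/
def Circuit.size {k : ℕ} {A B : Type} (c : Circuit k A B) : ℕ := (c.map List.length).sum

/-- The set of qubits that the circuit acts on. -/
def Circuit.qubits {k : ℕ} {A B : Type} (c : Circuit k A B) : Finset (Site k) :=
  (c.flatten.map Instr.support).foldr (· ∪ ·) ∅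

/-- The number of qubits that the circuit acts on. -/
def Circuit.width {k : ℕ} {A B : Type} (c : Circuit k A B) : ℕ := c.qubits.card

/-- The effect of a circuit on the state. -/
def Circuit.run {k : ℕ} {A B : Type} (u₁ : A → U1) (u₂ : B → U2) (c : Circuit k A B)
    (ρ : State k) : State k :=
  c.foldl (fun ρ S => S.foldl (fun ρ o => o.apply u₁ u₂ ρ) ρ) ρ

/-! ### Circuits as words over a finite alphabet -/

/-- The symbols used to write down circuits. -/
inductive Letter (A B : Type) : Type
  | layer
  | one (a : A)
  | two (b : B)
  | meas
  | plus
  | minus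
  | tick

/-- An integer is written as its sign followed by its absolute value in unary. -/
def encodeInt {A B : Type} (z : ℤ) : List (Letter A B) :=
  (if 0 ≤ z then .plus else .minus) :: List.replicate z.natAbs .tick

/-- A grid point is written as the list of its coordinates. -/
def encodeSite {k : ℕ} {A B : Type} (p : Site k) : List (Letter A B) :=
  (List.ofFn fun i => encodeInt (p i)).flatten

/-- An operation is written as its name followed by the qubits it is applied to. -/
def Instr.encode {k : ℕ} {A B : Type} : Instr k A B → List (Letter A B)
  | .one a p => .one a :: encodeSite p
  | .two b p q => .two b :: (encodeSite p ++ encodeSite q)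
  | .meas p => .meas :: encodeSite p

/-- A circuit is written timestep by timestep, each introduced by the symbol `layer`. -/
def Circuit.encode {k : ℕ} {A B : Type} (c : Circuit k A B) : List (Letter A B) :=
  c.flatMap fun S => .layer :: S.flatMap Instr.encode

/-! ### The model -/

/-- A family of quantum circuits in `k`-dimensional NANTC with basic operations from `G` (and
measurements). The circuits use finitely many different gates, and the sequence of sets of
operations is computed from the size `n` of the input (in unary) by a Turing machine in
polynomial time. The machine is deterministic, a special case of a randomized one. -/
structure Family (k : ℕ) (G : GateSet) where
  /-- number of different single-qubit gates in use -/
  g₁ : ℕ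
  /-- number of different two-qubit gates in use -/
  g₂ : ℕ
  /-- the single-qubit gates in use -/
  u₁ : Fin g₁ → U1
  /-- the two-qubit gates in use -/
  u₂ : Fin g₂ → U2
  u₁_mem : ∀ a, u₁ a ∈ G.one
  u₂_mem : ∀ b, u₂ b ∈ G.two
  /-- the circuit for inputs of size `n` -/
  circuit : ℕ → Circuit k (Fin g₁) (Fin g₂)
  wellFormed : ∀ n, (circuit n).WellFormed
  polyTime : Nonempty
    (Turing.TM2ComputableInPolyTime Computability.unaryEncodeNat Circuit.encode circuit)

/-! ### Controlled operations -/

/-- The controlled-`U` operation with `n` controls: the unitary on `n` control qubits and a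
target qubit that applies `U` to the target if all controls are `1`, and nothing otherwise. -/
def controlled (n : ℕ) (U : Matrix Bool Bool ℂ) :
    Matrix ((Fin n → Bool) × Bool) ((Fin n → Bool) × Bool) ℂ :=
  fun s t => if s.1 = t.1 then
      (if ∀ i, s.1 i = true then U s.2 t.2 else (1 : Matrix Bool Bool ℂ) s.2 t.2)
    else 0

/-- The places of `n` control qubits and of the target qubit, all different. -/
structure Layout (k n : ℕ) where
  /-- the places of the controls -/
  ctrl : Fin n ↪ Site k
  /-- the place of the target -/
  target : Site k
  target_ne : ∀ i, ctrl i ≠ target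

open Classical in
/-- `σ ⊗ |0⋯0⟩⟨0⋯0|`: the controls and the target are in the state `σ`, all other qubits
(the ancillas) are `|0⟩`. -/
def Layout.embed {k n : ℕ} (l : Layout k n)
    (σ : Matrix ((Fin n → Bool) × Bool) ((Fin n → Bool) × Bool) ℂ) : State k :=
  fun x y =>
    if ∀ p : Site k, (∀ i, p ≠ l.ctrl i) → p ≠ l.target → x p = false ∧ y p = false then
      σ (fun i => x (l.ctrl i), x l.target) (fun i => y (l.ctrl i), y l.target)
    else 0

/-- The `n`-th circuit of the family implements the controlled-`U` operation with `n` controls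
exactly, for some placement of the controls and the target. The ancillas start
in `|0⟩` and are returned to `|0⟩`. -/
def Family.ImplementsControlled {k : ℕ} {G : GateSet} (F : Family k G) (U : U1) (n : ℕ) : Prop :=
  ∃ l : Layout k n, ∀ σ : Matrix ((Fin n → Bool) × Bool) ((Fin n → Bool) × Bool) ℂ,
    (F.circuit n).run F.u₁ F.u₂ (l.embed σ) =
      l.embed (controlled n U * σ * (controlled n U)ᴴ)

end NANTC

end

noncomputable section

namespace NANTC

/-! ### Counter programs and their translation into Turing machines -/

/-! Let `m` be the least number with `n ≤ m ^ k`. The controls occupy `n` of the points `2 y` with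
`1 ≤ y i ≤ m`; points with an odd coordinate serve as ancillas, and the target is a neighbour of the
corner `(2m, …, 2m)`, just outside the cube. A product of controls is the negation of a disjunction
of negated bits, so it suffices to flip the controls, to collect their disjunction at the corner, to
apply `U` to the target if the corner holds `0`, and to undo the rest.

The disjunction is collected direction by direction. In direction `j` a whole slab of points is
merged into the next slab, `m` times in a row; afterwards all information lies on the face where
coordinate `j` is maximal. This takes `k * m` timesteps, hence depth of order `n ^ (1/k)`, and each
point is a source at most once, hence size of order `m ^ k`, which is of order `n`. Width is at most
twice the size.

One merge involves a source `a`, a destination `b` at distance two and the ancilla `t` between them.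
Since `t` starts in `|0⟩`, three two-qubit gates between neighbours suffice (`Junction.op_ket`):
conjugating a `Z` conditioned on `a` by a Hadamard conditioned on `b` turns `t` into `¬(a ∨ b)`, and
exchanging `b` and `t` with a negation stores the disjunction at `b` and saves the old bit in `t`.
`foldl_junction` gives the invariant that no source is used again while the disjunction over the
remaining places stays the same; `pairwise_junctions`, `junctions_spec` and `treePlaces_diff` verify
this on the grid, and `mainPlan_ket` is the resulting action on basis states.

Each abstract gate is a word of at most `L` basic operations up to a phase. A density operator is
handled as a mixture `∑ σ s t |ψ s⟩⟨ψ t|` (`mix`), so only vectors need to be followed and global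
phases cancel (`Plan.run_circuit_mix`). No measurement is needed.

For uniformity, the description of the circuit is written by a counter program built from nested
loops (`runs_mainProg`), and counter programs are simulated by a multi-stack machine with one step
per unit of time (`Runs.reachesIn`, `nonempty_polyTime_of_runs`). All loops run over coordinates up
to `m ≤ n` and their nesting depth depends on `k` only, so the time is polynomial. The constant is
computed in `exists_family`. -/

/-- Structured programs that work on the counters `R` and write symbols from `α`. -/
inductive Prog (R α : Type) : Type
  | skip
  | emit (a : α)
  | inc (r : R)
  | seq (p q : Prog R α)
  | loop (r : R) (p : Prog R α)
  | cond (r : R) (p : Prog R α)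

/-- The values of the counters and the symbols written so far. -/
structure Store (R α : Type) : Type where
  /-- the counters -/
  reg : R → ℕ
  /-- the output -/
  out : List α

section

variable {R α : Type} [DecidableEq R]

/-- `Runs p S S' t`: started in `S`, the program `p` ends in `S'` after at most `t` steps.
Both `loop r p` and `cond r p` test whether `r` is positive, and decrease it in this case
before `p` is executed. -/
inductive Runs : Prog R α → Store R α → Store R α → ℕ → Prop
  | skip (S : Store R α) : Runs .skip S S 1
  | emit (a : α) (S : Store R α) : Runs (.emit a) S ⟨S.reg, S.out ++ [a]⟩ 1
  | inc (r : R) (S : Store R α) :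
      Runs (.inc r) S ⟨Function.update S.reg r (S.reg r + 1), S.out⟩ 1
  | seq {p q : Prog R α} {S S' S'' : Store R α} {t t' : ℕ} :
      Runs p S S' t → Runs q S' S'' t' → Runs (.seq p q) S S'' (t + t')
  | loop_zero {r : R} {p : Prog R α} {S : Store R α} : S.reg r = 0 → Runs (.loop r p) S S 1
  | loop_succ {r : R} {p : Prog R α} {S S' S'' : Store R α} {v t t' : ℕ} : S.reg r = v + 1 →
      Runs p ⟨Function.update S.reg r v, S.out⟩ S' t → Runs (.loop r p) S' S'' t' →
      Runs (.loop r p) S S'' (t + 1 + t')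
  | cond_zero {r : R} {p : Prog R α} {S : Store R α} : S.reg r = 0 → Runs (.cond r p) S S 1
  | cond_succ {r : R} {p : Prog R α} {S S' : Store R α} {v t : ℕ} : S.reg r = v + 1 →
      Runs p ⟨Function.update S.reg r v, S.out⟩ S' t → Runs (.cond r p) S S' (t + 1)
  | weaken {p : Prog R α} {S S' : Store R α} {t t' : ℕ} : Runs p S S' t → t ≤ t' →
      Runs p S S' t'

/-- A step writes at most one symbol. This bounds the time that reversing the output takes later. -/
theorem Runs.length_out_le {p : Prog R α} {S S' : Store R α} {t : ℕ} (h : Runs p S S' t) :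
    S'.out.length ≤ S.out.length + t := by
  induction h with
  | emit => simp
  | _ => (try dsimp only at *); omega

end

/-- The labels of the machine that executes a program. -/
def Prog.Label {R α : Type} : Prog R α → Type
  | .skip => Unit
  | .emit _ => Unit
  | .inc _ => Unit
  | .seq p q => p.Label ⊕ q.Label
  | .loop _ p => Option p.Label
  | .cond _ p => Option p.Label

instance Prog.finiteLabel {R α : Type} : (p : Prog R α) → Finite p.Label
  | .skip => inferInstanceAs (Finite Unit)
  | .emit _ => inferInstanceAs (Finite Unit)
  | .inc _ => inferInstanceAs (Finite Unit)
  | .seq p q =>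
    have := p.finiteLabel
    have := q.finiteLabel
    inferInstanceAs (Finite (p.Label ⊕ q.Label))
  | .loop _ p =>
    have := p.finiteLabel
    inferInstanceAs (Finite (Option p.Label))
  | .cond _ p =>
    have := p.finiteLabel
    inferInstanceAs (Finite (Option p.Label))

/-- The label at which the execution of a program starts. -/
def Prog.entry {R α : Type} : (p : Prog R α) → p.Label
  | .skip => ()
  | .emit _ => ()
  | .inc _ => ()
  | .seq p _ => Sum.inl p.entry
  | .loop _ _ => none
  | .cond _ _ => none

/-- The stacks of the machine: one for each counter, one for the output in reverse order and
one for the output. -/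
inductive Stack (R : Type) : Type
  | reg (r : R)
  | work
  | out

instance Stack.finite {R : Type} [Finite R] : Finite (Stack R) :=
  Finite.of_surjective
    (fun x : R ⊕ Bool => x.elim Stack.reg fun b => if b then Stack.work else Stack.out) fun s =>
    match s with
    | .reg r => ⟨Sum.inl r, rfl⟩
    | .work => ⟨Sum.inr true, rfl⟩
    | .out => ⟨Sum.inr false, rfl⟩

/-- The alphabets of the stacks. -/
abbrev Stack.Alphabet {R : Type} (α : Type) : Stack R → Type
  | .reg _ => Bool
  | .work => α
  | .out => α

section

variable {R α : Type}

/-- Take one unit from a counter, and branch on whether this is possible. -/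
def popStmt [Inhabited α] {Λ : Type} (r : R) (yes no : Λ) :
    Turing.TM2.Stmt (Stack.Alphabet (R := R) α) Λ (Option α) :=
  .pop (.reg r) (fun _ o => o.map fun _ => default)
    (.branch Option.isSome (.load (fun _ => none) (.goto fun _ => yes)) (.goto fun _ => no))

/-- The statements of the machine that executes a program and continues at `exit`. -/
def Prog.stmt [Inhabited α] {Λ : Type} : (p : Prog R α) → (p.Label → Λ) → Λ → p.Label →
    Turing.TM2.Stmt (Stack.Alphabet (R := R) α) Λ (Option α)
  | .skip, _, exit, _ => .goto fun _ => exit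
  | .emit a, _, exit, _ => .push .work (fun _ => a) (.goto fun _ => exit)
  | .inc r, _, exit, _ => .push (.reg r) (fun _ => true) (.goto fun _ => exit)
  | .seq p q, emb, exit, l => Sum.casesOn l
      (fun l => p.stmt (fun x => emb (Sum.inl x)) (emb (Sum.inr q.entry)) l)
      (fun l => q.stmt (fun x => emb (Sum.inr x)) exit l)
  | .loop r p, emb, exit, l => Option.casesOn l (popStmt r (emb (some p.entry)) exit)
      (fun l => p.stmt (fun x => emb (some x)) (emb none) l)
  | .cond r p, emb, exit, l => Option.casesOn l (popStmt r (emb (some p.entry)) exit)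
      (fun l => p.stmt (fun x => emb (some x)) exit l)

/-- The contents of the stacks that represent a store. -/
def Store.stacks (S : Store R α) : (s : Stack R) → List (Stack.Alphabet α s)
  | .reg r => List.replicate (S.reg r) true
  | .work => S.out.reverse
  | .out => []

variable [DecidableEq (Stack R)]

/-- The machine is at the label `l` and its stacks represent `S`. -/
def Store.config {Λ : Type} (S : Store R α) (l : Λ) :
    Turing.TM2.Cfg (Stack.Alphabet (R := R) α) Λ (Option α) :=
  ⟨some l, none, S.stacks⟩

theorem Store.update_stacks_reg [DecidableEq R] (S : Store R α) (r : R) (v : ℕ) :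
    Function.update S.stacks (.reg r) (List.replicate v true) =
      Store.stacks ⟨Function.update S.reg r v, S.out⟩ := by
  funext s
  cases s with
  | reg q =>
    by_cases h : q = r
    · subst h; simp [Store.stacks]
    · rw [Function.update_of_ne (by simpa using h)]
      simp [Store.stacks, h]
  | work => rw [Function.update_of_ne (by simp)]; rfl
  | out => rw [Function.update_of_ne (by simp)]; rfl

theorem Store.update_stacks_work (S : Store R α) (l : List α) :
    Function.update S.stacks .work l.reverse = Store.stacks ⟨S.reg, l⟩ := by
  funext s
  cases s with
  | reg q => rw [Function.update_of_ne (by simp)]; rfl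
  | work => simp [Store.stacks]
  | out => rw [Function.update_of_ne (by simp)]; rfl

/-! ### Simulation of programs by machines -/

/-- `c'` is reached from `c` in at most `t` steps of the machine `M`. -/
def ReachesIn {Λ : Type} (M : Λ → Turing.TM2.Stmt (Stack.Alphabet (R := R) α) Λ (Option α))
    (c c' : Turing.TM2.Cfg (Stack.Alphabet (R := R) α) Λ (Option α)) (t : ℕ) : Prop :=
  ∃ s ≤ t, (flip bind (Turing.TM2.step M))^[s] (some c) = some c'

theorem ReachesIn.trans {Λ : Type}
    {M : Λ → Turing.TM2.Stmt (Stack.Alphabet (R := R) α) Λ (Option α)}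
    {c c' c'' : Turing.TM2.Cfg (Stack.Alphabet (R := R) α) Λ (Option α)} {t t' : ℕ}
    (h : ReachesIn M c c' t) (h' : ReachesIn M c' c'' t') : ReachesIn M c c'' (t + t') := by
  obtain ⟨s, hs, e⟩ := h
  obtain ⟨s', hs', e'⟩ := h'
  refine ⟨s' + s, by omega, ?_⟩
  rw [Function.iterate_add_apply, e, e']

theorem ReachesIn.single {Λ : Type}
    {M : Λ → Turing.TM2.Stmt (Stack.Alphabet (R := R) α) Λ (Option α)}
    {c c' : Turing.TM2.Cfg (Stack.Alphabet (R := R) α) Λ (Option α)}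
    (h : Turing.TM2.step M c = some c') : ReachesIn M c c' 1 :=
  ⟨1, le_rfl, h⟩

theorem reachesIn_popStmt_zero [Inhabited α] [DecidableEq R] {Λ : Type}
    {M : Λ → Turing.TM2.Stmt (Stack.Alphabet (R := R) α) Λ (Option α)} {l yes no : Λ} {r : R}
    (hM : M l = popStmt r yes no) {S : Store R α} (hS : S.reg r = 0) :
    ReachesIn M (S.config l) (S.config no) 1 := by
  refine ReachesIn.single ?_
  have e : S.stacks (.reg r) = List.replicate 0 true := by simp [Store.stacks, hS]
  have e' : Function.update S.stacks (.reg r) [] = S.stacks := by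
    have := S.update_stacks_reg r 0
    rw [List.replicate_zero] at this
    rw [this, ← hS, Function.update_eq_self]
  simp only [Store.config, Turing.TM2.step, hM, popStmt, Turing.TM2.stepAux, e]
  simp [e']

theorem reachesIn_popStmt_succ [Inhabited α] [DecidableEq R] {Λ : Type}
    {M : Λ → Turing.TM2.Stmt (Stack.Alphabet (R := R) α) Λ (Option α)} {l yes no : Λ} {r : R}
    (hM : M l = popStmt r yes no) {S : Store R α} {v : ℕ} (hS : S.reg r = v + 1) :
    ReachesIn M (S.config l) (Store.config ⟨Function.update S.reg r v, S.out⟩ yes) 1 := by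
  refine ReachesIn.single ?_
  have e : S.stacks (.reg r) = List.replicate (v + 1) true := by simp [Store.stacks, hS]
  simp only [Store.config, Turing.TM2.step, hM, popStmt, Turing.TM2.stepAux, e]
  simp [List.replicate_succ, ← Store.update_stacks_reg]

/-- Every unit of time pays for one machine step. The machine is arbitrary except that it contains
the code of `p` at the labels `emb`; with `emb` and `exit` quantified inside, the induction
hypothesis applies to subprograms sitting in a larger machine. -/
theorem Runs.reachesIn [Inhabited α] [DecidableEq R] {Λ : Type}
    {M : Λ → Turing.TM2.Stmt (Stack.Alphabet (R := R) α) Λ (Option α)}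
    {p : Prog R α} {S S' : Store R α} {t : ℕ} (h : Runs p S S' t) :
    ∀ (emb : p.Label → Λ) (exit : Λ), (∀ l, M (emb l) = p.stmt emb exit l) →
      ReachesIn M (S.config (emb p.entry)) (S'.config exit) t := by
  induction h with
  | skip S =>
    intro emb exit hM
    refine ReachesIn.single ?_
    simp [Store.config, Turing.TM2.step, hM, Prog.stmt]
  | emit a S =>
    intro emb exit hM
    refine ReachesIn.single ?_
    simp only [Store.config, Turing.TM2.step, hM, Prog.stmt, Turing.TM2.stepAux,
      ← Store.update_stacks_work]
    simp [Store.stacks]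
  | inc r S =>
    intro emb exit hM
    refine ReachesIn.single ?_
    simp only [Store.config, Turing.TM2.step, hM, Prog.stmt, Turing.TM2.stepAux,
      ← Store.update_stacks_reg]
    simp [Store.stacks, List.replicate_succ]
  | seq _ _ ih ih' =>
    intro emb exit hM
    exact (ih (fun x => emb (Sum.inl x)) _ fun l => hM (Sum.inl l)).trans
      (ih' (fun x => emb (Sum.inr x)) exit fun l => hM (Sum.inr l))
  | loop_zero hS =>
    intro emb exit hM
    exact reachesIn_popStmt_zero (hM none) hS
  | loop_succ hS _ _ ih ih' =>
    intro emb exit hM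
    -- The body exits to the test of the loop, so the remaining rounds start again at the entry with
    -- the same `emb` and `exit`.
    rw [Nat.add_comm _ 1]
    exact ((reachesIn_popStmt_succ (hM none) hS).trans
      (ih (fun x => emb (some x)) (emb none) fun l => hM (some l))).trans (ih' emb exit hM)
  | cond_zero hS =>
    intro emb exit hM
    exact reachesIn_popStmt_zero (hM none) hS
  | cond_succ hS _ ih =>
    intro emb exit hM
    rw [Nat.add_comm _ 1]
    exact (reachesIn_popStmt_succ (hM none) hS).trans
      (ih (fun x => emb (some x)) exit fun l => hM (some l))
  | weaken _ hle ih =>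
    intro emb exit hM
    obtain ⟨s, hs, e⟩ := ih emb exit hM
    exact ⟨s, hs.trans hle, e⟩

/-! ### Reversing the output -/

/-- The statements of the machine that executes `p` and then reverses the output. -/
def Prog.machineStmt [Inhabited α] (p : Prog R α) : Option p.Label →
    Turing.TM2.Stmt (Stack.Alphabet (R := R) α) (Option p.Label) (Option α)
  | none => .pop .work (fun _ o => o) (.branch Option.isSome
      (.push .out (fun o => o.getD default) (.load (fun _ => none) (.goto fun _ => none))) .halt)
  | some l => p.stmt some none l

/-- The stacks while the output is being reversed. -/
def reversingStacks (l l' : List α) : (s : Stack R) → List (Stack.Alphabet α s)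
  | .reg _ => []
  | .work => l
  | .out => l'

/-- The symbol written last is on top of `work`, so moving symbols one by one to `out` restores the
order. The extra step is the failing pop that leads to the halt. All counters are empty here because
a halting machine may leave nothing but its output. -/
theorem reachesIn_reversing [Inhabited α] (p : Prog R α) (l l' : List α) :
    ReachesIn p.machineStmt ⟨some none, none, reversingStacks l l'⟩
      ⟨none, none, reversingStacks [] (l.reverse ++ l')⟩ (l.length + 1) := by
  induction l generalizing l' with
  | nil =>
    refine ReachesIn.single ?_
    have : Function.update (reversingStacks (R := R) [] l') .work [] = reversingStacks [] l' := by
      funext s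
      cases s <;> simp [Function.update, reversingStacks]
    simp [Turing.TM2.step, Prog.machineStmt, reversingStacks, this]
  | cons a l ih =>
    have h : Turing.TM2.step p.machineStmt ⟨some none, none, reversingStacks (a :: l) l'⟩ =
        some ⟨some none, none, reversingStacks l (a :: l')⟩ := by
      have : Function.update (Function.update (reversingStacks (R := R) (a :: l) l') .work l)
          .out (a :: l') = reversingStacks l (a :: l') := by
        funext s
        cases s <;> simp [Function.update, reversingStacks]
      simp [Turing.TM2.step, Prog.machineStmt, reversingStacks, ← this]
    have := (ReachesIn.single h).trans (ih (a :: l'))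
    rw [Nat.add_comm] at this
    simpa using this

end

/-- A function whose values are written by a program in polynomial time is computed by a Turing
machine in polynomial time. -/
theorem nonempty_polyTime_of_runs {R α β : Type} [DecidableEq R] [Finite R] [Finite α]
    [Inhabited α]
    (p : Prog R α) (r₀ : R) (f : ℕ → β) (eb : β → List α) (T : Polynomial ℕ)
    (h : ∀ n, Runs p ⟨Function.update 0 r₀ n, []⟩ ⟨0, eb (f n)⟩ (T.eval n)) :
    Nonempty (Turing.TM2ComputableInPolyTime Computability.unaryEncodeNat eb f) := by
  classical
  have hlen : ∀ n, (Computability.unaryEncodeNat n).length = n := fun n => by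
    induction n with
    | zero => rfl
    | succ n ih => simp [Computability.unaryEncodeNat, ih]
  have hrep : ∀ n, Computability.unaryEncodeNat n = List.replicate n true := fun n => by
    induction n with
    | zero => rfl
    | succ n ih => rw [Computability.unaryEncodeNat, ih, List.replicate_succ]
  let tm : Turing.FinTM2 :=
    { K := Stack R
      kDecidableEq := inferInstance
      kFin := Fintype.ofFinite _
      k₀ := .reg r₀
      k₁ := .out
      Γ := Stack.Alphabet α
      Λ := Option p.Label
      main := some p.entry
      ΛFin := Fintype.ofFinite _
      σ := Option α
      initialState := none
      σFin := Fintype.ofFinite _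
      Γk₀Fin := inferInstanceAs (Fintype Bool)
      m := p.machineStmt }
  -- At most `T` steps for the program, at most `T` for moving the symbols, because the output is no
  -- longer than the time spent, and one for the final failing pop.
  have key : ∀ n, ∃ s ≤ (2 * T + 1).eval n, (flip bind tm.step)^[s]
      (some (Turing.initList tm (List.map id (Computability.unaryEncodeNat n)))) =
      some (Turing.haltList tm (List.map id (eb (f n)))) := fun n => by
    have h₁ := (h n).reachesIn (M := p.machineStmt) some none fun _ => rfl
    have h₂ := reachesIn_reversing p (eb (f n)).reverse []
    have hl := (h n).length_out_le
    have e₁ : Turing.initList tm (List.map id (Computability.unaryEncodeNat n)) =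
        Store.config ⟨Function.update 0 r₀ n, []⟩ (some p.entry) := by
      unfold Turing.initList Store.config
      congr 1
      funext s
      by_cases hs : s = .reg r₀
      · subst hs
        simp [tm, Store.stacks, hrep]
      · cases s with
        | reg r =>
          have : r ≠ r₀ := fun e => hs (by rw [e])
          simp [tm, Store.stacks, this]
        | work => simp [tm, Store.stacks]
        | out => simp [tm, Store.stacks]
    have e₂ : Turing.haltList tm (List.map id (eb (f n))) =
        ⟨none, none, reversingStacks [] (eb (f n))⟩ := by
      unfold Turing.haltList
      congr 1
      funext s
      cases s <;> simp [tm, reversingStacks]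
    have e₃ : Store.config (⟨0, eb (f n)⟩ : Store R α) (none : Option p.Label) =
        ⟨some none, none, reversingStacks (eb (f n)).reverse []⟩ := by
      unfold Store.config
      congr 1
    rw [e₃] at h₁
    obtain ⟨s, hs, e⟩ := h₁.trans h₂
    refine ⟨s, hs.trans ?_, ?_⟩
    · simp at hl ⊢
      omega
    · rw [e₁, e₂]
      rw [List.reverse_reverse, List.append_nil] at e
      exact e
  choose s hs e using key
  exact ⟨{ tm := tm
           inputAlphabet := Equiv.refl Bool
           outputAlphabet := Equiv.refl α
           time := 2 * T + 1
           outputsFun := fun n =>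
            { steps := s n
              evals_in_steps := e n
              steps_le_m := by rw [hlen]; exact hs n } }⟩

/-! ### Products in the order of execution -/

/-- The product of a list, in which the head of the list is the rightmost factor. -/
def seqProd {M : Type*} [Monoid M] : List M → M
  | [] => 1
  | a :: l => seqProd l * a

theorem seqProd_append {M : Type*} [Monoid M] (l l' : List M) :
    seqProd (l ++ l') = seqProd l' * seqProd l := by
  induction l with
  | nil => simp [seqProd]
  | cons a l ih => simp [seqProd, ih, mul_assoc]

/-- Translates between the order of matrix products and the order of execution. -/
theorem seqProd_reverse {M : Type*} [Monoid M] (l : List M) : seqProd l.reverse = l.prod := by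
  induction l with
  | nil => rfl
  | cons a l ih => simp [seqProd_append, ih, seqProd]

theorem commute_seqProd {M : Type*} [Monoid M] {l : List M} {a : M}
    (h : ∀ b ∈ l, Commute b a) : Commute (seqProd l) a := by
  induction l with
  | nil => exact Commute.one_left a
  | cons b l ih =>
    exact (ih fun c hc => h c (List.mem_cons_of_mem b hc)).mul_left (h b List.mem_cons_self)

/-- Turns an execution element by element into an execution layer by layer: `g` first everywhere,
then `f` everywhere. Only the `g` of a later element has to pass the `f` of an earlier one, so `f a`
and `g a` themselves need not commute. -/
theorem seqProd_map_mul {M ι : Type*} [Monoid M] {l : List ι} {f g : ι → M}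
    (h : l.Pairwise fun a b => Commute (g b) (f a)) :
    seqProd (l.map fun a => f a * g a) = seqProd (l.map f) * seqProd (l.map g) := by
  induction l with
  | nil => simp [seqProd]
  | cons a l ih =>
    rw [List.pairwise_cons] at h
    have hc : Commute (seqProd (l.map g)) (f a) := commute_seqProd fun b hb => by
      obtain ⟨c, hc, rfl⟩ := List.mem_map.1 hb
      exact h.1 c hc
    simp only [List.map_cons, seqProd, ih h.2]
    rw [mul_assoc, mul_assoc, ← mul_assoc (seqProd (l.map g)), hc.eq, mul_assoc]

/-! ### Operators on amplitudes -/

/-- Amplitudes in the computational basis. -/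
abbrev Amp (k : ℕ) : Type := Config k → ℂ

/-- `V` acting on the qubits `p` and `q`. -/
def op {k : ℕ} (V : Matrix (Bool × Bool) (Bool × Bool) ℂ) (p q : Site k) :
    Module.End ℂ (Amp k) where
  toFun ψ x := ∑ a : Bool × Bool, V (x p, x q) a * ψ (update₂ x p q a)
  map_add' ψ φ := by
    funext x
    simp [mul_add, Finset.sum_add_distrib]
  map_smul' c ψ := by
    funext x
    simp only [Pi.smul_apply, smul_eq_mul, Finset.mul_sum, RingHom.id_apply]
    exact Finset.sum_congr rfl fun a _ => by ring

theorem op_apply {k : ℕ} (V : Matrix (Bool × Bool) (Bool × Bool) ℂ) (p q : Site k) (ψ : Amp k)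
    (x : Config k) : op V p q ψ x = ∑ a : Bool × Bool, V (x p, x q) a * ψ (update₂ x p q a) :=
  rfl

section update₂

variable {k : ℕ} {p q : Site k} (x : Config k) (a : Bool × Bool)

theorem update₂_fst (h : p ≠ q) : update₂ x p q a p = a.1 := by
  simp [update₂, h]

theorem update₂_snd : update₂ x p q a q = a.2 := by
  simp [update₂]

theorem update₂_of_ne {z : Site k} (hp : z ≠ p) (hq : z ≠ q) : update₂ x p q a z = x z := by
  simp [update₂, hp, hq]

theorem update₂_update₂ (b : Bool × Bool) :
    update₂ (update₂ x p q a) p q b = update₂ x p q b := by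
  funext z
  by_cases hq : z = q
  · subst hq; simp [update₂]
  · by_cases hp : z = p
    · subst hp; simp [update₂, hq]
    · simp [update₂, hp, hq]

theorem update₂_self : update₂ x p q (x p, x q) = x := by
  funext z
  by_cases hq : z = q
  · subst hq; simp [update₂]
  · by_cases hp : z = p
    · subst hp; simp [update₂, hq]
    · simp [update₂, hq]

theorem update₂_comm {p' q' : Site k} (b : Bool × Bool) (h₁ : p ≠ p') (h₂ : p ≠ q')
    (h₃ : q ≠ p') (h₄ : q ≠ q') :
    update₂ (update₂ x p q a) p' q' b = update₂ (update₂ x p' q' b) p q a := by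
  unfold update₂
  funext z
  simp only [Function.update_apply]
  split_ifs <;> simp_all

end update₂

theorem op_mul {k : ℕ} (V W : Matrix (Bool × Bool) (Bool × Bool) ℂ) {p q : Site k} (h : p ≠ q) :
    op (V * W) p q = op V p q * op W p q := by
  refine LinearMap.ext fun ψ => funext fun x => ?_
  simp only [Module.End.mul_apply, op_apply, Matrix.mul_apply, update₂_fst _ _ h, update₂_snd,
    update₂_update₂, Finset.mul_sum, Finset.sum_mul]
  rw [Finset.sum_comm]
  exact Finset.sum_congr rfl fun a _ => Finset.sum_congr rfl fun b _ => by ring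

theorem op_one {k : ℕ} (p q : Site k) : op 1 p q = 1 := by
  refine LinearMap.ext fun ψ => funext fun x => ?_
  simp [op_apply, Matrix.one_apply, update₂_self]

theorem op_smul {k : ℕ} (c : ℂ) (V : Matrix (Bool × Bool) (Bool × Bool) ℂ) (p q : Site k) :
    op (c • V) p q = c • op V p q := by
  refine LinearMap.ext fun ψ => funext fun x => ?_
  simp [op_apply, Finset.mul_sum, mul_assoc]

/-- The two pairs of qubits have no qubit in common. -/
def Apart {k : ℕ} (a b : Site k × Site k) : Prop :=
  a.1 ≠ b.1 ∧ a.1 ≠ b.2 ∧ a.2 ≠ b.1 ∧ a.2 ≠ b.2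

theorem Apart.symm {k : ℕ} {a b : Site k × Site k} (h : Apart a b) : Apart b a :=
  ⟨h.1.symm, h.2.2.1.symm, h.2.1.symm, h.2.2.2.symm⟩

theorem Apart.commute_op {k : ℕ} {a b : Site k × Site k} (h : Apart a b)
    (V W : Matrix (Bool × Bool) (Bool × Bool) ℂ) :
    Commute (op V a.1 a.2) (op W b.1 b.2) := by
  obtain ⟨h₁, h₂, h₃, h₄⟩ := h
  refine LinearMap.ext fun ψ => funext fun x => ?_
  simp only [Module.End.mul_apply, op_apply, Finset.mul_sum,
    update₂_of_ne x _ h₁.symm h₃.symm, update₂_of_ne x _ h₂.symm h₄.symm,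
    update₂_of_ne x _ h₁ h₂, update₂_of_ne x _ h₃ h₄]
  rw [Finset.sum_comm]
  refine Finset.sum_congr rfl fun c _ => Finset.sum_congr rfl fun d _ => ?_
  rw [update₂_comm x d c h₁ h₂ h₃ h₄]
  ring

open Classical in
/-- The basis vector `|x⟩`. -/
def ket {k : ℕ} (x : Config k) : Amp k := fun z => if z = x then 1 else 0

/-- `op` is defined through the rows of `V`, by its effect on amplitudes; basis vectors see the
columns. -/
theorem op_ket {k : ℕ} (V : Matrix (Bool × Bool) (Bool × Bool) ℂ) {p q : Site k} (h : p ≠ q)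
    (x : Config k) :
    op V p q (ket x) = ∑ a : Bool × Bool, V a (x p, x q) • ket (update₂ x p q a) := by
  funext z
  rw [op_apply, Finset.sum_apply]
  -- If `z` agrees with `x` away from `p` and `q`, one term survives on each side, and both are the
  -- same matrix element; otherwise both sides vanish.
  by_cases hz : ∀ s, s ≠ p → s ≠ q → z s = x s
  · rw [Finset.sum_eq_single (x p, x q), Finset.sum_eq_single (z p, z q)]
    · have e₁ : update₂ z p q (x p, x q) = x := by
        funext s
        by_cases hq : s = q
        · subst hq; exact update₂_snd _ _
        · by_cases hp : s = p
          · subst hp; exact update₂_fst _ _ h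
          · rw [update₂_of_ne _ _ hp hq, hz s hp hq]
      have e₂ : update₂ x p q (z p, z q) = z := by
        funext s
        by_cases hq : s = q
        · subst hq; exact update₂_snd _ _
        · by_cases hp : s = p
          · subst hp; exact update₂_fst _ _ h
          · rw [update₂_of_ne _ _ hp hq, hz s hp hq]
      simp [ket, e₁, e₂]
    · intro b _ hb
      have : z ≠ update₂ x p q b := fun e => hb <| by
        rw [e, update₂_fst _ _ h, update₂_snd]
      simp [ket, this]
    · simp
    · intro b _ hb
      have : update₂ z p q b ≠ x := fun e => hb <| by
        rw [← e, update₂_fst _ _ h, update₂_snd]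
      simp [ket, this]
    · simp
  · push Not at hz
    obtain ⟨s, hp, hq, hs⟩ := hz
    rw [Finset.sum_eq_zero, Finset.sum_eq_zero]
    · intro a _
      have : z ≠ update₂ x p q a := fun e => hs <| by rw [e, update₂_of_ne _ _ hp hq]
      simp [ket, this]
    · intro a _
      have : update₂ z p q a ≠ x := fun e => hs <| by rw [← e, update₂_of_ne _ _ hp hq]
      simp [ket, this]

/-- `V` acting on each of the given pairs of qubits. -/
def opPar {k : ℕ} (V : Matrix (Bool × Bool) (Bool × Bool) ℂ) (ps : List (Site k × Site k)) :
    Module.End ℂ (Amp k) :=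
  seqProd (ps.map fun a => op V a.1 a.2)

/-- Different pairs have no qubit in common, and each pair consists of neighbours. -/
def Parallel {k : ℕ} (ps : List (Site k × Site k)) : Prop :=
  ps.Pairwise Apart ∧ ∀ a ∈ ps, Adjacent a.1 a.2

theorem Adjacent.ne {k : ℕ} {p q : Site k} (h : Adjacent p q) : p ≠ q := by
  rintro rfl
  simp [Adjacent] at h

theorem Adjacent.symm {k : ℕ} {p q : Site k} (h : Adjacent p q) : Adjacent q p := by
  unfold Adjacent at *
  rw [← h]
  exact Finset.sum_congr rfl fun i _ => abs_sub_comm _ _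

/-- Operators on disjoint pairs commute, so performing `W` and then `V` pair by pair is the same as
performing `W` on all pairs before `V` on all pairs. -/
theorem opPar_mul {k : ℕ} (V W : Matrix (Bool × Bool) (Bool × Bool) ℂ)
    {ps : List (Site k × Site k)} (h : Parallel ps) :
    opPar (V * W) ps = opPar V ps * opPar W ps := by
  unfold opPar
  rw [← seqProd_map_mul]
  · congr 1
    exact List.map_congr_left fun a ha => op_mul V W (h.2 a ha).ne
  · exact h.1.imp fun hab => hab.symm.commute_op W V

theorem opPar_one {k : ℕ} (ps : List (Site k × Site k)) : opPar 1 ps = 1 := by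
  induction ps with
  | nil => rfl
  | cons a ps ih =>
    rw [opPar, List.map_cons, seqProd, op_one, mul_one]
    exact ih

theorem opPar_smul {k : ℕ} (c : ℂ) (V : Matrix (Bool × Bool) (Bool × Bool) ℂ)
    (ps : List (Site k × Site k)) : opPar (c • V) ps = c ^ ps.length • opPar V ps := by
  induction ps with
  | nil => simp [opPar, seqProd]
  | cons a ps ih =>
    have e : ∀ W, opPar W (a :: ps) = opPar W ps * op W a.1 a.2 := fun W => rfl
    rw [e, e, ih, op_smul, smul_mul_smul_comm, List.length_cons, pow_succ]

/-! ### Mixtures -/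

/-- The operator `∑ s t, σ s t |ψ s⟩⟨ψ t|`. -/
def mix {k : ℕ} {ι : Type*} [Fintype ι] (ψ : ι → Amp k) (σ : Matrix ι ι ℂ) : State k :=
  fun x y => ∑ s, ∑ t, σ s t * ψ s x * star (ψ t y)

/-- Conjugation acts on the two sides of each `|ψ s⟩⟨ψ t|` separately, which reduces the evolution
of states to that of vectors. -/
theorem applyTwo_mix {k : ℕ} {ι : Type*} [Fintype ι]
    (V : Matrix (Bool × Bool) (Bool × Bool) ℂ) (p q : Site k) (ψ : ι → Amp k)
    (σ : Matrix ι ι ℂ) : applyTwo V p q (mix ψ σ) = mix (fun s => op V p q (ψ s)) σ := by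
  funext x y
  simp only [applyTwo, mix, op_apply, star_sum, star_mul', Finset.mul_sum, Finset.sum_mul]
  calc _ = ∑ a : Bool × Bool, ∑ s, ∑ b : Bool × Bool, ∑ t, _ :=
        Finset.sum_congr rfl fun a _ => Finset.sum_comm
    _ = ∑ s, ∑ a : Bool × Bool, ∑ b : Bool × Bool, ∑ t, _ := Finset.sum_comm
    _ = ∑ s, ∑ b : Bool × Bool, ∑ a : Bool × Bool, ∑ t, _ :=
        Finset.sum_congr rfl fun s _ => Finset.sum_comm
    _ = ∑ s, ∑ b : Bool × Bool, ∑ t, ∑ a : Bool × Bool, _ :=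
        Finset.sum_congr rfl fun s _ => Finset.sum_congr rfl fun b _ => Finset.sum_comm
    _ = ∑ s, ∑ t, ∑ b : Bool × Bool, ∑ a : Bool × Bool, _ :=
        Finset.sum_congr rfl fun s _ => Finset.sum_comm
    _ = _ := Finset.sum_congr rfl fun s _ => Finset.sum_congr rfl fun t _ =>
        Finset.sum_congr rfl fun b _ => Finset.sum_congr rfl fun a _ => by ring

/-- The common phase of the vectors meets its conjugate. This is why words that are correct up to a
phase give exact circuits. -/
theorem mix_smul {k : ℕ} {ι : Type*} [Fintype ι] {c : ℂ} (hc : ‖c‖ = 1) (ψ : ι → Amp k)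
    (σ : Matrix ι ι ℂ) : mix (fun s => c • ψ s) σ = mix ψ σ := by
  have h : c * star c = 1 := by
    rw [Complex.star_def, Complex.mul_conj, Complex.normSq_eq_norm_sq, hc]
    simp
  funext x y
  refine Finset.sum_congr rfl fun s _ => Finset.sum_congr rfl fun t _ => ?_
  simp only [Pi.smul_apply, smul_eq_mul, star_mul']
  linear_combination (σ s t * ψ s x * star (ψ t y)) * h

/-- If the vectors evolve by the columns of `M`, the coefficient matrix is conjugated by `M`; this
turns the action on basis vectors into the required statement about states. -/
theorem mix_mul {k : ℕ} {ι : Type*} [Fintype ι] (ψ : ι → Amp k) (M σ : Matrix ι ι ℂ) :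
    mix (fun s => ∑ t, M t s • ψ t) σ = mix ψ (M * σ * Mᴴ) := by
  funext x y
  simp only [mix, Finset.sum_apply, Pi.smul_apply, smul_eq_mul, star_sum, star_mul',
    Matrix.mul_apply, Matrix.conjTranspose_apply, Finset.mul_sum, Finset.sum_mul]
  calc _ = ∑ s, ∑ t, ∑ v, ∑ u, M u s * σ s t * star (M v t) * ψ u x * star (ψ v y) :=
        Finset.sum_congr rfl fun s _ => Finset.sum_congr rfl fun t _ =>
          Finset.sum_congr rfl fun v _ => Finset.sum_congr rfl fun u _ => by ring
    _ = ∑ s, ∑ t, ∑ u, ∑ v, M u s * σ s t * star (M v t) * ψ u x * star (ψ v y) :=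
        Finset.sum_congr rfl fun s _ => Finset.sum_congr rfl fun t _ => Finset.sum_comm
    _ = ∑ s, ∑ u, ∑ t, ∑ v, M u s * σ s t * star (M v t) * ψ u x * star (ψ v y) :=
        Finset.sum_congr rfl fun s _ => Finset.sum_comm
    _ = ∑ u, ∑ s, ∑ t, ∑ v, M u s * σ s t * star (M v t) * ψ u x * star (ψ v y) :=
        Finset.sum_comm
    _ = ∑ u, ∑ s, ∑ v, ∑ t, M u s * σ s t * star (M v t) * ψ u x * star (ψ v y) :=
        Finset.sum_congr rfl fun u _ => Finset.sum_congr rfl fun s _ => Finset.sum_comm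
    _ = ∑ u, ∑ v, ∑ s, ∑ t, M u s * σ s t * star (M v t) * ψ u x * star (ψ v y) :=
        Finset.sum_congr rfl fun u _ => Finset.sum_comm
    _ = ∑ u, ∑ v, ∑ t, ∑ s, M u s * σ s t * star (M v t) * ψ u x * star (ψ v y) :=
        Finset.sum_congr rfl fun u _ => Finset.sum_congr rfl fun v _ => Finset.sum_comm

/-! ### Words of basic operations on a pair of qubits -/

/-- A basic operation on an ordered pair of qubits. -/
inductive PairOp (A B : Type) : Type
  | fst (a : A)
  | snd (a : A)
  | two (b : B)
  | swapped (b : B)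

/-- The unitary that is performed on the pair. -/
def PairOp.mat {A B : Type} (u₁ : A → U1) (u₂ : B → U2) :
    PairOp A B → Matrix (Bool × Bool) (Bool × Bool) ℂ
  | .fst a => (u₁ a : Matrix Bool Bool ℂ) ⊗ₖ (1 : Matrix Bool Bool ℂ)
  | .snd a => (1 : Matrix Bool Bool ℂ) ⊗ₖ (u₁ a : Matrix Bool Bool ℂ)
  | .two b => u₂ b
  | .swapped b => (u₂ b : Matrix (Bool × Bool) (Bool × Bool) ℂ).submatrix Prod.swap Prod.swap

/-- The operation on the pair `p, q`. -/
def PairOp.instr {k : ℕ} {A B : Type} (p q : Site k) : PairOp A B → Instr k A B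
  | .fst a => .one a p
  | .snd a => .one a q
  | .two b => .two b p q
  | .swapped b => .two b q p

theorem applyTwo_kronecker_one {k : ℕ} (V : Matrix Bool Bool ℂ) {p q : Site k} (h : p ≠ q)
    (ρ : State k) : applyTwo (V ⊗ₖ (1 : Matrix Bool Bool ℂ)) p q ρ = applyOne V p ρ := by
  funext x y
  have e : ∀ (z : Config k) (a : Bool), update₂ z p q (a, z q) = Function.update z p a :=
    fun z a => by
      have : z q = Function.update z p a q := by rw [Function.update_of_ne h.symm]
      unfold update₂
      simp only
      rw [this, Function.update_eq_self]
  simp [applyTwo, applyOne, Fintype.sum_prod_type, Matrix.kroneckerMap_apply, Matrix.one_apply,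
    apply_ite star, e]

theorem applyTwo_swap {k : ℕ} (V : Matrix (Bool × Bool) (Bool × Bool) ℂ) {p q : Site k}
    (h : p ≠ q) (ρ : State k) :
    applyTwo (V.submatrix Prod.swap Prod.swap) p q ρ = applyTwo V q p ρ := by
  funext x y
  have e : ∀ (z : Config k) (a : Bool × Bool), update₂ z p q a.swap = update₂ z q p a :=
    fun z a => Function.update_comm h _ _ _
  unfold applyTwo
  rw [← (Equiv.prodComm Bool Bool).sum_comp]
  refine Finset.sum_congr rfl fun a _ => ?_
  rw [← (Equiv.prodComm Bool Bool).sum_comp]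
  refine Finset.sum_congr rfl fun b _ => ?_
  simp [e]

theorem applyTwo_one_kronecker {k : ℕ} (V : Matrix Bool Bool ℂ) {p q : Site k} (h : p ≠ q)
    (ρ : State k) : applyTwo ((1 : Matrix Bool Bool ℂ) ⊗ₖ V) p q ρ = applyOne V q ρ := by
  rw [← applyTwo_kronecker_one V h.symm, ← applyTwo_swap _ h]
  congr 1
  ext ⟨a, a'⟩ ⟨b, b'⟩
  simp [Matrix.kroneckerMap_apply, mul_comm]

theorem PairOp.apply_instr {k : ℕ} {A B : Type} (u₁ : A → U1) (u₂ : B → U2) (l : PairOp A B)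
    {p q : Site k} (h : p ≠ q) (ρ : State k) :
    (l.instr p q).apply u₁ u₂ ρ = applyTwo (l.mat u₁ u₂) p q ρ := by
  cases l with
  | fst a => exact (applyTwo_kronecker_one _ h ρ).symm
  | snd a => exact (applyTwo_one_kronecker _ h ρ).symm
  | two b => rfl
  | swapped b => exact (applyTwo_swap _ h ρ).symm

/-- The word `w` of operations performed on each of the pairs `ps`. -/
def wordLayers {k : ℕ} {A B : Type} (w : List (PairOp A B)) (ps : List (Site k × Site k)) :
    Circuit k A B :=
  w.map fun l => ps.map fun a => l.instr a.1 a.2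

/-- The unitary that a word induces, its head being performed first. -/
def wordMat {A B : Type} (u₁ : A → U1) (u₂ : B → U2) (w : List (PairOp A B)) :
    Matrix (Bool × Bool) (Bool × Bool) ℂ :=
  seqProd (w.map (PairOp.mat u₁ u₂))

theorem run_append {k : ℕ} {A B : Type} (u₁ : A → U1) (u₂ : B → U2) (c c' : Circuit k A B)
    (ρ : State k) : Circuit.run u₁ u₂ (c ++ c') ρ = Circuit.run u₁ u₂ c' (Circuit.run u₁ u₂ c ρ) :=
  List.foldl_append

theorem foldl_instr_mix {k : ℕ} {A B : Type} (u₁ : A → U1) (u₂ : B → U2) {ι : Type*} [Fintype ι]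
    (l : PairOp A B) {ps : List (Site k × Site k)} (h : ∀ a ∈ ps, a.1 ≠ a.2) (ψ : ι → Amp k)
    (σ : Matrix ι ι ℂ) :
    (ps.map fun a => l.instr a.1 a.2).foldl (fun ρ o => o.apply u₁ u₂ ρ) (mix ψ σ) =
      mix (fun s => opPar (l.mat u₁ u₂) ps (ψ s)) σ := by
  induction ps generalizing ψ with
  | nil => rfl
  | cons a ps ih =>
    rw [List.forall_mem_cons] at h
    simp only [List.map_cons, List.foldl_cons]
    rw [PairOp.apply_instr u₁ u₂ l h.1, applyTwo_mix, ih h.2]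
    rfl

/-- The circuit runs through the word letter by letter on all pairs at once; by `opPar_mul` this
equals the product of the word on each pair. -/
theorem run_wordLayers_mix {k : ℕ} {A B : Type} (u₁ : A → U1) (u₂ : B → U2) {ι : Type*}
    [Fintype ι] (w : List (PairOp A B)) {ps : List (Site k × Site k)} (h : Parallel ps)
    (ψ : ι → Amp k) (σ : Matrix ι ι ℂ) :
    Circuit.run u₁ u₂ (wordLayers w ps) (mix ψ σ) =
      mix (fun s => opPar (wordMat u₁ u₂ w) ps (ψ s)) σ := by
  induction w generalizing ψ with
  | nil => simp [wordLayers, wordMat, seqProd, opPar_one, Circuit.run]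
  | cons l w ih =>
    have e : Circuit.run u₁ u₂ (wordLayers (l :: w) ps) (mix ψ σ) =
        Circuit.run u₁ u₂ (wordLayers w ps)
          ((ps.map fun a => l.instr a.1 a.2).foldl (fun ρ o => o.apply u₁ u₂ ρ) (mix ψ σ)) := rfl
    rw [e, foldl_instr_mix u₁ u₂ l (fun a ha => (h.2 a ha).ne), ih]
    simp only [wordMat, List.map_cons, seqProd, opPar_mul _ _ h, Module.End.mul_apply]

/-! ### Plans and their circuits -/

/-- A sequence of steps, in each of which the same unitary is performed on several pairs. -/
abbrev Plan (k : ℕ) (g : Type) : Type := List (g × List (Site k × Site k))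

/-- The circuit that performs a plan. -/
def Plan.circuit {k : ℕ} {g A B : Type} (word : g → List (PairOp A B)) (P : Plan k g) :
    Circuit k A B :=
  P.flatMap fun s => wordLayers (word s.1) s.2

/-- The operator that a plan induces. -/
def Plan.op {k : ℕ} {g : Type} (V : g → Matrix (Bool × Bool) (Bool × Bool) ℂ) (P : Plan k g) :
    Module.End ℂ (Amp k) :=
  seqProd (P.map fun s => opPar (V s.1) s.2)

theorem Plan.op_append {k : ℕ} {g : Type} (V : g → Matrix (Bool × Bool) (Bool × Bool) ℂ)
    (P Q : Plan k g) : Plan.op V (P ++ Q) = Plan.op V Q * Plan.op V P := by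
  unfold Plan.op
  rw [List.map_append, seqProd_append]

/-- The passage from basic operations to abstract gates: each word may differ from its gate by a
phase, and the phases disappear in the mixture. -/
theorem Plan.run_circuit_mix {k : ℕ} {g A B : Type} (u₁ : A → U1) (u₂ : B → U2)
    (word : g → List (PairOp A B)) (V : g → Matrix (Bool × Bool) (Bool × Bool) ℂ)
    (hV : ∀ a, ∃ c : ℂ, ‖c‖ = 1 ∧ V a = c • wordMat u₁ u₂ (word a)) {ι : Type*} [Fintype ι]
    (P : Plan k g) (hP : ∀ s ∈ P, Parallel s.2) (ψ : ι → Amp k) (σ : Matrix ι ι ℂ) :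
    Circuit.run u₁ u₂ (P.circuit word) (mix ψ σ) = mix (fun s => P.op V (ψ s)) σ := by
  induction P generalizing ψ with
  | nil => rfl
  | cons s P ih =>
    rw [List.forall_mem_cons] at hP
    obtain ⟨c, hc, e⟩ := hV s.1
    have e' : Plan.circuit word (s :: P) = wordLayers (word s.1) s.2 ++ Plan.circuit word P := rfl
    -- The phase of the word occurs once for every pair, hence the power `c ^ s.2.length`.
    rw [e', run_append, run_wordLayers_mix u₁ u₂ _ hP.1,
      ← mix_smul (c := c ^ s.2.length) (by simp [hc]), ih hP.2]
    simp only [Plan.op, List.map_cons, seqProd, e, opPar_smul, Module.End.mul_apply,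
      LinearMap.smul_apply]

/-- The plan that undoes a plan. -/
def Plan.inverse {k : ℕ} {g : Type} (inv : g → g) (P : Plan k g) : Plan k g :=
  P.reverse.map fun s => (inv s.1, s.2)

theorem Plan.op_inverse_mul {k : ℕ} {g : Type} (inv : g → g)
    (V : g → Matrix (Bool × Bool) (Bool × Bool) ℂ) (hV : ∀ a, V (inv a) * V a = 1)
    (P : Plan k g) (hP : ∀ s ∈ P, Parallel s.2) : (P.inverse inv).op V * P.op V = 1 := by
  induction P with
  | nil => simp [Plan.inverse, Plan.op, seqProd]
  | cons s P ih =>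
    rw [List.forall_mem_cons] at hP
    have e : Plan.inverse inv (s :: P) = Plan.inverse inv P ++ [(inv s.1, s.2)] := by
      simp [Plan.inverse]
    have e' : Plan.op V (s :: P) = Plan.op V P * opPar (V s.1) s.2 := rfl
    have e'' : Plan.op V [(inv s.1, s.2)] = opPar (V (inv s.1)) s.2 := one_mul _
    rw [e, Plan.op_append, e', e'', mul_assoc, ← mul_assoc _ (Plan.op V P), ih hP.2, one_mul,
      ← opPar_mul _ _ hP.1, hV, opPar_one]

/-! ### The states of the controls and the target -/

open Classical in
/-- The basis state in which the controls and the target have the given values, and all other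
qubits are `|0⟩`. -/
def Layout.config {k n : ℕ} (l : Layout k n) (s : (Fin n → Bool) × Bool) : Config k :=
  fun p => if p = l.target then s.2 else if h : ∃ i, p = l.ctrl i then s.1 h.choose else false

theorem Layout.config_target {k n : ℕ} (l : Layout k n) (s : (Fin n → Bool) × Bool) :
    l.config s l.target = s.2 := by
  simp [Layout.config]

theorem Layout.config_ctrl {k n : ℕ} (l : Layout k n) (s : (Fin n → Bool) × Bool) (i : Fin n) :
    l.config s (l.ctrl i) = s.1 i := by
  have h : ∃ j, l.ctrl i = l.ctrl j := ⟨i, rfl⟩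
  have e : h.choose = i := (l.ctrl.injective h.choose_spec).symm
  simp only [Layout.config, if_neg (l.target_ne i), dif_pos h, e]

theorem Layout.config_other {k n : ℕ} (l : Layout k n) (s : (Fin n → Bool) × Bool) {p : Site k}
    (hp : ∀ i, p ≠ l.ctrl i) (hp' : p ≠ l.target) : l.config s p = false := by
  simp [Layout.config, hp', hp]

theorem Layout.config_update {k n : ℕ} (l : Layout k n) (s : (Fin n → Bool) × Bool) (b : Bool) :
    Function.update (l.config s) l.target b = l.config (s.1, b) := by
  funext p
  by_cases h : p = l.target
  · subst h; simp [Layout.config]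
  · simp [Layout.config, h]

theorem Layout.eq_config_iff {k n : ℕ} (l : Layout k n) (s : (Fin n → Bool) × Bool)
    (x : Config k) : x = l.config s ↔
      (∀ p, (∀ i, p ≠ l.ctrl i) → p ≠ l.target → x p = false) ∧
        (fun i => x (l.ctrl i), x l.target) = s := by
  constructor
  · rintro rfl
    refine ⟨fun p hp hp' => l.config_other s hp hp', ?_⟩
    ext <;> simp [l.config_ctrl, l.config_target]
  · rintro ⟨h, rfl⟩
    funext p
    by_cases hp : p = l.target
    · subst hp; rw [l.config_target]
    · by_cases hc : ∃ i, p = l.ctrl i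
      · obtain ⟨i, rfl⟩ := hc; rw [l.config_ctrl]
      · push Not at hc
        rw [l.config_other _ hc hp, h p hc hp]

/-- At the matrix element `(x, y)` only the indices read off from `x` and `y` can contribute to the
double sum, and they do so exactly if all ancillas are `0` in both. -/
theorem Layout.embed_eq_mix {k n : ℕ} (l : Layout k n)
    (σ : Matrix ((Fin n → Bool) × Bool) ((Fin n → Bool) × Bool) ℂ) :
    l.embed σ = mix (fun s => ket (l.config s)) σ := by
  classical
  have key : ∀ (s : (Fin n → Bool) × Bool) (x : Config k), ket (l.config s) x =
      if s = (fun i => x (l.ctrl i), x l.target) then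
        if ∀ p, (∀ i, p ≠ l.ctrl i) → p ≠ l.target → x p = false then 1 else 0
      else 0 := fun s x => by
    unfold ket
    by_cases h : x = l.config s
    · have := (l.eq_config_iff s x).1 h
      rw [if_pos h, if_pos this.2.symm, if_pos this.1]
    · rw [if_neg h]
      split_ifs with h₁ h₂
      · exact absurd ((l.eq_config_iff s x).2 ⟨h₂, h₁.symm⟩) h
      · rfl
      · rfl
  funext x y
  unfold mix
  beta_reduce
  rw [Finset.sum_eq_single (fun i => x (l.ctrl i), x l.target),
    Finset.sum_eq_single (fun i => y (l.ctrl i), y l.target)]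
  · rw [key, key, if_pos rfl, if_pos rfl, Layout.embed]
    by_cases hx : ∀ p, (∀ i, p ≠ l.ctrl i) → p ≠ l.target → x p = false
    · by_cases hy : ∀ p, (∀ i, p ≠ l.ctrl i) → p ≠ l.target → y p = false
      · rw [if_pos fun p h h' => ⟨hx p h h', hy p h h'⟩, if_pos hx, if_pos hy, star_one, mul_one,
          mul_one]
      · rw [if_neg fun h => hy fun p h₁ h₂ => (h p h₁ h₂).2, if_neg hy, star_zero, mul_zero]
    · rw [if_neg fun h => hx fun p h₁ h₂ => (h p h₁ h₂).1, if_neg hx, mul_zero, zero_mul]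
  · intro b _ hb
    rw [key b y, if_neg hb, star_zero, mul_zero]
  · exact fun h => absurd (Finset.mem_univ _) h
  · intro b _ hb
    exact Finset.sum_eq_zero fun t _ => by rw [key b x, if_neg hb, mul_zero, zero_mul]
  · exact fun h => absurd (Finset.mem_univ _) h

/-! ### The gates -/

/-- The operator on two qubits that applies `A` or `B` to the second one, depending on whether
the first one is `|0⟩` or `|1⟩`. -/
def select (A B : Matrix Bool Bool ℂ) : Matrix (Bool × Bool) (Bool × Bool) ℂ :=
  fun s t => if s.1 = t.1 then (if s.1 then B else A) s.2 t.2 else 0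

theorem select_mem {A B : Matrix Bool Bool ℂ} (hA : A ∈ Matrix.unitaryGroup Bool ℂ)
    (hB : B ∈ Matrix.unitaryGroup Bool ℂ) :
    select A B ∈ Matrix.unitaryGroup (Bool × Bool) ℂ := by
  rw [Matrix.mem_unitaryGroup_iff] at *
  ext ⟨a, b⟩ ⟨a', b'⟩
  have hA' := congrFun (congrFun hA b) b'
  have hB' := congrFun (congrFun hB b) b'
  simp only [Matrix.mul_apply, Matrix.star_apply, Fintype.sum_prod_type, Fintype.sum_bool,
    Matrix.one_apply, select] at *
  cases a <;> cases a' <;> simp_all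

theorem op_select_ket {k : ℕ} (A B : Matrix Bool Bool ℂ) {p q : Site k} (h : p ≠ q)
    (x : Config k) : op (select A B) p q (ket x) =
      ∑ c : Bool, (if x p then B else A) c (x q) • ket (Function.update x q c) := by
  have e : ∀ c, update₂ x p q (x p, c) = Function.update x q c := fun c => by
    unfold update₂
    simp only
    rw [Function.update_eq_self]
  rw [op_ket _ h, Fintype.sum_prod_type, Finset.sum_eq_single (x p)]
  · simp only [select, if_true, e]
  · intro b _ hb
    simp [select, hb]
  · simp

/-- The Pauli matrix `X`. -/
def pauliX : Matrix Bool Bool ℂ := fun a b => if a = b then 0 else 1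

/-- The Pauli matrix `Z`. -/
def pauliZ : Matrix Bool Bool ℂ := fun a b => if a = b then (if a then -1 else 1) else 0

/-- The Hadamard matrix. -/
def hadamard : Matrix Bool Bool ℂ :=
  fun a b => if a && b then -((√2 : ℝ) : ℂ)⁻¹ else ((√2 : ℝ) : ℂ)⁻¹

/-- The matrix of `|b, t⟩ ↦ |¬t, b⟩`. -/
def swapNot : Matrix (Bool × Bool) (Bool × Bool) ℂ :=
  fun s t => if s = (!t.2, t.1) then 1 else 0

theorem inv_sqrt_two_mul_self : ((√2 : ℝ) : ℂ)⁻¹ * ((√2 : ℝ) : ℂ)⁻¹ = 1 / 2 := by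
  rw [← mul_inv, ← Complex.ofReal_mul, Real.mul_self_sqrt (by norm_num)]
  norm_num

theorem pauliX_mem : pauliX ∈ Matrix.unitaryGroup Bool ℂ := by
  rw [Matrix.mem_unitaryGroup_iff]
  ext a b
  cases a <;> cases b <;> simp [Matrix.mul_apply, pauliX]

theorem pauliZ_mem : pauliZ ∈ Matrix.unitaryGroup Bool ℂ := by
  rw [Matrix.mem_unitaryGroup_iff]
  ext a b
  cases a <;> cases b <;> simp [Matrix.mul_apply, pauliZ]

theorem hadamard_mem : hadamard ∈ Matrix.unitaryGroup Bool ℂ := by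
  rw [Matrix.mem_unitaryGroup_iff]
  have h := inv_sqrt_two_mul_self
  ext a b
  cases a <;> cases b <;> simp [Matrix.mul_apply, hadamard, -Complex.ofReal_inv] <;>
    linear_combination 2 * h

theorem swapNot_mem : swapNot ∈ Matrix.unitaryGroup (Bool × Bool) ℂ := by
  rw [Matrix.mem_unitaryGroup_iff]
  ext ⟨a, b⟩ ⟨a', b'⟩
  cases a <;> cases b <;> cases a' <;> cases b' <;>
    simp [Matrix.mul_apply, swapNot, Fintype.sum_prod_type]

theorem op_swapNot_ket {k : ℕ} {p q : Site k} (h : p ≠ q) (x : Config k) :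
    op swapNot p q (ket x) = ket (update₂ x p q (!x q, x p)) := by
  rw [op_ket _ h, Finset.sum_eq_single (!x q, x p)]
  · simp [swapNot]
  · intro b _ hb
    simp [swapNot, hb]
  · simp

/-- The names of the unitaries that are used. -/
inductive Gate : Type
  | flip
  | prepare
  | mark
  | merge
  | control

instance : Finite Gate :=
  Finite.of_injective (fun g => match g with
    | .flip => (0 : Fin 5) | .prepare => 1 | .mark => 2 | .merge => 3 | .control => 4)
    fun a b h => by cases a <;> cases b <;> simp_all

/-- The unitaries that are used, given the unitary to be controlled. -/
def Gate.unitary (U : U1) : Gate → U2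
  | .flip => ⟨select pauliX pauliX, select_mem pauliX_mem pauliX_mem⟩
  | .prepare => ⟨select hadamard 1, select_mem hadamard_mem (one_mem _)⟩
  | .mark => ⟨select pauliZ 1, select_mem pauliZ_mem (one_mem _)⟩
  | .merge => ⟨swapNot, swapNot_mem⟩ * ⟨select hadamard 1, select_mem hadamard_mem (one_mem _)⟩
  | .control => ⟨select U 1, select_mem U.2 (one_mem _)⟩

/-- The unitary `g` or, if the flag is set, its inverse. -/
def signedUnitary (U : U1) (g : Gate × Bool) : U2 :=
  if g.2 then (g.1.unitary U)⁻¹ else g.1.unitary U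

/-- The matrix of `signedUnitary`. -/
def signedMat (U : U1) (g : Gate × Bool) : Matrix (Bool × Bool) (Bool × Bool) ℂ :=
  (signedUnitary U g : U2)

theorem signedMat_inv_mul (U : U1) (g : Gate × Bool) :
    signedMat U (g.1, !g.2) * signedMat U g = 1 := by
  have h : signedUnitary U (g.1, !g.2) * signedUnitary U g = 1 := by
    obtain ⟨g, b⟩ := g
    cases b <;> simp [signedUnitary]
  exact congrArg Subtype.val h

/-! ### Merging two bits -/

/-- A place `a` whose bit is merged into `b`, with the help of the ancilla `t` between them. -/
structure Junction (k : ℕ) : Type where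
  /-- the source -/
  a : Site k
  /-- the ancilla -/
  t : Site k
  /-- the destination -/
  b : Site k

/-- The operator that merges the bits at `a` and `b`. -/
def Junction.op {k : ℕ} (U : U1) (g : Junction k) : Module.End ℂ (Amp k) :=
  NANTC.op (signedMat U (.merge, false)) g.b g.t *
    (NANTC.op (signedMat U (.mark, false)) g.a g.t *
      NANTC.op (signedMat U (.prepare, false)) g.b g.t)

/-- The disjunction of the bits at `a` and `b` is stored at `b`, the former bit at `b` moves
to `t`. -/
def Junction.map {k : ℕ} (x : Config k) (g : Junction k) : Config k :=
  Function.update (Function.update x g.t (x g.b)) g.b (x g.a || x g.b)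

/-- If `b` is `0`, the ancilla undergoes a Hadamard, a `Z` provided that `a` is `0`, and a Hadamard
again, so it becomes `1` exactly if `a` is `0`. If `b` is `1`, it stays `|0⟩`, on which `Z` has no
effect. Thus `t` holds `¬(a ∨ b)` before the exchange by `swapNot`, which negates it on the way to
`b`. -/
theorem Junction.op_ket {k : ℕ} (U : U1) {g : Junction k} (hbt : g.b ≠ g.t) (hat : g.a ≠ g.t)
    (x : Config k) (hx : x g.t = false) : g.op U (ket x) = ket (g.map x) := by
  have e₀ : Function.update x g.t false = x := by rw [← hx, Function.update_eq_self]
  have em : signedMat U (.merge, false) = swapNot * select hadamard 1 := rfl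
  have ek : signedMat U (.mark, false) = select pauliZ 1 := rfl
  have ep : signedMat U (.prepare, false) = select hadamard 1 := rfl
  have h2 := inv_sqrt_two_mul_self
  have hs : ∀ c, update₂ (Function.update x g.t c) g.b g.t (!c, x g.b) =
      Function.update (Function.update x g.t (x g.b)) g.b (!c) := fun c => by
    funext z
    simp only [update₂, Function.update_apply]
    split_ifs <;> simp_all
  -- The part before the exchange. The second conditional Hadamard comes from the gate `merge`,
  -- which fuses it with the exchange because both act on `b` and `t`.
  have key : (NANTC.op (select hadamard 1) g.b g.t * (NANTC.op (select pauliZ 1) g.a g.t *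
      NANTC.op (select hadamard 1) g.b g.t)) (ket x) =
      ket (Function.update x g.t (!(x g.a || x g.b))) := by
    simp only [Module.End.mul_apply, op_select_ket _ _ hbt, op_select_ket _ _ hat, hx, map_add,
      map_smul, Fintype.sum_bool, Function.update_self, Function.update_of_ne hbt,
      Function.update_of_ne hat, Function.update_idem, e₀]
    cases hb : x g.b <;> cases ha : x g.a <;>
      simp [hadamard, pauliZ, smul_smul, h2, -Complex.ofReal_inv, ← sub_eq_add_neg, e₀]
    all_goals (try simp only [smul_sub, smul_smul, h2]); module
  rw [Junction.op, em, ek, ep, op_mul _ _ hbt, mul_assoc, Module.End.mul_apply, key,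
    op_swapNot_ket hbt, Function.update_self, Function.update_of_ne hbt, hs, Bool.not_not]
  rfl

theorem Junction.map_update {k : ℕ} {g : Junction k} {p : Site k} (ha : g.a ≠ p) (ht : g.t ≠ p)
    (hb : g.b ≠ p) (x : Config k) (v : Bool) :
    Junction.map (Function.update x p v) g = Function.update (Junction.map x g) p v := by
  funext z
  simp only [Junction.map, Function.update_apply, ha, hb, if_false]
  split_ifs <;> simp_all

/-- Merging neither reads nor writes a place that is in no junction; this is applied to the target.
-/
theorem foldl_junction_map_update {k : ℕ} {gs : List (Junction k)} {p : Site k}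
    (h : ∀ g ∈ gs, g.a ≠ p ∧ g.t ≠ p ∧ g.b ≠ p) (x : Config k) (v : Bool) :
    gs.foldl Junction.map (Function.update x p v) =
      Function.update (gs.foldl Junction.map x) p v := by
  induction gs generalizing x with
  | nil => rfl
  | cons g gs ih =>
    rw [List.forall_mem_cons] at h
    simp only [List.foldl_cons]
    rw [Junction.map_update h.1.1 h.1.2.1 h.1.2.2, ih h.2]

/-- If no source is used again, then merging moves the disjunction of all bits in `B` to the
places that are no sources. -/
theorem foldl_junction {k : ℕ} (U : U1) (gs : List (Junction k)) (B : Set (Site k))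
    (hB : ∀ g ∈ gs, g.a ∈ B ∧ g.b ∈ B ∧ g.t ∉ B ∧ g.a ≠ g.b)
    (hgs : gs.Pairwise fun g g' => g'.a ≠ g.a ∧ g'.b ≠ g.a ∧ g'.t ≠ g.t) (x : Config k)
    (hx : ∀ g ∈ gs, x g.t = false) :
    seqProd (gs.map (Junction.op U)) (ket x) = ket (gs.foldl Junction.map x) ∧
      ((∃ z ∈ B, (∀ g ∈ gs, g.a ≠ z) ∧ gs.foldl Junction.map x z = true) ↔
        ∃ z ∈ B, x z = true) := by
  induction gs generalizing B x with
  | nil => simp [seqProd]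
  | cons g gs ih =>
    rw [List.forall_mem_cons] at hB hx
    rw [List.pairwise_cons] at hgs
    obtain ⟨ha, hb, ht, hab⟩ := hB.1
    have hbt : g.b ≠ g.t := fun e => ht (e ▸ hb)
    have hat : g.a ≠ g.t := fun e => ht (e ▸ ha)
    -- The source is removed from `B` because later junctions must not meet it again as a source or
    -- a destination. Later ancillas are still `0`: they differ from the ancilla just used, and lie
    -- outside `B`, which contains the destination just written.
    obtain ⟨h₁, h₂⟩ := ih (B \ {g.a})
      (fun g' hg' => by
        obtain ⟨h₁, h₂, h₃, h₄⟩ := hB.2 g' hg'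
        obtain ⟨h₅, h₆, -⟩ := hgs.1 g' hg'
        exact ⟨⟨h₁, h₅⟩, ⟨h₂, h₆⟩, fun h => h₃ h.1, h₄⟩) hgs.2 (Junction.map x g)
      (fun g' hg' => by
        have h : g'.t ≠ g.b := fun e => (hB.2 g' hg').2.2.1 (e ▸ hb)
        simp [Junction.map, h, (hgs.1 g' hg').2.2, hx.2 g' hg'])
    constructor
    · simp only [List.map_cons, seqProd, List.foldl_cons, Module.End.mul_apply]
      rw [Junction.op_ket U hbt hat x hx.1, h₁]
    · have h₃ : (∃ z ∈ B, (∀ g' ∈ g :: gs, g'.a ≠ z) ∧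
          (g :: gs).foldl Junction.map x z = true) ↔
          ∃ z ∈ B \ {g.a}, (∀ g' ∈ gs, g'.a ≠ z) ∧
            gs.foldl Junction.map (Junction.map x g) z = true := by
        refine exists_congr fun z => ?_
        simp only [List.forall_mem_cons, List.foldl_cons, Set.mem_sdiff, Set.mem_singleton_iff,
          ne_comm (a := g.a), ne_eq]
        tauto
      rw [h₃, h₂]
      -- One merge preserves the disjunction: the bits at `g.a` and `g.b` are both accounted for at
      -- `g.b`, which stays in the smaller set, and no other bit of `B` changes.
      constructor
      · rintro ⟨z, ⟨hz, -⟩, h⟩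
        by_cases hzb : z = g.b
        · subst hzb
          simp only [Junction.map, Function.update_self, Bool.or_eq_true] at h
          exact h.elim (fun h => ⟨_, ha, h⟩) fun h => ⟨_, hb, h⟩
        · have hzt : z ≠ g.t := fun e => ht (e ▸ hz)
          exact ⟨z, hz, by simpa [Junction.map, hzb, hzt] using h⟩
      · rintro ⟨z, hz, h⟩
        by_cases hzb : z = g.b ∨ z = g.a
        · refine ⟨g.b, ⟨hb, hab.symm⟩, ?_⟩
          rcases hzb with rfl | rfl <;> simp [Junction.map, h]
        · push Not at hzb
          have hzt : z ≠ g.t := fun e => ht (e ▸ hz)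
          exact ⟨z, ⟨hz, hzb.2⟩, by simpa [Junction.map, hzb.1, hzt] using h⟩

/-! ### Flipping bits -/

/-- Words exist for two-qubit unitaries only, so a one-qubit flip is carried out with a neighbour
`p` that is left alone. In particular `p` may be any qubit, even the target. -/
theorem op_flip_ket {k : ℕ} (U : U1) {p q : Site k} (h : p ≠ q) (x : Config k) :
    op (signedMat U (.flip, false)) p q (ket x) = ket (Function.update x q (!x q)) := by
  have e : signedMat U (.flip, false) = select pauliX pauliX := rfl
  rw [e, op_select_ket _ _ h]
  cases hq : x q <;> simp [pauliX]

theorem opPar_flip_ket {k : ℕ} (U : U1) {ps : List (Site k × Site k)}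
    (h : ∀ a ∈ ps, a.1 ≠ a.2) (x : Config k) :
    opPar (signedMat U (.flip, false)) ps (ket x) =
      ket (ps.foldl (fun x a => Function.update x a.2 (!x a.2)) x) := by
  induction ps generalizing x with
  | nil => rfl
  | cons a ps ih =>
    rw [List.forall_mem_cons] at h
    have e : opPar (signedMat U (.flip, false)) (a :: ps) =
      opPar (signedMat U (.flip, false)) ps * op (signedMat U (.flip, false)) a.1 a.2 := rfl
    rw [e, Module.End.mul_apply, op_flip_ket U h.1, ih h.2]
    rfl

/-- Since no place is listed twice, no flip undoes another one. -/
theorem foldl_flip_apply {k : ℕ} {ps : List (Site k × Site k)} (h : (ps.map Prod.snd).Nodup)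
    (x : Config k) (z : Site k) :
    ps.foldl (fun x a => Function.update x a.2 (!x a.2)) x z =
      (x z ^^ decide (z ∈ ps.map Prod.snd)) := by
  induction ps generalizing x with
  | nil => simp
  | cons a ps ih =>
    rw [List.map_cons, List.nodup_cons] at h
    rw [List.foldl_cons, ih h.2]
    by_cases hz : z = a.2
    · subst hz
      simp [h.1]
    · simp [hz]

/-! ### Places -/

/-- The grid point `2 y + o e_j`. -/
def site {k : ℕ} (y : Fin k → ℕ) (j : Fin k) (o : ℕ) : Site k :=
  fun i => ((2 * y i + if i = j then o else 0 : ℕ) : ℤ)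

/-- The pair of the grid points `2 y + o e_j` and `2 y + o' e_j`. -/
def sitePair {k : ℕ} (j : Fin k) (o o' : ℕ) (y : Fin k → ℕ) : Site k × Site k :=
  (site y j o, site y j o')

theorem site_apply_of_ne {k : ℕ} (y : Fin k → ℕ) {i j : Fin k} (o : ℕ) (h : i ≠ j) :
    site y j o i = 2 * (y i : ℤ) := by
  simp [site, h]

theorem site_apply_self {k : ℕ} (y : Fin k → ℕ) (j : Fin k) (o : ℕ) :
    site y j o j = 2 * (y j : ℤ) + o := by
  simp [site]

theorem adjacent_site {k : ℕ} (y : Fin k → ℕ) (j : Fin k) (o : ℕ) :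
    Adjacent (site y j o) (site y j (o + 1)) := by
  unfold Adjacent
  rw [Finset.sum_eq_single j]
  · simp [site]
  · intro i _ hi
    simp [site, hi]
  · simp

/-! ### Boxes of grid points -/

/-- The points that are obtained from `y` when the given coordinates take all values
from `1` to `m`. -/
def points {k : ℕ} (m : ℕ) : List (Fin k) → (Fin k → ℕ) → List (Fin k → ℕ)
  | [], y => [y]
  | i :: is, y => (List.range m).flatMap fun r => points m is (Function.update y i (r + 1))

theorem length_points {k : ℕ} (m : ℕ) (is : List (Fin k)) (y : Fin k → ℕ) :
    (points m is y).length = m ^ is.length := by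
  induction is generalizing y with
  | nil => rfl
  | cons i is ih => simp [points, List.length_flatMap, ih, pow_succ, mul_comm]

theorem mem_points {k : ℕ} {m : ℕ} {is : List (Fin k)} (his : is.Nodup) {y z : Fin k → ℕ} :
    z ∈ points m is y ↔ (∀ i ∉ is, z i = y i) ∧ ∀ i ∈ is, 1 ≤ z i ∧ z i ≤ m := by
  induction is generalizing y with
  | nil => simp [points, funext_iff]
  | cons i is ih =>
    rw [List.nodup_cons] at his
    simp only [points, List.mem_flatMap, List.mem_range, ih his.2]
    constructor
    · rintro ⟨r, hr, h₁, h₂⟩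
      refine ⟨fun l hl => ?_, ?_⟩
      · rw [List.mem_cons, not_or] at hl
        rw [h₁ l hl.2, Function.update_of_ne hl.1]
      · rw [List.forall_mem_cons]
        refine ⟨?_, h₂⟩
        rw [h₁ i his.1, Function.update_self]
        omega
    · rintro ⟨h₁, h₂⟩
      rw [List.forall_mem_cons] at h₂
      refine ⟨z i - 1, by omega, fun l hl => ?_, h₂.2⟩
      by_cases hli : l = i
      · subst hli
        rw [Function.update_self]
        omega
      · rw [Function.update_of_ne hli, h₁ l (by simp [hli, hl])]

theorem nodup_points {k : ℕ} (m : ℕ) {is : List (Fin k)} (his : is.Nodup) (y : Fin k → ℕ) :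
    (points m is y).Nodup := by
  induction is generalizing y with
  | nil => simp [points]
  | cons i is ih =>
    rw [List.nodup_cons] at his
    refine List.nodup_flatMap.2 ⟨fun r _ => ih his.2 _, ?_⟩
    refine List.nodup_range.imp fun {r r'} hr => ?_
    intro z hz hz'
    have h₁ := ((mem_points his.2).1 hz).1 i his.1
    have h₂ := ((mem_points his.2).1 hz').1 i his.1
    rw [Function.update_self] at h₁ h₂
    omega

/-- The offsets `a` and `b` have different parity and differ by one, while `2 y` is even; so a grid
point in the pair determines both its offset and `y`. -/
theorem apart_sitePair {k : ℕ} {y y' : Fin k → ℕ} (h : y ≠ y') (j : Fin k) {a b : ℕ}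
    (hab : b = a + 1 ∨ a = b + 1) : Apart (sitePair j a b y) (sitePair j a b y') := by
  have key : ∀ o o', o ∈ [a, b] → o' ∈ [a, b] → site y j o ≠ site y' j o' := by
    intro o o' ho ho' e
    refine h (funext fun i => ?_)
    have := congrFun e i
    simp only [List.mem_cons, List.not_mem_nil, or_false] at ho ho'
    by_cases hi : i = j
    · subst hi
      rw [site_apply_self, site_apply_self] at this
      omega
    · rw [site_apply_of_ne _ _ hi, site_apply_of_ne _ _ hi] at this
      omega
  refine ⟨key _ _ ?_ ?_, key _ _ ?_ ?_, key _ _ ?_ ?_, key _ _ ?_ ?_⟩ <;> simp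

theorem parallel_sitePair {k : ℕ} {ys : List (Fin k → ℕ)} (h : ys.Nodup) (j : Fin k) {a b : ℕ}
    (hab : b = a + 1 ∨ a = b + 1) : Parallel (ys.map (sitePair j a b)) := by
  constructor
  · rw [List.pairwise_map]
    exact h.imp fun hne => apart_sitePair hne j hab
  · intro p hp
    obtain ⟨y, -, rfl⟩ := List.mem_map.1 hp
    rcases hab with rfl | rfl
    · exact adjacent_site y j a
    · exact (adjacent_site y j b).symm

/-- The coordinates before the `c`-th one are `m`, the other ones are `0`. -/
def prefixPoint {k : ℕ} (m c : ℕ) : Fin k → ℕ := fun i => if i.val < c then m else 0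

/-- The coordinates after `j`. -/
def later {k : ℕ} (j : Fin k) : List (Fin k) := (List.finRange k).filter (j < ·)

theorem nodup_later {k : ℕ} (j : Fin k) : (later j).Nodup :=
  (List.nodup_finRange k).filter _

theorem mem_later {k : ℕ} {i j : Fin k} : i ∈ later j ↔ j < i := by
  simp [later]

/-- Strict, since `j` is not after itself. The missing factor `m` in the number of sources of a
timestep pays for the `m` timesteps of a direction. -/
theorem length_later_lt {k : ℕ} (j : Fin k) : (later j).length < k := by
  have h := List.length_filter_lt_length_iff_exists (l := List.finRange k) (p := (j < ·))
  rw [List.length_finRange] at h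
  exact h.2 ⟨j, List.mem_finRange j, by simp⟩

/-- The sources of the `r`-th timestep in the direction `j`. -/
def sources {k : ℕ} (m : ℕ) (j : Fin k) (r : ℕ) : List (Fin k → ℕ) :=
  points m (later j) (Function.update (prefixPoint m j) j r)

theorem mem_sources {k : ℕ} {m r : ℕ} {j : Fin k} {y : Fin k → ℕ} : y ∈ sources m j r ↔
    (∀ i < j, y i = m) ∧ y j = r ∧ ∀ i, j < i → 1 ≤ y i ∧ y i ≤ m := by
  rw [sources, mem_points (nodup_later j)]
  simp only [mem_later, not_lt]
  constructor
  · rintro ⟨h₁, h₂⟩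
    refine ⟨fun i hi => ?_, ?_, h₂⟩
    · rw [h₁ i hi.le, Function.update_of_ne hi.ne, prefixPoint, if_pos (Fin.lt_def.1 hi)]
    · rw [h₁ j le_rfl, Function.update_self]
  · rintro ⟨h₁, h₂, h₃⟩
    refine ⟨fun i hi => ?_, h₃⟩
    rcases hi.lt_or_eq with hi | rfl
    · rw [h₁ i hi, Function.update_of_ne hi.ne, prefixPoint, if_pos (Fin.lt_def.1 hi)]
    · rw [h₂, Function.update_self]

theorem nodup_sources {k : ℕ} (m : ℕ) (j : Fin k) (r : ℕ) : (sources m j r).Nodup :=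
  nodup_points m (nodup_later j) _

/-! ### The schedule of merges -/

/-- One timestep of merging. -/
def mergeStep {k : ℕ} (m : ℕ) (j : Fin k) (r : ℕ) : Plan k (Gate × Bool) :=
  [((.prepare, false), (sources m j r).map (sitePair j 2 1)),
    ((.mark, false), (sources m j r).map (sitePair j 0 1)),
    ((.merge, false), (sources m j r).map (sitePair j 2 1))]

/-- Merging in all directions. -/
def mergeAll (k m : ℕ) : Plan k (Gate × Bool) :=
  (List.finRange k).flatMap fun j => (List.range m).flatMap fun r => mergeStep m j r

/-- The junction with source `2 y` in direction `j`. -/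
def junction {k : ℕ} (j : Fin k) (y : Fin k → ℕ) : Junction k :=
  ⟨site y j 0, site y j 1, site y j 2⟩

/-- All junctions, in the order of execution. -/
def junctions (k m : ℕ) : List (Junction k) :=
  (List.finRange k).flatMap fun j => (List.range m).flatMap fun r =>
    (sources m j r).map (junction j)

/-- The sources of one timestep share their `j`-th coordinate, so their junctions, which extend in
direction `j`, are disjoint. Hence three layers over all sources have the same effect as one
complete junction after the other. -/
theorem op_mergeStep {k : ℕ} (U : U1) (m : ℕ) (j : Fin k) (r : ℕ) :
    (mergeStep m j r).op (signedMat U) =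
      seqProd (((sources m j r).map (junction j)).map (Junction.op U)) := by
  -- Offsets change only the coordinate `j`, in which the sources agree, so different sources are
  -- told apart by another coordinate.
  have hs : ∀ {y y'}, y ∈ sources m j r → y' ∈ sources m j r → y ≠ y' →
      ∀ o o', o ≤ 2 → o' ≤ 2 → site y j o ≠ site y' j o' := by
    intro y y' hy hy' hne o o' ho ho' e
    rw [mem_sources] at hy hy'
    refine hne (funext fun i => ?_)
    by_cases hi : i = j
    · rw [hi, hy.2.1, hy'.2.1]
    · have := congrFun e i
      rw [site_apply_of_ne _ _ hi, site_apply_of_ne _ _ hi] at this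
      omega
  have hap : ∀ {y y'}, y ∈ sources m j r → y' ∈ sources m j r → y ≠ y' →
      ∀ a b a' b', a ≤ 2 → b ≤ 2 → a' ≤ 2 → b' ≤ 2 →
        Apart (sitePair j a b y) (sitePair j a' b' y') :=
    fun hy hy' hne a b a' b' ha hb ha' hb' =>
      ⟨hs hy hy' hne a a' ha ha', hs hy hy' hne a b' ha hb', hs hy hy' hne b a' hb ha',
        hs hy hy' hne b b' hb hb'⟩
  have hpw : (sources m j r).Pairwise fun y y' =>
      y ∈ sources m j r ∧ y' ∈ sources m j r ∧ y ≠ y' :=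
    List.pairwise_iff_forall_sublist.2 fun {a b} hab =>
      ⟨hab.subset (by simp), hab.subset (by simp),
        List.pairwise_iff_forall_sublist.1 (nodup_sources m j r) hab⟩
  have e₁ : seqProd (((sources m j r).map (junction j)).map (Junction.op U)) =
      seqProd ((sources m j r).map fun y =>
        op (signedMat U (.merge, false)) (sitePair j 2 1 y).1 (sitePair j 2 1 y).2 *
          (op (signedMat U (.mark, false)) (sitePair j 0 1 y).1 (sitePair j 0 1 y).2 *
          op (signedMat U (.prepare, false)) (sitePair j 2 1 y).1 (sitePair j 2 1 y).2)) := by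
    rw [List.map_map]
    rfl
  -- Two applications split the product of three factors into three layers.
  rw [e₁, seqProd_map_mul, seqProd_map_mul]
  · simp only [Plan.op, mergeStep, List.map_cons, List.map_nil, seqProd, one_mul, opPar,
      List.map_map]
    rw [mul_assoc]
    rfl
  · refine hpw.imp fun {y y'} h => ?_
    exact (hap h.2.1 h.1 h.2.2.symm 2 1 0 1 (by simp) (by simp) (by simp) (by simp)).commute_op
      (signedMat U (.prepare, false)) (signedMat U (.mark, false))
  · refine hpw.imp fun {y y'} h => ?_
    refine Commute.mul_left ?_ ?_
    · exact (hap h.2.1 h.1 h.2.2.symm 0 1 2 1 (by simp) (by simp) (by simp) (by simp)).commute_op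
        (signedMat U (.mark, false)) (signedMat U (.merge, false))
    · exact (hap h.2.1 h.1 h.2.2.symm 2 1 2 1 (by simp) (by simp) (by simp) (by simp)).commute_op
        (signedMat U (.prepare, false)) (signedMat U (.merge, false))

theorem Plan.op_flatMap {k : ℕ} {ι g : Type} (V : g → Matrix (Bool × Bool) (Bool × Bool) ℂ)
    {J : Type} (W : J → Module.End ℂ (Amp k)) (P : ι → Plan k g) (Q : ι → List J)
    (h : ∀ i, (P i).op V = seqProd ((Q i).map W)) (l : List ι) :
    Plan.op V (l.flatMap P) = seqProd ((l.flatMap Q).map W) := by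
  induction l with
  | nil => rfl
  | cons i l ih =>
    rw [List.flatMap_cons, List.flatMap_cons, Plan.op_append, List.map_append, seqProd_append, ih,
      h]

theorem op_mergeAll {k : ℕ} (U : U1) (m : ℕ) :
    (mergeAll k m).op (signedMat U) = seqProd ((junctions k m).map (Junction.op U)) :=
  Plan.op_flatMap _ _ _ _ (fun j => Plan.op_flatMap _ _ _ _ (op_mergeStep U m j) _) _

theorem mem_junctions {k m : ℕ} {g : Junction k} : g ∈ junctions k m ↔ ∃ j y, g = junction j y ∧
    (∀ i < j, y i = m) ∧ y j < m ∧ ∀ i, j < i → 1 ≤ y i ∧ y i ≤ m := by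
  simp only [junctions, List.mem_flatMap, List.mem_finRange, true_and, List.mem_range,
    List.mem_map, mem_sources]
  constructor
  · rintro ⟨j, r, hr, y, ⟨h₁, h₂, h₃⟩, rfl⟩
    exact ⟨j, y, rfl, h₁, by omega, h₃⟩
  · rintro ⟨j, y, rfl, h₁, h₂, h₃⟩
    exact ⟨j, y j, h₂, y, ⟨h₁, rfl, h₃⟩, rfl⟩

/-- The hypothesis `h'` says that `y' + e_{j'} ≠ y`, so the later destination is not the earlier
source. Ancillas need only `y' ≠ y`: the odd coordinate of `2 y + e_j` determines `j`, and then `y`.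
-/
theorem junction_order {k : ℕ} {j j' : Fin k} {y y' : Fin k → ℕ} (h : y' ≠ y)
    (h' : ∃ i, (i ≠ j' ∧ y' i ≠ y i) ∨ (i = j' ∧ y' i + 1 ≠ y i)) :
    (junction j' y').a ≠ (junction j y).a ∧ (junction j' y').b ≠ (junction j y).a ∧
      (junction j' y').t ≠ (junction j y).t := by
  refine ⟨fun e => h (funext fun i => ?_), fun e => ?_, fun e => h (funext fun i => ?_)⟩
  · have := congrFun e i
    simp only [junction, site, ite_self, add_zero] at this
    omega
  · obtain ⟨i, hi⟩ := h'
    have := congrFun e i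
    simp only [junction, site, ite_self, add_zero] at this
    rcases hi with ⟨h₁, h₂⟩ | ⟨h₁, h₂⟩
    · rw [if_neg h₁] at this
      omega
    · rw [if_pos h₁] at this
      omega
  · have := congrFun e i
    simp only [junction, site] at this
    split_ifs at this <;> omega

/-- Within a timestep and between timesteps of one direction, later destinations have a larger
`j`-th coordinate than earlier sources. In a later direction the `j`-th coordinate is `m`
throughout, whereas sources of direction `j` have it smaller than `m`. -/
theorem pairwise_junctions (k m : ℕ) :
    (junctions k m).Pairwise fun g g' => g'.a ≠ g.a ∧ g'.b ≠ g.a ∧ g'.t ≠ g.t := by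
  refine List.pairwise_flatMap.2 ⟨fun j _ => List.pairwise_flatMap.2 ⟨fun r _ => ?_, ?_⟩, ?_⟩
  · rw [List.pairwise_map]
    refine (List.pairwise_iff_forall_sublist.2 fun {a b} hab => ?_)
    have ha : a ∈ sources m j r := hab.subset (by simp)
    have hb : b ∈ sources m j r := hab.subset (by simp)
    have hne := List.pairwise_iff_forall_sublist.1 (nodup_sources m j r) hab
    refine junction_order hne.symm ⟨j, Or.inr ⟨rfl, ?_⟩⟩
    rw [mem_sources] at ha hb
    omega
  · refine List.pairwise_lt_range.imp fun {r r'} hr => ?_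
    simp only [List.mem_map]
    rintro _ ⟨y, hy, rfl⟩ _ ⟨y', hy', rfl⟩
    rw [mem_sources] at hy hy'
    refine junction_order (fun e => ?_) ⟨j, Or.inr ⟨rfl, by omega⟩⟩
    subst e
    omega
  · refine (List.pairwise_lt_finRange k).imp fun {j j'} hj => ?_
    simp only [List.mem_flatMap, List.mem_map, List.mem_range]
    rintro _ ⟨r, hr, y, hy, rfl⟩ _ ⟨r', hr', y', hy', rfl⟩
    rw [mem_sources] at hy hy'
    have h₁ := hy'.1 j hj
    have h₂ := hy.2.1
    refine junction_order (fun e => ?_) ⟨j, Or.inl ⟨hj.ne, by omega⟩⟩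
    subst e
    omega

/-! ### Sources, destinations and the root of the merging tree -/

/-- The places that take part in merging, except for the ancillas. -/
def treePlaces (k m : ℕ) : Set (Site k) :=
  {z | ∃ y : Fin k → ℕ, z = (fun i => 2 * (y i : ℤ)) ∧ (∀ i, y i ≤ m) ∧
    ∀ i l, i < l → y i < m → 1 ≤ y l}

theorem junctions_spec {k m : ℕ} {g : Junction k} (hg : g ∈ junctions k m) :
    g.a ∈ treePlaces k m ∧ g.b ∈ treePlaces k m ∧ g.t ∉ treePlaces k m ∧ g.a ≠ g.b := by
  obtain ⟨j, y, rfl, h₁, h₂, h₃⟩ := mem_junctions.1 hg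
  have hle : ∀ i, y i ≤ m := fun i => by
    rcases lt_trichotomy i j with h | h | h
    · exact (h₁ i h).le
    · exact h ▸ h₂.le
    · exact (h₃ i h).2
  -- The destination `2 y + 2 e_j` belongs to the point `y + e_j`.
  refine ⟨⟨y, ?_, hle, ?_⟩, ⟨Function.update y j (y j + 1), ?_, ?_, ?_⟩, ?_, ?_⟩
  · funext i
    simp [junction, site]
  · intro i l hil hi
    have : ¬ i < j := fun h => hi.ne (h₁ i h)
    exact (h₃ l (lt_of_le_of_lt (not_lt.1 this) hil)).1
  · funext i
    by_cases h : i = j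
    · subst h
      simp only [junction, site_apply_self, Function.update_self]
      push_cast
      ring
    · simp only [junction, site_apply_of_ne _ _ h, Function.update_of_ne h]
  · intro i
    by_cases h : i = j
    · subst h
      rw [Function.update_self]
      omega
    · rw [Function.update_of_ne h]
      exact hle i
  · intro i l hil hi
    by_cases h : l = j
    · subst h
      rw [Function.update_self]
      omega
    · rw [Function.update_of_ne h]
      have : ¬ i < j := fun h' => by
        rw [Function.update_of_ne h'.ne] at hi
        exact hi.ne (h₁ i h')
      exact (h₃ l (lt_of_le_of_lt (not_lt.1 this) hil)).1
  -- The ancilla has an odd coordinate.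
  · rintro ⟨y', h, -⟩
    have := congrFun h j
    simp only [junction, site_apply_self] at this
    omega
  · intro h
    have := congrFun h j
    simp only [junction, site_apply_self] at this
    omega

/-- A point other than `(m, …, m)` is a source in the direction of its first coordinate that is not
`m`; the condition in `treePlaces` makes its later coordinates positive, as a source requires. -/
theorem treePlaces_diff {k m : ℕ} {z : Site k} :
    (z ∈ treePlaces k m ∧ ∀ g ∈ junctions k m, g.a ≠ z) ↔ z = fun _ => 2 * (m : ℤ) := by
  constructor
  · rintro ⟨⟨y, rfl, h₁, h₂⟩, h₃⟩
    suffices h : ∀ i, y i = m by simp [h]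
    by_contra hne
    push Not at hne
    -- The first coordinate that differs from `m`.
    obtain ⟨j, hj, hmin⟩ := Finset.exists_min_image (Finset.univ.filter fun i => y i ≠ m) id
      (by simpa [Finset.filter_nonempty_iff] using hne)
    simp only [Finset.mem_filter, Finset.mem_univ, true_and, id] at hj hmin
    have hjm : y j < m := lt_of_le_of_ne (h₁ j) hj
    refine h₃ (junction j y) (mem_junctions.2 ⟨j, y, rfl, fun i hi => ?_, hjm, fun i hi =>
      ⟨h₂ j i hi hjm, h₁ i⟩⟩) ?_
    · by_contra hne
      exact absurd hi (not_lt.2 (hmin i hne))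
    · funext i
      simp [junction, site]
  · rintro rfl
    refine ⟨⟨fun _ => m, rfl, fun _ => le_rfl, fun i l _ h => absurd h (lt_irrefl m)⟩, ?_⟩
    intro g hg e
    obtain ⟨j, y, rfl, -, h, -⟩ := mem_junctions.1 hg
    have := congrFun e j
    simp only [junction, site_apply_self] at this
    omega

/-- Keeps all junctions away from the target, which has a coordinate `2 m + 1`. -/
theorem junctions_bound {k m : ℕ} {g : Junction k} (hg : g ∈ junctions k m) (i : Fin k) :
    g.a i ≤ 2 * m ∧ g.t i ≤ 2 * m ∧ g.b i ≤ 2 * m := by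
  obtain ⟨j, y, rfl, h₁, h₂, h₃⟩ := mem_junctions.1 hg
  by_cases h : i = j
  · subst h
    simp only [junction, site_apply_self]
    omega
  · simp only [junction, site_apply_of_ne _ _ h]
    rcases lt_or_gt_of_ne h with h | h
    · have := h₁ i h
      omega
    · have := h₃ i h
      omega

/-- Separates the ancillas of the junctions from the controls, whose coordinates are even. -/
theorem junctions_odd {k m : ℕ} {g : Junction k} (hg : g ∈ junctions k m) :
    ∃ j : Fin k, ∃ v : ℤ, g.t j = 2 * v + 1 := by
  obtain ⟨j, y, rfl, -⟩ := mem_junctions.1 hg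
  exact ⟨j, y j, by simp [junction, site_apply_self]⟩

/-! ### The plan for the controlled operation -/

/-- The points at which the controls may be placed. -/
def cells (k m : ℕ) : List (Fin k → ℕ) := points m (List.finRange k) (prefixPoint m 0)

theorem length_cells (k m : ℕ) : (cells k m).length = m ^ k := by
  rw [cells, length_points, List.length_finRange]

theorem nodup_cells (k m : ℕ) : (cells k m).Nodup := nodup_points _ (List.nodup_finRange k) _

theorem mem_cells {k m : ℕ} {y : Fin k → ℕ} : y ∈ cells k m ↔ ∀ i, 1 ≤ y i ∧ y i ≤ m := by
  rw [cells, mem_points (List.nodup_finRange k)]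
  simp

/-- Flip the controls and compute whether one of them is now `1`. -/
def preparation (k m n : ℕ) (j₀ : Fin k) : Plan k (Gate × Bool) :=
  ((.flip, false), ((cells k m).take n).map (sitePair j₀ 1 0)) :: mergeAll k m

/-- The inverse of a named unitary. -/
def invertGate (g : Gate × Bool) : Gate × Bool := (g.1, !g.2)

/-- The plan for the controlled operation with `n` controls. -/
def mainPlan (k m n : ℕ) (j₀ : Fin k) : Plan k (Gate × Bool) :=
  preparation k m n j₀ ++ [((.control, false), [sitePair j₀ 0 1 (prefixPoint m k)])] ++
    (preparation k m n j₀).inverse invertGate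

theorem parallel_mergeAll {k m : ℕ} {s : (Gate × Bool) × List (Site k × Site k)}
    (hs : s ∈ mergeAll k m) : Parallel s.2 := by
  simp only [mergeAll, List.mem_flatMap] at hs
  obtain ⟨j, -, r, -, hs⟩ := hs
  simp only [mergeStep, List.mem_cons, List.not_mem_nil, or_false] at hs
  rcases hs with rfl | rfl | rfl
  · exact parallel_sitePair (nodup_sources m j r) j (Or.inr rfl)
  · exact parallel_sitePair (nodup_sources m j r) j (Or.inl rfl)
  · exact parallel_sitePair (nodup_sources m j r) j (Or.inr rfl)

theorem parallel_preparation {k m n : ℕ} {j₀ : Fin k}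
    {s : (Gate × Bool) × List (Site k × Site k)} (hs : s ∈ preparation k m n j₀) :
    Parallel s.2 := by
  rcases List.mem_cons.1 hs with rfl | hs
  · exact parallel_sitePair ((nodup_cells k m).sublist (List.take_sublist _ _)) j₀ (Or.inr rfl)
  · exact parallel_mergeAll hs

theorem parallel_mainPlan {k m n : ℕ} {j₀ : Fin k}
    {s : (Gate × Bool) × List (Site k × Site k)} (hs : s ∈ mainPlan k m n j₀) :
    Parallel s.2 := by
  simp only [mainPlan, List.mem_append, List.mem_singleton] at hs
  rcases hs with (hs | rfl) | hs
  · exact parallel_preparation hs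
  · exact parallel_sitePair (List.nodup_singleton (prefixPoint m k)) j₀ (Or.inl rfl)
  · simp only [Plan.inverse, List.mem_map, List.mem_reverse] at hs
    obtain ⟨s, hs, rfl⟩ := hs
    exact parallel_preparation (s := s) hs

/-- The places of the controls and the target. -/
def mainLayout (k m n : ℕ) (j₀ : Fin k) (hn : n ≤ m ^ k) : Layout k n where
  ctrl := ⟨fun i => site ((cells k m).get (i.castLE (hn.trans_eq (length_cells k m).symm))) j₀ 0,
    fun i i' h => by
      have h' : (cells k m).get (i.castLE (hn.trans_eq (length_cells k m).symm)) =
          (cells k m).get (i'.castLE (hn.trans_eq (length_cells k m).symm)) := funext fun l => by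
        have := congrFun h l
        simp only [site, ite_self, add_zero] at this
        omega
      simpa [Fin.ext_iff] using (nodup_cells k m).injective_get h'⟩
  target := site (prefixPoint m k) j₀ 1
  target_ne := fun i h => by
    -- In the coordinate `j₀` controls are even and the target is odd.
    have : site ((cells k m).get _) j₀ 0 j₀ = site (prefixPoint m k) j₀ 1 j₀ := congrFun h j₀
    rw [site_apply_self, site_apply_self] at this
    omega

/-- The classical effect of the preparation. -/
def prepared (k m n : ℕ) (j₀ : Fin k) (x : Config k) : Config k :=
  (junctions k m).foldl Junction.map
    ((((cells k m).take n).map (sitePair j₀ 1 0)).foldl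
      (fun x a => Function.update x a.2 (!x a.2)) x)

theorem mem_ctrl_iff {k m n : ℕ} {j₀ : Fin k} {hn : n ≤ m ^ k} {z : Site k} :
    z ∈ (((cells k m).take n).map (sitePair j₀ 1 0)).map Prod.snd ↔
      ∃ i, z = (mainLayout k m n j₀ hn).ctrl i := by
  rw [List.map_map, List.mem_map]
  constructor
  · rintro ⟨y, hy, rfl⟩
    obtain ⟨i, hi, rfl⟩ := List.mem_take_iff_getElem.1 hy
    exact ⟨⟨i, by omega⟩, rfl⟩
  · rintro ⟨i, rfl⟩
    refine ⟨_, List.mem_take_iff_getElem.2 ⟨i, ?_, rfl⟩, rfl⟩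
    rw [length_cells]
    have := i.2
    omega

theorem nodup_ctrl {k m n : ℕ} {j₀ : Fin k} :
    ((((cells k m).take n).map (sitePair j₀ 1 0)).map Prod.snd).Nodup := by
  rw [List.map_map]
  refine ((nodup_cells k m).sublist (List.take_sublist _ _)).map fun y y' h => funext fun l => ?_
  have := congrFun h l
  simp only [Function.comp, sitePair, site, ite_self, add_zero] at this
  omega

/-- After the flips the tree contains a `1` exactly if some control was `0`; merging carries this
disjunction to the only place that is never a source. -/
theorem preparation_ket {k m n : ℕ} {j₀ : Fin k} (hn : n ≤ m ^ k) (U : U1)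
    (s : (Fin n → Bool) × Bool) :
    (preparation k m n j₀).op (signedMat U) (ket ((mainLayout k m n j₀ hn).config s)) =
        ket (prepared k m n j₀ ((mainLayout k m n j₀ hn).config s)) ∧
      (prepared k m n j₀ ((mainLayout k m n j₀ hn).config s) (fun _ => 2 * (m : ℤ)) = true ↔
        ¬ ∀ i, s.1 i = true) := by
  set l := mainLayout k m n j₀ hn with hl
  set ps := ((cells k m).take n).map (sitePair j₀ 1 0) with hps
  set x := ps.foldl (fun x a => Function.update x a.2 (!x a.2)) (l.config s) with hx
  have hval : ∀ z, x z = (l.config s z ^^ decide (z ∈ ps.map Prod.snd)) :=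
    foldl_flip_apply nodup_ctrl (l.config s)
  have heven : ∀ i i', ∃ v : ℤ, l.ctrl i i' = 2 * v := fun i i' => by
    refine ⟨((cells k m).get (i.castLE (hn.trans_eq (length_cells k m).symm)) i' : ℕ), ?_⟩
    simp [hl, mainLayout, site]
  have hzero : ∀ z, (∀ i, z ≠ l.ctrl i) → z ≠ l.target → x z = false := fun z h h' => by
    rw [hval, l.config_other s h h']
    have : z ∉ ps.map Prod.snd := fun hz => by
      obtain ⟨i, hi⟩ := (mem_ctrl_iff (hn := hn)).1 hz
      exact h i hi
    simp [this]
  have hctrl : ∀ i, x (l.ctrl i) = !s.1 i := fun i => by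
    rw [hval, l.config_ctrl]
    have : l.ctrl i ∈ ps.map Prod.snd := (mem_ctrl_iff (hn := hn)).2 ⟨i, rfl⟩
    simp [this]
  have htgt : l.target j₀ = 2 * (m : ℤ) + 1 := by
    simp [hl, mainLayout, site_apply_self, prefixPoint]
  obtain ⟨h₁, h₂⟩ := foldl_junction U (junctions k m) (treePlaces k m)
    -- The ancillas start in `0`: parity distinguishes them from the controls, and the size of the
    -- coordinate `j₀` from the target.
    (fun g hg => junctions_spec hg) (pairwise_junctions k m) x fun g hg => by
      refine hzero _ (fun i e => ?_) fun e => ?_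
      · obtain ⟨j, v, hv⟩ := junctions_odd hg
        obtain ⟨v', hv'⟩ := heven i j
        rw [e] at hv
        omega
      · have := (junctions_bound hg j₀).2.1
        rw [e, htgt] at this
        omega
  constructor
  · have e : (preparation k m n j₀).op (signedMat U) =
        (mergeAll k m).op (signedMat U) * opPar (signedMat U (.flip, false)) ps := rfl
    rw [e, op_mergeAll, Module.End.mul_apply, opPar_flip_ket U, ← hx, h₁]
    · rfl
    · intro a ha
      exact ((parallel_sitePair ((nodup_cells k m).sublist (List.take_sublist _ _)) j₀
        (Or.inr rfl)).2 a ha).ne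
  · have e : prepared k m n j₀ (l.config s) = (junctions k m).foldl Junction.map x := rfl
    -- The root is the only place of the tree that is not a source.
    have h₃ : (∃ z ∈ treePlaces k m, (∀ g ∈ junctions k m, g.a ≠ z) ∧
        (junctions k m).foldl Junction.map x z = true) ↔
        (junctions k m).foldl Junction.map x (fun _ => 2 * (m : ℤ)) = true := by
      simp only [← and_assoc, treePlaces_diff, exists_eq_left]
    rw [e, ← h₃, h₂]
    push Not
    constructor
    -- A place of the tree that holds `1` must be a flipped control: the target is outside the tree,
    -- and everything else is `0`.
    · rintro ⟨z, ⟨y, rfl, hy, -⟩, hz⟩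
      by_contra hne
      push Not at hne
      rw [hzero] at hz
      · exact absurd hz (by simp)
      · intro i hi
        rw [hi, hctrl, hne i] at hz
        exact absurd hz (by simp)
      · intro e
        have := congrFun e j₀
        rw [htgt] at this
        omega
    · rintro ⟨i, hi⟩
      refine ⟨l.ctrl i, ?_, by rw [hctrl]; simpa using hi⟩
      set y := (cells k m).get (i.castLE (hn.trans_eq (length_cells k m).symm)) with hy
      have hmem : ∀ l, 1 ≤ y l ∧ y l ≤ m := mem_cells.1 (List.get_mem _ _)
      refine ⟨y, ?_, fun l => (hmem l).2, fun _ l _ _ => (hmem l).1⟩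
      funext l'
      simp [hl, mainLayout, site, hy]

/-- The target is neither flipped nor part of a junction. So after the controlled step has changed
the target, each branch is still a prepared basis state, and the inverse preparation restores
controls and ancillas. -/
theorem prepared_update {k m n : ℕ} {j₀ : Fin k} (hn : n ≤ m ^ k) (x : Config k) (b : Bool) :
    prepared k m n j₀ (Function.update x (mainLayout k m n j₀ hn).target b) =
      Function.update (prepared k m n j₀ x) (mainLayout k m n j₀ hn).target b := by
  have htgt : (mainLayout k m n j₀ hn).target j₀ = 2 * (m : ℤ) + 1 := by
    simp [mainLayout, site_apply_self, prefixPoint]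
  unfold prepared
  rw [← foldl_junction_map_update]
  · congr 1
    have : ∀ a ∈ ((cells k m).take n).map (sitePair j₀ 1 0),
        a.2 ≠ (mainLayout k m n j₀ hn).target := fun a ha e => by
      obtain ⟨i, hi⟩ := (mem_ctrl_iff (hn := hn)).1 (List.mem_map_of_mem ha)
      exact (mainLayout k m n j₀ hn).target_ne i (hi.symm.trans e)
    generalize ((cells k m).take n).map (sitePair j₀ 1 0) = ps at this
    induction ps generalizing x with
    | nil => rfl
    | cons a ps ih =>
      rw [List.forall_mem_cons] at this
      simp only [List.foldl_cons]
      rw [← ih _ this.2, Function.update_of_ne this.1, Function.update_comm this.1]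
  · intro g hg
    obtain ⟨h₁, h₂, h₃⟩ := junctions_bound hg j₀
    refine ⟨fun e => ?_, fun e => ?_, fun e => ?_⟩
    · rw [e, htgt] at h₁; omega
    · rw [e, htgt] at h₂; omega
    · rw [e, htgt] at h₃; omega

/-- Compute, act, uncompute. The middle gate acts on the target if the root is `0`, that is, if no
flipped control is `1`. -/
theorem mainPlan_ket {k m n : ℕ} {j₀ : Fin k} (hn : n ≤ m ^ k) (U : U1)
    (s : (Fin n → Bool) × Bool) :
    (mainPlan k m n j₀).op (signedMat U) (ket ((mainLayout k m n j₀ hn).config s)) =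
      ∑ t, controlled n U t s • ket ((mainLayout k m n j₀ hn).config t) := by
  set l := mainLayout k m n j₀ hn with hl
  obtain ⟨h₁, h₂⟩ := preparation_ket (j₀ := j₀) hn U s
  rw [← hl] at h₁ h₂
  have hinv : ∀ t, ((preparation k m n j₀).inverse invertGate).op (signedMat U)
      (ket (prepared k m n j₀ (l.config t))) = ket (l.config t) := fun t => by
    rw [← (preparation_ket hn U t).1, ← Module.End.mul_apply,
      Plan.op_inverse_mul invertGate (signedMat U) (signedMat_inv_mul U) _
        fun s hs => parallel_preparation hs, Module.End.one_apply]
  have hroot : site (prefixPoint m k) j₀ 0 = fun _ => 2 * (m : ℤ) := by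
    funext i
    simp [site, prefixPoint]
  have hne : (fun _ => 2 * (m : ℤ)) ≠ l.target := by
    rw [← hroot]
    exact (adjacent_site _ j₀ 0).ne
  have hmid : Plan.op (signedMat U) [((Gate.control, false), [sitePair j₀ 0 1 (prefixPoint m k)])]
      = op (select U 1) (fun _ => 2 * (m : ℤ)) l.target := by
    rw [← hroot]
    exact (one_mul _).trans (one_mul _)
  have hupd : ∀ c, Function.update (prepared k m n j₀ (l.config s)) l.target c =
      prepared k m n j₀ (l.config (s.1, c)) := fun c => by
    rw [← prepared_update hn, ← hl, l.config_update]
  have htgt : prepared k m n j₀ (l.config s) l.target = s.2 := by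
    have := congrFun (hupd s.2) l.target
    rw [Function.update_self] at this
    exact this.symm
  -- Only outcomes with the original control values have a nonzero coefficient, which leaves the sum
  -- over the target bit.
  rw [mainPlan, Plan.op_append, Plan.op_append, Module.End.mul_apply, Module.End.mul_apply, h₁,
    hmid, op_select_ket _ _ hne, map_sum, Fintype.sum_prod_type, Finset.sum_eq_single s.1]
  · refine Finset.sum_congr rfl fun c _ => ?_
    rw [map_smul, hupd, hinv, htgt]
    congr 1
    simp only [controlled, if_true]
    by_cases hs : ∀ i, s.1 i = true
    · rw [if_pos hs, if_neg fun h => h₂.1 h hs]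
    · rw [if_neg hs, if_pos (h₂.2 hs)]
  · intro c _ hc
    exact Finset.sum_eq_zero fun b _ => by simp [controlled, hc]
  · exact fun h => absurd (Finset.mem_univ _) h

/-! ### Rules for counter programs -/

section

variable {R α : Type} [DecidableEq R]

/-- Execute programs one after the other. -/
def Prog.seqs : List (Prog R α) → Prog R α
  | [] => .skip
  | p :: ps => .seq p (Prog.seqs ps)

theorem Runs.seqs {ps : List (Prog R α)} {T : ℕ} (S : ℕ → Store R α)
    (h : ∀ (i : ℕ) (hi : i < ps.length), Runs ps[i] (S i) (S (i + 1)) T) :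
    Runs (Prog.seqs ps) (S 0) (S ps.length) (ps.length * T + 1) := by
  induction ps generalizing S with
  | nil => exact (Runs.skip (S 0)).weaken (by simp)
  | cons p ps ih =>
    have h₁ := h 0 (by simp)
    have h₂ := ih (fun i => S (i + 1)) fun i hi => h (i + 1) (by simpa using hi)
    refine (h₁.seq h₂).weaken ?_
    rw [List.length_cons]
    linarith

theorem Runs.seqs_ofFn {k : ℕ} {p : Fin k → Prog R α} {T : ℕ} (S : ℕ → Store R α)
    (h : ∀ i : Fin k, Runs (p i) (S i) (S (i + 1)) T) :
    Runs (Prog.seqs (List.ofFn p)) (S 0) (S k) (k * T + 1) := by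
  have := Runs.seqs (ps := List.ofFn p) (T := T) S fun i hi => by
    rw [List.getElem_ofFn]
    exact h ⟨i, by simpa using hi⟩
  rwa [List.length_ofFn] at this

theorem Runs.emits (l : List α) (S : Store R α) :
    Runs (Prog.seqs (l.map Prog.emit)) S ⟨S.reg, S.out ++ l⟩ (l.length + 1) := by
  induction l generalizing S with
  | nil =>
    rw [List.append_nil]
    exact Runs.skip S
  | cons a l ih =>
    have := (Runs.emit a S).seq (ih _)
    rw [List.append_assoc] at this
    refine this.weaken ?_
    rw [List.length_cons]
    omega

theorem Runs.seqs_emit {J : Type} {T : ℕ} (p : J → Prog R α) (f : J → List α) (ρ : R → ℕ)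
    (js : List J) (h : ∀ j ∈ js, ∀ o, Runs (p j) ⟨ρ, o⟩ ⟨ρ, o ++ f j⟩ T) (o : List α) :
    Runs (Prog.seqs (js.map p)) ⟨ρ, o⟩ ⟨ρ, o ++ js.flatMap f⟩ (js.length * T + 1) := by
  induction js generalizing o with
  | nil =>
    rw [List.flatMap_nil, List.append_nil]
    exact (Runs.skip _).weaken (by simp)
  | cons j js ih =>
    rw [List.forall_mem_cons] at h
    have := (h.1 o).seq (ih h.2 (o ++ f j))
    rw [List.append_assoc] at this
    refine this.weaken ?_
    rw [List.length_cons]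
    linarith

/-- `S i` is the store at a test, after `i` rounds. The number of rounds is given by these stores
and not by the initial value of `r`, because bodies may change `r` themselves; the search and the
merging loops do. -/
theorem Runs.loop {r : R} {p : Prog R α} {T : ℕ} (N : ℕ) (S : ℕ → Store R α)
    (hN : (S N).reg r = 0)
    (h : ∀ i < N, ∃ v, (S i).reg r = v + 1 ∧
      Runs p ⟨Function.update (S i).reg r v, (S i).out⟩ (S (i + 1)) T) :
    Runs (.loop r p) (S 0) (S N) (N * (T + 1) + 1) := by
  induction N generalizing S with
  | zero => exact (Runs.loop_zero hN).weaken (by simp)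
  | succ N ih =>
    obtain ⟨v, hv, h₀⟩ := h 0 (by omega)
    refine (Runs.loop_succ hv h₀ (ih (fun i => S (i + 1)) hN fun i hi =>
      h (i + 1) (by omega))).weaken ?_
    linarith

end

/-! ### The registers -/

/-- The registers of the program that writes the circuit. -/
inductive Reg (k : ℕ) : Type
  | cnt (i : Fin k)
  | pos (i : Fin k)
  | tmp
  | src
  | dst
  deriving DecidableEq

instance (k : ℕ) : Finite (Reg k) :=
  Finite.of_surjective
    (fun x : (Fin k ⊕ Fin k) ⊕ Fin 3 => match x with
      | .inl (.inl i) => Reg.cnt i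
      | .inl (.inr i) => Reg.pos i
      | .inr 0 => Reg.tmp
      | .inr 1 => Reg.src
      | .inr 2 => Reg.dst) fun r =>
    match r with
    | .cnt i => ⟨.inl (.inl i), rfl⟩
    | .pos i => ⟨.inl (.inr i), rfl⟩
    | .tmp => ⟨.inr 0, rfl⟩
    | .src => ⟨.inr 1, rfl⟩
    | .dst => ⟨.inr 2, rfl⟩

/-- The registers with the given values. -/
def regs {k : ℕ} (a y : Fin k → ℕ) (t s d : ℕ) : Reg k → ℕ
  | .cnt i => a i
  | .pos i => y i
  | .tmp => t
  | .src => s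
  | .dst => d

section

variable {k : ℕ} (a y : Fin k → ℕ) (t s d v : ℕ) (i : Fin k)

theorem update_regs_cnt :
    Function.update (regs a y t s d) (.cnt i) v = regs (Function.update a i v) y t s d := by
  funext r
  cases r <;> simp [Function.update_apply, regs]

theorem update_regs_pos :
    Function.update (regs a y t s d) (.pos i) v = regs a (Function.update y i v) t s d := by
  funext r
  cases r <;> simp [Function.update_apply, regs]

theorem update_regs_tmp : Function.update (regs a y t s d) .tmp v = regs a y v s d := by
  funext r
  cases r <;> simp [regs]

theorem update_regs_src : Function.update (regs a y t s d) .src v = regs a y t v d := by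
  funext r
  cases r <;> simp [regs]

theorem update_regs_dst : Function.update (regs a y t s d) .dst v = regs a y t s v := by
  funext r
  cases r <;> simp [regs]

variable {α : Type} (o : List α)

theorem runs_inc_cnt : Runs (.inc (.cnt i)) ⟨regs a y t s d, o⟩
    ⟨regs (Function.update a i (a i + 1)) y t s d, o⟩ 1 := by
  rw [← update_regs_cnt]
  exact Runs.inc _ _

theorem runs_inc_pos : Runs (.inc (.pos i)) ⟨regs a y t s d, o⟩
    ⟨regs a (Function.update y i (y i + 1)) t s d, o⟩ 1 := by
  rw [← update_regs_pos]
  exact Runs.inc _ _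

theorem runs_inc_tmp : Runs (.inc .tmp) ⟨regs a y t s d, o⟩ ⟨regs a y (t + 1) s d, o⟩ 1 := by
  rw [← update_regs_tmp a y t s d (t + 1)]
  exact Runs.inc (R := Reg k) _ ⟨regs a y t s d, o⟩

theorem runs_inc_src : Runs (.inc .src) ⟨regs a y t s d, o⟩ ⟨regs a y t (s + 1) d, o⟩ 1 := by
  rw [← update_regs_src a y t s d (s + 1)]
  exact Runs.inc (R := Reg k) _ ⟨regs a y t s d, o⟩

theorem runs_inc_dst : Runs (.inc .dst) ⟨regs a y t s d, o⟩ ⟨regs a y t s (d + 1), o⟩ 1 := by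
  rw [← update_regs_dst a y t s d (d + 1)]
  exact Runs.inc (R := Reg k) _ ⟨regs a y t s d, o⟩

end

/-- The store while the circuit is being written: the counters complement the coordinates. -/
def gridStore {k : ℕ} {α : Type} (m : ℕ) (y : Fin k → ℕ) (σ : ℕ × ℕ × List α) :
    Store (Reg k) α :=
  ⟨regs (fun i => m - y i) y 0 σ.1 σ.2.1, σ.2.2⟩

theorem update_sub {k : ℕ} (m : ℕ) (y : Fin k → ℕ) (i : Fin k) (v : ℕ) :
    (fun l => m - Function.update y i v l) = Function.update (fun l => m - y l) i (m - v) := by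
  funext l
  by_cases h : l = i
  · subst h; simp
  · simp [h]

/-! ### Nested loops over the points -/

/-- Execute a program at all points that are obtained when the given coordinates vary. -/
def nest {k : ℕ} {α : Type} (body : Prog (Reg k) α) : List (Fin k) → Prog (Reg k) α
  | [] => body
  | i :: is => .seq (.loop (.cnt i) (.seq (.inc (.pos i)) (nest body is)))
      (.loop (.pos i) (.inc (.cnt i)))

/-- A bound for the running time of nested loops. -/
def nestCost (N T : ℕ) : ℕ → ℕ
  | 0 => T
  | c + 1 => (N + 1) * (nestCost N T c + 5)

theorem nestCost_mono {N T c c' : ℕ} (h : c ≤ c') : nestCost N T c ≤ nestCost N T c' := by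
  induction h with
  | refl => rfl
  | step _ ih =>
    refine ih.trans ?_
    rw [nestCost]
    nlinarith

/-- In each level the units of `cnt i` move to `pos i` one by one, so that they always add up to
`m`, and the second loop moves them back. Since `pos i` is increased before the body, the body meets
the values `1` to `m`. -/
theorem runs_nest {k : ℕ} {α : Type} {body : Prog (Reg k) α} {m N T : ℕ} (hm : m ≤ N)
    (f : (Fin k → ℕ) → ℕ × ℕ × List α → ℕ × ℕ × List α) {is : List (Fin k)} (his : is.Nodup)
    {y : Fin k → ℕ} (hy : ∀ i ∈ is, y i = 0)
    (hbody : ∀ z ∈ points m is y, ∀ σ, Runs body (gridStore m z σ) (gridStore m z (f z σ)) T)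
    (σ : ℕ × ℕ × List α) :
    Runs (nest body is) (gridStore m y σ)
      (gridStore m y ((points m is y).foldl (fun σ z => f z σ) σ)) (nestCost N T is.length) := by
  induction is generalizing y σ with
  | nil => exact hbody y (by simp [points]) σ
  | cons i is ih =>
    rw [List.nodup_cons] at his
    rw [List.forall_mem_cons] at hy
    have e : Function.update y i 0 = y := by rw [← hy.1, Function.update_eq_self]
    have h₁ : Runs (.loop (.cnt i) (.seq (.inc (.pos i)) (nest body is))) (gridStore m y σ)
        (gridStore m (Function.update y i m) ((points m (i :: is) y).foldl (fun σ z => f z σ) σ))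
        (m * (1 + nestCost N T is.length + 1) + 1) := by
      -- The state after `r` rounds, kept opaque so that simplification does not unfold it.
      obtain ⟨g, hg⟩ : ∃ g : ℕ → ℕ × ℕ × List α, ∀ r, g r =
          ((List.range r).flatMap fun r => points m is (Function.update y i (r + 1))).foldl
            (fun σ z => f z σ) σ := ⟨_, fun _ => rfl⟩
      have := Runs.loop (r := Reg.cnt i) (p := .seq (.inc (.pos i)) (nest body is))
        (T := 1 + nestCost N T is.length) m
        (fun r => gridStore m (Function.update y i r) (g r))
        (by simp [gridStore, regs]) fun r hr => by
          refine ⟨m - (r + 1), ?_, ?_⟩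
          · simp only [gridStore, regs, Function.update_self]
            omega
          · have h₀ := runs_inc_pos (Function.update (fun l => m - y l) i (m - (r + 1)))
              (Function.update y i r) 0 (g r).1 (g r).2.1 i (g r).2.2
            rw [Function.update_idem, Function.update_self, ← update_sub] at h₀
            have h₁ := ih his.2 (y := Function.update y i (r + 1))
              (fun l hl => by
                have hne : l ≠ i := fun e => his.1 (e ▸ hl)
                rw [Function.update_of_ne hne, hy.2 l hl])
              (fun z hz => hbody z (List.mem_flatMap.2 ⟨r, List.mem_range.2 hr, hz⟩)) (g r)
            have hg' : g (r + 1) = (points m is (Function.update y i (r + 1))).foldl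
                (fun σ z => f z σ) (g r) := by
              rw [hg, hg, List.range_succ, List.flatMap_append, List.foldl_append,
                List.flatMap_singleton]
            simp only [gridStore, update_regs_cnt, update_sub, Function.update_idem]
            rw [← hg'] at h₁
            rw [update_sub] at h₀
            simp only [gridStore, update_sub] at h₁
            exact h₀.seq h₁
      beta_reduce at this
      rw [e, hg, hg] at this
      exact this
    have h₂ : ∀ σ : ℕ × ℕ × List α, Runs (.loop (.pos i) (.inc (.cnt i)))
        (gridStore m (Function.update y i m) σ) (gridStore m y σ) (m * (1 + 1) + 1) := fun σ => by
      have := Runs.loop (r := Reg.pos i) (p := (.inc (.cnt i) : Prog (Reg k) α)) (T := 1) m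
        (fun r => gridStore m (Function.update y i (m - r)) σ)
        (by simp [gridStore, regs]) fun r hr => by
          refine ⟨m - (r + 1), ?_, ?_⟩
          · simp only [gridStore, regs, Function.update_self]
            omega
          · simp only [gridStore, update_regs_pos, update_sub, Function.update_idem]
            have := runs_inc_cnt (Function.update (fun l => m - y l) i (m - (m - r)))
              (Function.update y i (m - (r + 1))) 0 σ.1 σ.2.1 i σ.2.2
            simp only [Function.update_idem, Function.update_self] at this
            rwa [show m - (m - r) + 1 = m - (m - (r + 1)) by omega] at this
      simpa only [Nat.sub_zero, Nat.sub_self, e] using this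
    -- With `c` the cost of the inner levels, both loops together take `m * (c + 4) + 2`.
    refine (h₁.seq (h₂ _)).weaken ?_
    rw [List.length_cons, nestCost]
    have := Nat.mul_le_mul_right (nestCost N T is.length + 4) hm
    nlinarith

theorem foldl_output {J α : Type} (f : J → List α) (l : List J) (s d : ℕ) (o : List α) :
    l.foldl (fun (σ : ℕ × ℕ × List α) z => (σ.1, σ.2.1, σ.2.2 ++ f z)) (s, d, o) =
      (s, d, o ++ l.flatMap f) := by
  induction l generalizing o with
  | nil => simp
  | cons a l ih => simp [ih]

/-- Write the output for one point, if there is still a unit in the last register. -/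
def guarded {J α : Type} (f : J → List α) (z : J) (σ : ℕ × ℕ × List α) : ℕ × ℕ × List α :=
  if σ.2.1 = 0 then σ else (σ.1 + 1, σ.2.1 - 1, σ.2.2 ++ f z)

/-- The last register is a budget: output is produced for the first `d` points only, and the first
register records the units spent. -/
theorem foldl_guarded {J α : Type} (f : J → List α) (l : List J) (s d : ℕ) (o : List α) :
    l.foldl (fun σ z => guarded f z σ) (s, d, o) =
      (s + min d l.length, d - l.length, o ++ (l.take d).flatMap f) := by
  induction l generalizing s d o with
  | nil => simp
  | cons a l ih =>
    rw [List.foldl_cons]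
    cases d with
    | zero => rw [guarded, if_pos rfl, ih]; simp
    | succ d =>
      rw [guarded, if_neg (by simp), ih]
      simp only [List.length_cons, Nat.add_sub_cancel, List.take_succ_cons, List.flatMap_cons,
        List.append_assoc, Prod.mk.injEq, and_true]
      omega

/-- Move one unit from the first register to the second one. -/
def transfer {α : Type} (σ : ℕ × ℕ × List α) : ℕ × ℕ × List α :=
  if σ.1 = 0 then σ else (σ.1 - 1, σ.2.1 + 1, σ.2.2)

theorem foldl_transfer {J α : Type} (l : List J) (s d : ℕ) (o : List α) :
    l.foldl (fun σ _ => transfer σ) (s, d, o) = (s - l.length, d + min s l.length, o) := by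
  induction l generalizing s d with
  | nil => simp
  | cons a l ih =>
    rw [List.foldl_cons]
    cases s with
    | zero => rw [transfer, if_pos rfl, ih]; simp
    | succ s =>
      rw [transfer, if_neg (by simp), ih]
      simp only [List.length_cons, Prod.mk.injEq, and_true]
      omega

/-! ### Writing grid points, operations and layers -/

section

variable {k : ℕ} {A B : Type}

/-- Write the integer `2 y_i + e`. -/
def emitCoord (i : Fin k) (e : ℕ) : Prog (Reg k) (Letter A B) :=
  .seq (.emit .plus)
    (.seq (.loop (.pos i) (.seq (.inc .tmp) (.seq (.emit .tick) (.emit .tick))))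
      (.seq (.loop .tmp (.inc (.pos i))) (Prog.seqs ((List.replicate e .tick).map .emit))))

/-- Reading a counter empties it, so its units are parked in `tmp` and moved back afterwards; each
contributes two ticks. Coordinates are never negative, so the sign is always `plus`. -/
theorem runs_emitCoord {N : ℕ} {a y : Fin k → ℕ} {i : Fin k} (hy : y i ≤ N) {e : ℕ} (he : e ≤ 2)
    (s d : ℕ) (o : List (Letter A B)) :
    Runs (emitCoord i e) ⟨regs a y 0 s d, o⟩
      ⟨regs a y 0 s d, o ++ encodeInt ((2 * y i + e : ℕ) : ℤ)⟩ (7 * N + 8) := by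
  have h₁ := Runs.loop (r := Reg.pos i)
    (p := (.seq (.inc .tmp) (.seq (.emit .tick) (.emit .tick)) : Prog (Reg k) (Letter A B)))
    (T := 1 + (1 + 1)) (y i)
    (fun r => ⟨regs a (Function.update y i (y i - r)) r s d,
      o ++ .plus :: List.replicate (2 * r) .tick⟩)
    (by simp [regs]) fun r hr => by
      refine ⟨y i - (r + 1), ?_, ?_⟩
      · simp only [regs, Function.update_self]
        omega
      · simp only [update_regs_pos, Function.update_idem]
        have := (runs_inc_tmp a (Function.update y i (y i - (r + 1))) r s d
          (o ++ .plus :: List.replicate (2 * r) Letter.tick)).seq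
            ((Runs.emit .tick _).seq (Runs.emit .tick _))
        simpa [Nat.mul_add, List.replicate_add] using this
  have h₂ := Runs.loop (r := Reg.tmp) (p := (.inc (.pos i) : Prog (Reg k) (Letter A B)))
    (T := 1) (y i)
    (fun r => ⟨regs a (Function.update y i r) (y i - r) s d,
      o ++ .plus :: List.replicate (2 * y i) .tick⟩)
    (by simp [regs]) fun r hr => by
      refine ⟨y i - (r + 1), ?_, ?_⟩
      · simp only [regs]
        omega
      · simp only [update_regs_tmp]
        have := runs_inc_pos a (Function.update y i r) (y i - (r + 1)) s d i
          (o ++ .plus :: List.replicate (2 * y i) Letter.tick)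
        simpa using this
  simp only [Nat.sub_self, Nat.sub_zero, Function.update_eq_self, Nat.mul_zero] at h₁ h₂
  have h₃ := (Runs.emit (R := Reg k) (Letter.plus : Letter A B) ⟨regs a y 0 s d, o⟩).seq
    (h₁.seq (h₂.seq (Runs.emits (List.replicate e .tick) _)))
  have e₁ : (o ++ Letter.plus :: List.replicate (2 * y i) .tick) ++ List.replicate e .tick =
      o ++ (encodeInt ((2 * y i + e : ℕ) : ℤ) : List (Letter A B)) := by
    rw [encodeInt, if_pos (by positivity), Int.natAbs_natCast, List.replicate_add,
      List.append_assoc, List.cons_append]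
  rw [e₁, List.length_replicate] at h₃
  exact h₃.weaken (by omega)

/-- Write the grid point `2 y + o e_j`. -/
def emitSite (j : Fin k) (o : ℕ) : Prog (Reg k) (Letter A B) :=
  Prog.seqs ((List.finRange k).map fun i => emitCoord i (if i = j then o else 0))

/-- A bound for the time to write a grid point. -/
def siteCost (k N : ℕ) : ℕ := k * (7 * N + 8) + 1

theorem runs_emitSite {N : ℕ} {a y : Fin k → ℕ} (hy : ∀ i, y i ≤ N) (j : Fin k) {o : ℕ}
    (ho : o ≤ 2) (s d : ℕ) (out : List (Letter A B)) :
    Runs (emitSite j o) ⟨regs a y 0 s d, out⟩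
      ⟨regs a y 0 s d, out ++ encodeSite (site y j o)⟩ (siteCost k N) := by
  have h := Runs.seqs_emit (T := 7 * N + 8)
    (fun i => (emitCoord i (if i = j then o else 0) : Prog (Reg k) (Letter A B)))
    (fun i => encodeInt (site y j o i)) (regs a y 0 s d) (List.finRange k)
    (fun i _ out => runs_emitCoord (hy i) (by split_ifs <;> omega) s d out) out
  rw [List.length_finRange] at h
  rw [encodeSite, List.ofFn_eq_map, ← List.flatMap_def]
  exact h

/-- Write an operation on the pair `2 y + o e_j`, `2 y + o' e_j`. -/
def emitOp (j : Fin k) (o o' : ℕ) : PairOp A B → Prog (Reg k) (Letter A B)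
  | .fst a => .seq (.emit (.one a)) (emitSite j o)
  | .snd a => .seq (.emit (.one a)) (emitSite j o')
  | .two b => .seq (.emit (.two b)) (.seq (emitSite j o) (emitSite j o'))
  | .swapped b => .seq (.emit (.two b)) (.seq (emitSite j o') (emitSite j o))

/-- A bound for the time to write an operation. -/
def opCost (k N : ℕ) : ℕ := 1 + (siteCost k N + siteCost k N)

theorem runs_emitOp {N : ℕ} {a y : Fin k → ℕ} (hy : ∀ i, y i ≤ N) (j : Fin k) {o o' : ℕ}
    (ho : o ≤ 2) (ho' : o' ≤ 2) (l : PairOp A B) (s d : ℕ) (out : List (Letter A B)) :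
    Runs (emitOp j o o' l) ⟨regs a y 0 s d, out⟩
      ⟨regs a y 0 s d, out ++ (l.instr (site y j o) (site y j o')).encode⟩ (opCost k N) := by
  have h : ∀ {o : ℕ}, o ≤ 2 → ∀ out : List (Letter A B), Runs (emitSite j o)
      ⟨regs a y 0 s d, out⟩ ⟨regs a y 0 s d, out ++ encodeSite (site y j o)⟩ (siteCost k N) :=
    fun ho out => runs_emitSite hy j ho s d out
  have hle : 1 + siteCost k N ≤ opCost k N := by unfold opCost; omega
  cases l with
  | fst c =>
    have := (Runs.emit (.one c) ⟨regs a y 0 s d, out⟩).seq (h ho _)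
    exact (by simpa [emitOp, PairOp.instr, Instr.encode] using this : Runs _ _ _ _).weaken hle
  | snd c =>
    have := (Runs.emit (.one c) ⟨regs a y 0 s d, out⟩).seq (h ho' _)
    exact (by simpa [emitOp, PairOp.instr, Instr.encode] using this : Runs _ _ _ _).weaken hle
  | two c =>
    have := (Runs.emit (.two c) ⟨regs a y 0 s d, out⟩).seq ((h ho _).seq (h ho' _))
    simpa [emitOp, opCost, PairOp.instr, Instr.encode] using this
  | swapped c =>
    have := (Runs.emit (.two c) ⟨regs a y 0 s d, out⟩).seq ((h ho' _).seq (h ho _))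
    simpa [emitOp, opCost, PairOp.instr, Instr.encode] using this

theorem points_le {m : ℕ} {is : List (Fin k)} (his : is.Nodup) {y z : Fin k → ℕ}
    (hy : ∀ i, y i ≤ m) (hz : z ∈ points m is y) (i : Fin k) : z i ≤ m := by
  rw [mem_points his] at hz
  by_cases hi : i ∈ is
  · exact (hz.2 i hi).2
  · rw [hz.1 i hi]
    exact hy i

/-- Write a layer that consists of one operation for each point. -/
def emitLayer (is : List (Fin k)) (j : Fin k) (o o' : ℕ) (l : PairOp A B) :
    Prog (Reg k) (Letter A B) :=
  .seq (.emit .layer) (nest (emitOp j o o' l) is)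

/-- A bound for the time to write a layer. -/
def layerCost (k N : ℕ) : ℕ := 1 + nestCost N (opCost k N) k

theorem runs_emitLayer {m N : ℕ} (hm : m ≤ N) {is : List (Fin k)} (his : is.Nodup)
    {y : Fin k → ℕ} (hy : ∀ i, y i ≤ m) (hy' : ∀ i ∈ is, y i = 0) (j : Fin k) {o o' : ℕ}
    (ho : o ≤ 2) (ho' : o' ≤ 2) (l : PairOp A B) (s d : ℕ) (out : List (Letter A B)) :
    Runs (emitLayer is j o o' l) (gridStore m y (s, d, out))
      (gridStore m y (s, d, out ++ .layer ::
        ((points m is y).map (sitePair j o o')).flatMap fun a => (l.instr a.1 a.2).encode))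
      (layerCost k N) := by
  have h := runs_nest (body := emitOp j o o' l) (T := opCost k N) hm
    (fun z σ => (σ.1, σ.2.1, σ.2.2 ++ (l.instr (site z j o) (site z j o')).encode)) his hy'
    (fun z hz σ => runs_emitOp (fun i => (points_le his hy hz i).trans hm) j ho ho' l σ.1 σ.2.1
      σ.2.2) (s, d, out ++ [.layer])
  rw [foldl_output] at h
  have h' := (Runs.emit (.layer : Letter A B) (gridStore m y (s, d, out))).seq h
  rw [List.flatMap_map]
  rw [List.append_assoc, List.singleton_append] at h'
  refine h'.weaken (Nat.add_le_add_left (nestCost_mono ?_) 1)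
  exact his.length_le_card.trans_eq (Fintype.card_fin k)

/-- Write the layers of a word. -/
def emitWord (is : List (Fin k)) (j : Fin k) (o o' : ℕ) (w : List (PairOp A B)) :
    Prog (Reg k) (Letter A B) :=
  Prog.seqs (w.map (emitLayer is j o o'))

/-- A bound for the time to write the layers of a word of length `L`. -/
def wordCost (k L N : ℕ) : ℕ := L * layerCost k N + 1

theorem encode_wordLayers (w : List (PairOp A B)) (ps : List (Site k × Site k)) :
    (wordLayers w ps).encode =
      w.flatMap fun l => .layer :: ps.flatMap fun a => (l.instr a.1 a.2).encode := by
  simp only [Circuit.encode, wordLayers, List.flatMap_map]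

theorem runs_emitWord {m N L : ℕ} (hm : m ≤ N) {is : List (Fin k)} (his : is.Nodup)
    {y : Fin k → ℕ} (hy : ∀ i, y i ≤ m) (hy' : ∀ i ∈ is, y i = 0) (j : Fin k) {o o' : ℕ}
    (ho : o ≤ 2) (ho' : o' ≤ 2) {w : List (PairOp A B)} (hw : w.length ≤ L) (s d : ℕ)
    (out : List (Letter A B)) :
    Runs (emitWord is j o o' w) (gridStore m y (s, d, out))
      (gridStore m y
        (s, d, out ++ (wordLayers w ((points m is y).map (sitePair j o o'))).encode))
      (wordCost k L N) := by
  rw [encode_wordLayers]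
  refine (Runs.seqs_emit (T := layerCost k N) (emitLayer is j o o') _ _ w
    (fun l _ out => runs_emitLayer hm his hy hy' j ho ho' l s d out) out).weaken ?_
  exact Nat.add_le_add_right (Nat.mul_le_mul_right _ hw) 1

variable {L : ℕ} (word : Gate × Bool → List (PairOp A B))

/-- The word that describes the circuit of a plan. -/
def Plan.encode (P : Plan k (Gate × Bool)) : List (Letter A B) := (P.circuit word).encode

theorem Plan.encode_append (P Q : Plan k (Gate × Bool)) :
    Plan.encode word (P ++ Q) = Plan.encode word P ++ Plan.encode word Q := by
  simp [Plan.encode, Plan.circuit, Circuit.encode]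

theorem Plan.encode_singleton (g : Gate × Bool) (ps : List (Site k × Site k)) :
    Plan.encode word [(g, ps)] = (wordLayers (word g) ps).encode := by
  simp [Plan.encode, Plan.circuit]

theorem Plan.inverse_flatMap {ι g : Type} (inv : g → g) (l : List ι) (P : ι → Plan k g) :
    Plan.inverse inv (l.flatMap P) = l.reverse.flatMap fun i => (P i).inverse inv := by
  simp only [Plan.inverse, List.reverse_flatMap, List.map_flatMap]
  rfl

/-- The gates of a timestep, with the offsets of the pairs on which they act. -/
def mergeGates : List ((Gate × Bool) × ℕ × ℕ) :=
  [((.prepare, false), 2, 1), ((.mark, false), 0, 1), ((.merge, false), 2, 1)]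

/-- The gates of an inverted timestep. -/
def unmergeGates : List ((Gate × Bool) × ℕ × ℕ) :=
  [((.merge, true), 2, 1), ((.mark, true), 0, 1), ((.prepare, true), 2, 1)]

/-- The plan that performs the given gates at all sources. -/
def stepPlan (m : ℕ) (gs : List ((Gate × Bool) × ℕ × ℕ)) (j : Fin k) (r : ℕ) :
    Plan k (Gate × Bool) :=
  gs.map fun g => (g.1, (sources m j r).map (sitePair j g.2.1 g.2.2))

theorem stepPlan_mergeGates (m : ℕ) (j : Fin k) (r : ℕ) :
    stepPlan m mergeGates j r = mergeStep m j r := rfl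

theorem stepPlan_unmergeGates (m : ℕ) (j : Fin k) (r : ℕ) :
    stepPlan m unmergeGates j r = (mergeStep m j r).inverse invertGate := rfl

/-- Write the gates of a timestep. -/
def emitStep (gs : List ((Gate × Bool) × ℕ × ℕ)) (j : Fin k) : Prog (Reg k) (Letter A B) :=
  Prog.seqs (gs.map fun g => emitWord (later j) j g.2.1 g.2.2 (word g.1))

/-- A bound for the time to write a timestep. -/
def stepCost (k L N : ℕ) : ℕ := 3 * wordCost k L N + 1

theorem runs_emitStep {m N r : ℕ} (hm : m ≤ N) (hr : r ≤ m)
    (hw : ∀ g, (word g).length ≤ L) {gs : List ((Gate × Bool) × ℕ × ℕ)}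
    (hgs : ∀ g ∈ gs, g.2.1 ≤ 2 ∧ g.2.2 ≤ 2) (hlen : gs.length ≤ 3) (j : Fin k) (s d : ℕ)
    (out : List (Letter A B)) :
    Runs (emitStep word gs j) (gridStore m (Function.update (prefixPoint m j) j r) (s, d, out))
      (gridStore m (Function.update (prefixPoint m j) j r)
        (s, d, out ++ Plan.encode word (stepPlan m gs j r))) (stepCost k L N) := by
  have hy : ∀ i, Function.update (prefixPoint m j) j r i ≤ m := fun i => by
    by_cases h : i = j
    · subst h
      rwa [Function.update_self]
    · rw [Function.update_of_ne h, prefixPoint]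
      split_ifs <;> simp
  have hy' : ∀ i ∈ later j, Function.update (prefixPoint m j) j r i = 0 := fun i hi => by
    rw [mem_later] at hi
    rw [Function.update_of_ne hi.ne', prefixPoint, if_neg (not_lt.2 (Fin.le_def.1 hi.le))]
  have h := Runs.seqs_emit (T := wordCost k L N)
    (fun g : (Gate × Bool) × ℕ × ℕ => emitWord (later j) j g.2.1 g.2.2 (word g.1))
    (fun g => (wordLayers (word g.1) ((sources m j r).map (sitePair j g.2.1 g.2.2))).encode)
    (gridStore m (Function.update (prefixPoint m j) j r) (s, d, out)).reg gs
    (fun g hg out => runs_emitWord hm (nodup_later j) hy hy' j (hgs g hg).1 (hgs g hg).2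
      (hw g.1) s d out) out
  have e : Plan.encode word (stepPlan m gs j r) = gs.flatMap fun g =>
      (wordLayers (word g.1) ((sources m j r).map (sitePair j g.2.1 g.2.2))).encode := by
    simp [Plan.encode, Plan.circuit, Circuit.encode, stepPlan, List.flatMap_map,
      List.flatMap_assoc]
  rw [e]
  exact h.weaken (Nat.add_le_add_right (Nat.mul_le_mul_right _ hlen) 1)

/-- Write the timesteps in direction `j`. -/
def emitMerge (j : Fin k) : Prog (Reg k) (Letter A B) :=
  .loop (.cnt j) (.seq (.inc (.cnt j)) (.seq (emitStep word mergeGates j)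
    (.cond (.cnt j) (.inc (.pos j)))))

/-- Write the inverted timesteps in direction `j`. -/
def emitUnmerge (j : Fin k) : Prog (Reg k) (Letter A B) :=
  .loop (.pos j) (.seq (.inc (.cnt j)) (emitStep word unmergeGates j))

/-- A bound for the time to write all timesteps in one direction. -/
def mergeCost (k L N : ℕ) : ℕ := N * (1 + (stepCost k L N + 2) + 1) + 1

theorem update_prefixPoint_zero (m : ℕ) (j : Fin k) :
    Function.update (prefixPoint m j) j 0 = prefixPoint m j := by
  rw [Function.update_eq_self_iff, prefixPoint, if_neg (lt_irrefl _)]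

theorem update_prefixPoint_self (m : ℕ) (j : Fin k) :
    Function.update (prefixPoint m j) j m = prefixPoint m (j + 1) := by
  funext i
  by_cases h : i = j
  · subst h
    rw [Function.update_self, prefixPoint, if_pos (Nat.lt_succ_self _)]
  · rw [Function.update_of_ne h, prefixPoint, prefixPoint]
    have : (i : ℕ) ≠ j := fun e => h (Fin.ext e)
    congr 1
    simp only [eq_iff_iff]
    omega

/-- The test of the loop takes a unit from `cnt j`, which is returned at once so that the timestep
is written with the counters in balance; `cond` then serves as a decrement when the unit passes to
`pos j`. Coordinate `j` is left at `m`. -/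
theorem runs_emitMerge {m N : ℕ} (hm : m ≤ N) (hw : ∀ g, (word g).length ≤ L) (j : Fin k)
    (s d : ℕ) (out : List (Letter A B)) :
    Runs (emitMerge word j) (gridStore m (prefixPoint m j) (s, d, out))
      (gridStore m (prefixPoint m (j + 1)) (s, d, out ++ Plan.encode word
        ((List.range m).flatMap fun r => mergeStep m j r))) (mergeCost k L N) := by
  have h := Runs.loop (r := Reg.cnt j)
    (p := .seq (.inc (.cnt j)) (.seq (emitStep word mergeGates j)
      (.cond (.cnt j) (.inc (.pos j))))) (T := 1 + (stepCost k L N + 2)) m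
    (fun r => gridStore m (Function.update (prefixPoint m j) j r) (s, d, out ++ Plan.encode word
        ((List.range r).flatMap fun r => mergeStep m j r)))
    (by simp [gridStore, regs]) fun r hr => by
      refine ⟨m - (r + 1), by simp only [gridStore, regs, Function.update_self]; omega, ?_⟩
      set out' := out ++ Plan.encode word ((List.range r).flatMap fun r => mergeStep m j r)
        with hout
      have h₁ := runs_inc_cnt (Function.update (fun l => m - prefixPoint m j l) j (m - (r + 1)))
        (Function.update (prefixPoint m j) j r) 0 s d j out'
      rw [Function.update_idem, Function.update_self,
        show m - (r + 1) + 1 = m - r by omega, ← update_sub] at h₁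
      have h₂ := runs_emitStep word hm hr.le hw (gs := mergeGates) (by decide) le_rfl j s d out'
      have h₃ : Runs (.cond (.cnt j) (.inc (.pos j)))
          (gridStore m (Function.update (prefixPoint m j) j r)
            (s, d, out' ++ Plan.encode word (stepPlan m mergeGates j r)))
          (gridStore m (Function.update (prefixPoint m j) j (r + 1))
            (s, d, out' ++ Plan.encode word (stepPlan m mergeGates j r))) (1 + 1) := by
        refine Runs.cond_succ (v := m - (r + 1)) ?_ ?_
        · simp only [gridStore, regs, Function.update_self]
          omega
        · simp only [gridStore, update_regs_cnt, update_sub, Function.update_idem]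
          have := runs_inc_pos (Function.update (fun l => m - prefixPoint m j l) j (m - (r + 1)))
            (Function.update (prefixPoint m j) j r) 0 s d j
            (out' ++ Plan.encode word (stepPlan m mergeGates j r))
          rwa [Function.update_idem, Function.update_self] at this
      have e : out ++ Plan.encode word ((List.range (r + 1)).flatMap fun r => mergeStep m j r) =
          out' ++ Plan.encode word (stepPlan m mergeGates j r) := by
        rw [List.range_succ, List.flatMap_append, Plan.encode_append, List.flatMap_singleton,
          hout, List.append_assoc, stepPlan_mergeGates]
      rw [e]
      refine Runs.seq ?_ (h₂.seq h₃)
      simp only [gridStore, update_regs_cnt, update_sub, Function.update_idem] at h₁ ⊢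
      exact h₁
  beta_reduce at h
  rw [update_prefixPoint_zero, update_prefixPoint_self] at h
  have e : out ++ Plan.encode word ((List.range 0).flatMap fun r => mergeStep m j r) = out := by
    simp [Plan.encode, Plan.circuit, Circuit.encode]
  rw [e] at h
  exact h.weaken (Nat.add_le_add_right (Nat.mul_le_mul_right _ hm) 1)

/-- Here the test itself decreases `pos j` before the timestep is written, so the timesteps appear
for `m - 1` down to `0`, in the order of the inverse. -/
theorem runs_emitUnmerge {m N : ℕ} (hm : m ≤ N) (hw : ∀ g, (word g).length ≤ L) (j : Fin k)
    (s d : ℕ) (out : List (Letter A B)) :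
    Runs (emitUnmerge word j) (gridStore m (prefixPoint m (j + 1)) (s, d, out))
      (gridStore m (prefixPoint m j) (s, d, out ++ Plan.encode word
        (Plan.inverse invertGate ((List.range m).flatMap fun r => mergeStep m j r))))
      (mergeCost k L N) := by
  have hinv : Plan.inverse invertGate ((List.range m).flatMap fun r => mergeStep m j r) =
      (List.range m).flatMap fun r => stepPlan m unmergeGates j (m - 1 - r) := by
    rw [Plan.inverse_flatMap, List.range_eq_range', List.reverse_range', List.flatMap_map,
      ← List.range_eq_range']
    simp only [zero_add, stepPlan_unmergeGates]
  rw [hinv]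
  have h := Runs.loop (r := Reg.pos j)
    (p := .seq (.inc (.cnt j)) (emitStep word unmergeGates j)) (T := 1 + stepCost k L N) m
    (fun r => gridStore m (Function.update (prefixPoint m j) j (m - r))
      (s, d, out ++ Plan.encode word
        ((List.range r).flatMap fun r => stepPlan m unmergeGates j (m - 1 - r))))
    (by simp [gridStore, regs]) fun r hr => by
      refine ⟨m - (r + 1), by simp only [gridStore, regs, Function.update_self]; omega, ?_⟩
      set out' := out ++ Plan.encode word
        ((List.range r).flatMap fun r => stepPlan m unmergeGates j (m - 1 - r)) with hout
      have h₁ := runs_inc_cnt (Function.update (fun l => m - prefixPoint m j l) j (m - (m - r)))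
        (Function.update (prefixPoint m j) j (m - (r + 1))) 0 s d j out'
      rw [Function.update_idem, Function.update_self,
        show m - (m - r) + 1 = m - (m - (r + 1)) by omega, ← update_sub] at h₁
      have h₂ := runs_emitStep word hm (Nat.sub_le m (r + 1)) hw (gs := unmergeGates) (by decide)
        le_rfl j s d out'
      have e : out ++ Plan.encode word
          ((List.range (r + 1)).flatMap fun r => stepPlan m unmergeGates j (m - 1 - r)) =
          out' ++ Plan.encode word (stepPlan m unmergeGates j (m - (r + 1))) := by
        rw [List.range_succ, List.flatMap_append, Plan.encode_append, List.flatMap_singleton,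
          hout, List.append_assoc, show m - 1 - r = m - (r + 1) by omega]
      rw [e]
      refine Runs.seq ?_ h₂
      simp only [gridStore, update_regs_pos, update_sub, Function.update_idem] at h₁ ⊢
      exact h₁
  beta_reduce at h
  rw [Nat.sub_self, Nat.sub_zero, update_prefixPoint_zero, update_prefixPoint_self] at h
  have e : out ++ Plan.encode word
      ((List.range 0).flatMap fun r => stepPlan m unmergeGates j (m - 1 - r)) = out := by
    simp [Plan.encode, Plan.circuit, Circuit.encode]
  rw [e] at h
  refine h.weaken (Nat.add_le_add_right ?_ 1)
  exact Nat.mul_le_mul hm (by omega)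

end

/-! ### The side length of the cube -/

/-- The least `m` with `n ≤ m ^ k`. -/
def rootCeil (k n : ℕ) : ℕ := sInf {m | n ≤ m ^ k}

theorem le_rootCeil_pow {k : ℕ} (hk : k ≠ 0) (n : ℕ) : n ≤ rootCeil k n ^ k :=
  Nat.sInf_mem (s := {m | n ≤ m ^ k}) ⟨n, Nat.le_self_pow hk n⟩

theorem pow_lt_of_lt_rootCeil {k n m : ℕ} (h : m < rootCeil k n) : m ^ k < n :=
  not_le.1 (Nat.notMem_of_lt_sInf (s := {m | n ≤ m ^ k}) h)

theorem rootCeil_le {k : ℕ} (hk : k ≠ 0) (n : ℕ) : rootCeil k n ≤ n :=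
  Nat.sInf_le (Nat.le_self_pow hk n)

theorem prefixPoint_zero {k : ℕ} (m : ℕ) : (prefixPoint m 0 : Fin k → ℕ) = 0 := by
  funext i
  simp [prefixPoint]

section

variable {k : ℕ}

/-- Move everything from the last register to the one before. -/
theorem runs_dst_to_src {α : Type} {N s d : ℕ} (hd : d ≤ N) (a y : Fin k → ℕ) (out : List α) :
    Runs (.loop .dst (.inc .src)) ⟨regs a y 0 s d, out⟩ ⟨regs a y 0 (s + d) 0, out⟩
      (N * 2 + 1) := by
  have h := Runs.loop (r := Reg.dst) (p := (.inc .src : Prog (Reg k) α)) (T := 1) d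
    (fun r => ⟨regs a y 0 (s + r) (d - r), out⟩) (by simp [regs]) fun r hr => by
      refine ⟨d - (r + 1), by simp only [regs]; omega, ?_⟩
      simp only [update_regs_dst]
      exact runs_inc_src a y 0 (s + r) (d - (r + 1)) out
  simp only [Nat.sub_self, Nat.sub_zero, Nat.add_zero] at h
  exact h.weaken (by omega)

theorem runs_src_to_dst {α : Type} {N s d : ℕ} (hs : s ≤ N) (a y : Fin k → ℕ) (out : List α) :
    Runs (.loop .src (.inc .dst)) ⟨regs a y 0 s d, out⟩ ⟨regs a y 0 0 (d + s), out⟩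
      (N * 2 + 1) := by
  have h := Runs.loop (r := Reg.src) (p := (.inc .dst : Prog (Reg k) α)) (T := 1) s
    (fun r => ⟨regs a y 0 (s - r) (d + r), out⟩) (by simp [regs]) fun r hr => by
      refine ⟨s - (r + 1), by simp only [regs]; omega, ?_⟩
      simp only [update_regs_src]
      exact runs_inc_dst a y 0 (s - (r + 1)) (d + r) out
  simp only [Nat.sub_self, Nat.sub_zero, Nat.add_zero] at h
  exact h.weaken (by omega)

/-- Increase the side length, then try to move the units of `src` to the points of the cube. -/
def searchStep (k : ℕ) (α : Type) : Prog (Reg k) α :=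
  .seq (.inc .src) (.seq (.loop .dst (.inc .src))
    (.seq (Prog.seqs (List.ofFn fun i => .inc (.cnt i)))
      (nest (.cond .src (.inc .dst)) (List.finRange k))))

/-- A bound for the time of the search for the side length. -/
def searchCost (k N : ℕ) : ℕ :=
  N * (1 + ((N * 2 + 1) + ((k * 1 + 1) + nestCost N 2 k)) + 1) + 1

/-- Before each test, with side length `m`, the `n` units are split into `min n (m ^ k)` in `dst`
and the rest in `src`. The rest vanishes first at `m = rootCeil k n`. The nested loops count the
points of the cube, so no power has to be computed. -/
theorem runs_search (hk : k ≠ 0) {α : Type} (n : ℕ) (out : List α) :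
    Runs (.loop .src (searchStep k α)) ⟨Function.update 0 .src n, out⟩
      (gridStore (rootCeil k n) (prefixPoint (rootCeil k n) 0) (0, n, out)) (searchCost k n) := by
  have h := Runs.loop (r := Reg.src) (p := searchStep k α)
    (T := 1 + ((n * 2 + 1) + ((k * 1 + 1) + nestCost n 2 k))) (rootCeil k n)
    (fun m => gridStore m 0 (n - m ^ k, min n (m ^ k), out))
    (by simpa [gridStore, regs, Nat.sub_eq_zero_iff_le] using le_rootCeil_pow hk n) fun m hm => by
      have hlt := pow_lt_of_lt_rootCeil hm
      refine ⟨n - m ^ k - 1, by simp only [gridStore, regs]; omega, ?_⟩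
      simp only [gridStore, update_regs_src]
      -- The unit taken by the test is returned, and then all `n` units are gathered in `src` for a
      -- new attempt with side length `m + 1`.
      have h₁ := runs_inc_src (fun i : Fin k => m - (0 : Fin k → ℕ) i) 0 0 (n - m ^ k - 1)
        (min n (m ^ k)) out
      have h₂ := runs_dst_to_src (s := n - m ^ k - 1 + 1) (d := min n (m ^ k)) (min_le_left _ _)
        (fun i : Fin k => m - (0 : Fin k → ℕ) i) 0 out
      rw [show n - m ^ k - 1 + 1 + min n (m ^ k) = n by omega] at h₂
      -- After `c` of the increments, the first `c` counters are already `m + 1`.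
      have h₃ := Runs.seqs_ofFn (p := fun i : Fin k => (.inc (.cnt i) : Prog (Reg k) α)) (T := 1)
        (fun c => ⟨regs (fun i : Fin k => if i.val < c then m + 1 else m) 0 0 n 0, out⟩)
        fun i => by
          have := runs_inc_cnt (fun l : Fin k => if l.val < i.val then m + 1 else m) 0 0 n 0 i out
          rw [if_neg (lt_irrefl _)] at this
          convert this using 3
          funext l
          by_cases hl : l = i
          · subst hl
            simp
          · have : (l : ℕ) ≠ i := fun e => hl (Fin.ext e)
            rw [Function.update_of_ne hl]
            congr 1
            simp only [eq_iff_iff]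
            omega
      have h₄ := runs_nest (α := α) (body := .cond .src (.inc .dst)) (m := m + 1) (N := n) (T := 2)
        (lt_of_lt_of_le hm (rootCeil_le hk n)) (fun _ σ => transfer σ) (List.nodup_finRange k)
        (y := 0) (fun _ _ => rfl) (fun z _ σ => by
          obtain ⟨s, d, o⟩ := σ
          unfold transfer
          cases s with
          | zero => exact (Runs.cond_zero rfl).weaken one_le_two
          | succ s =>
            refine Runs.cond_succ (t := 1) (v := s) rfl ?_
            simp only [gridStore, update_regs_src]
            exact runs_inc_dst _ z 0 s d o) (n, 0, out)
      rw [foldl_transfer, length_points, List.length_finRange, Nat.zero_add] at h₄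
      simp only [Nat.not_lt_zero, if_false, Fin.is_lt, if_true] at h₃
      exact h₁.seq (h₂.seq (h₃.seq h₄))
  -- The input is the initial state with side length `0`; this uses `0 ^ k = 0`.
  have e : (⟨Function.update 0 .src n, out⟩ : Store (Reg k) α) =
      gridStore 0 0 (n - 0 ^ k, min n (0 ^ k), out) := by
    have : (0 : Reg k → ℕ) = regs 0 0 0 0 0 := by
      funext r
      cases r <;> rfl
    rw [this, update_regs_src, zero_pow hk]
    simp [gridStore]
    rfl
  rw [e]
  beta_reduce at h
  have hle := le_rootCeil_pow hk n
  rw [Nat.sub_eq_zero_of_le hle, min_eq_left hle] at h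
  rw [prefixPoint_zero]
  exact h.weaken (Nat.add_le_add_right (Nat.mul_le_mul_right _ (rootCeil_le hk n)) 1)

variable {A B : Type}

/-- Write a layer of operations that flip the controls. -/
def emitFlipLayer (j₀ : Fin k) (l : PairOp A B) : Prog (Reg k) (Letter A B) :=
  .seq (.emit .layer) (.seq (nest (.cond .dst (.seq (.inc .src) (emitOp j₀ 1 0 l)))
    (List.finRange k)) (.loop .src (.inc .dst)))

/-- A bound for the time to write a layer of operations that flip the controls. -/
def flipLayerCost (k N : ℕ) : ℕ := 1 + (nestCost N (1 + opCost k N + 1) k + (N * 2 + 1))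

/-- `dst` limits the output to the first `n` cells. The units spent are collected in `src` and
returned, so that `n` is available again for the next layer. -/
theorem runs_emitFlipLayer {m n N : ℕ} (hm : m ≤ N) (hn : n ≤ N) (hmn : n ≤ m ^ k) (j₀ : Fin k)
    (l : PairOp A B) (out : List (Letter A B)) :
    Runs (emitFlipLayer j₀ l) (gridStore m (prefixPoint m 0) (0, n, out))
      (gridStore m (prefixPoint m 0) (0, n, out ++ .layer ::
        (((cells k m).take n).map (sitePair j₀ 1 0)).flatMap fun a => (l.instr a.1 a.2).encode))
      (flipLayerCost k N) := by
  have h := runs_nest (body := .cond .dst (.seq (.inc .src) (emitOp j₀ 1 0 l)))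
    (T := 1 + opCost k N + 1) hm
    (guarded fun z => (l.instr (site z j₀ 1) (site z j₀ 0)).encode) (List.nodup_finRange k)
    (y := prefixPoint m 0) (fun i _ => by simp [prefixPoint])
    (fun z hz σ => by
      obtain ⟨s, d, o⟩ := σ
      unfold guarded
      have hz' := mem_cells.1 hz
      cases d with
      | zero => exact (Runs.cond_zero rfl).weaken (by omega)
      | succ d =>
        refine Runs.cond_succ (v := d) rfl ?_
        simp only [gridStore, update_regs_dst]
        exact (runs_inc_src _ z 0 s d o).seq (runs_emitOp (fun i => (hz' i).2.trans hm) j₀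
          one_le_two zero_le_two l (s + 1) d o)) (0, n, out ++ [.layer])
  have hlen : (points m (List.finRange k) (prefixPoint m 0)).length = m ^ k := length_cells k m
  rw [foldl_guarded, hlen, List.length_finRange, min_eq_left hmn, Nat.sub_eq_zero_of_le hmn,
    Nat.zero_add] at h
  have h' := (Runs.emit (.layer : Letter A B) (gridStore m (prefixPoint m 0) (0, n, out))).seq
    (h.seq (runs_src_to_dst hn _ _ _))
  rw [List.append_assoc, List.singleton_append, Nat.zero_add] at h'
  rw [List.flatMap_map]
  exact h'

/-- Write the layers of a word that flips the controls. -/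
def emitFlip (j₀ : Fin k) (w : List (PairOp A B)) : Prog (Reg k) (Letter A B) :=
  Prog.seqs (w.map (emitFlipLayer j₀))

theorem runs_emitFlip {m n N L : ℕ} (hm : m ≤ N) (hn : n ≤ N) (hmn : n ≤ m ^ k) (j₀ : Fin k)
    {w : List (PairOp A B)} (hw : w.length ≤ L) (out : List (Letter A B)) :
    Runs (emitFlip j₀ w) (gridStore m (prefixPoint m 0) (0, n, out))
      (gridStore m (prefixPoint m 0) (0, n, out ++
        (wordLayers w (((cells k m).take n).map (sitePair j₀ 1 0))).encode))
      (L * flipLayerCost k N + 1) := by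
  rw [encode_wordLayers]
  refine (Runs.seqs_emit (T := flipLayerCost k N) (emitFlipLayer j₀) _ _ w
    (fun l _ out => runs_emitFlipLayer hm hn hmn j₀ l out) out).weaken ?_
  exact Nat.add_le_add_right (Nat.mul_le_mul_right _ hw) 1

variable {L : ℕ} (word : Gate × Bool → List (PairOp A B))

/-- Nothing is reset between directions: a finished direction leaves its coordinate at `m`, which is
where the sources of the later directions lie. -/
theorem runs_emitMergeAll {m N : ℕ} (hm : m ≤ N) (hw : ∀ g, (word g).length ≤ L) (s d : ℕ)
    (out : List (Letter A B)) :
    Runs (Prog.seqs (List.ofFn (emitMerge (k := k) word))) (gridStore m (prefixPoint m 0) (s, d, out))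
      (gridStore m (prefixPoint m k) (s, d, out ++ Plan.encode word (mergeAll k m)))
      (k * mergeCost k L N + 1) := by
  have h := Runs.seqs_ofFn (p := emitMerge (k := k) word) (T := mergeCost k L N)
    (fun c => gridStore m (prefixPoint m c) (s, d, out ++ Plan.encode word
      (((List.finRange k).take c).flatMap fun j => (List.range m).flatMap fun r =>
        mergeStep m j r))) fun i => by
      have := runs_emitMerge word hm hw i s d (out ++ Plan.encode word
        (((List.finRange k).take i).flatMap fun j => (List.range m).flatMap fun r =>
          mergeStep m j r))
      have hi : (i : ℕ) < (List.finRange k).length := by simp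
      rw [List.append_assoc, ← Plan.encode_append] at this
      rw [List.take_succ_eq_append_getElem hi, List.flatMap_append, List.flatMap_singleton,
        List.getElem_finRange]
      exact this
  beta_reduce at h
  rw [List.take_zero, List.take_of_length_le (by simp)] at h
  have e : out ++ Plan.encode word (([] : List (Fin k)).flatMap fun j =>
      (List.range m).flatMap fun r => mergeStep m j r) = out := by
    simp [Plan.encode, Plan.circuit, Circuit.encode]
  rw [e] at h
  exact h

/-- The directions are undone from the last to the first, which returns the coordinates from `m` to
`0` one after the other. -/
theorem runs_emitUnmergeAll {m N : ℕ} (hm : m ≤ N) (hw : ∀ g, (word g).length ≤ L) (s d : ℕ)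
    (out : List (Letter A B)) :
    Runs (Prog.seqs (List.ofFn fun i : Fin k => emitUnmerge word i.rev))
      (gridStore m (prefixPoint m k) (s, d, out))
      (gridStore m (prefixPoint m 0) (s, d, out ++ Plan.encode word
        ((mergeAll k m).inverse invertGate))) (k * mergeCost k L N + 1) := by
  have hinv : (mergeAll k m).inverse invertGate = (List.finRange k).flatMap fun i =>
      Plan.inverse invertGate ((List.range m).flatMap fun r => mergeStep m i.rev r) := by
    rw [mergeAll, Plan.inverse_flatMap, List.finRange_reverse, List.flatMap_map]
  have h := Runs.seqs_ofFn (p := fun i : Fin k => emitUnmerge word i.rev) (T := mergeCost k L N)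
    (fun c => gridStore m (prefixPoint m (k - c)) (s, d, out ++ Plan.encode word
      (((List.finRange k).take c).flatMap fun i => Plan.inverse invertGate
        ((List.range m).flatMap fun r => mergeStep m i.rev r)))) fun i => by
      have := runs_emitUnmerge word hm hw i.rev s d (out ++ Plan.encode word
        (((List.finRange k).take i).flatMap fun i => Plan.inverse invertGate
          ((List.range m).flatMap fun r => mergeStep m i.rev r)))
      have hi : (i : ℕ) < (List.finRange k).length := by simp
      rw [List.append_assoc, ← Plan.encode_append] at this
      rw [List.take_succ_eq_append_getElem hi, List.flatMap_append, List.flatMap_singleton,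
        List.getElem_finRange]
      have e : (i.rev : ℕ) + 1 = k - i := by
        rw [Fin.val_rev]
        omega
      rw [e, Fin.val_rev] at this
      exact this
  beta_reduce at h
  rw [List.take_zero, List.take_of_length_le (by simp), Nat.sub_self, Nat.sub_zero] at h
  have e : out ++ Plan.encode word (([] : List (Fin k)).flatMap fun i =>
      Plan.inverse invertGate ((List.range m).flatMap fun r => mergeStep m i.rev r)) = out := by
    simp [Plan.encode, Plan.circuit, Circuit.encode]
  rw [e] at h
  rw [hinv]
  exact h

/-- Clear the registers. -/
def cleanUp (k : ℕ) (α : Type) : Prog (Reg k) α :=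
  .seq (.loop .dst .skip) (Prog.seqs (List.ofFn fun i => .loop (.cnt i) .skip))

/-- A bound for the time to clear the registers. -/
def cleanUpCost (k N : ℕ) : ℕ := (N * 2 + 1) + (k * (N * 2 + 1) + 1)

theorem runs_cleanUp {α : Type} {m n N : ℕ} (hm : m ≤ N) (hn : n ≤ N) (out : List α) :
    Runs (cleanUp k α) (gridStore m (prefixPoint m 0) (0, n, out)) ⟨0, out⟩ (cleanUpCost k N) := by
  have h₁ := Runs.loop (r := Reg.dst) (p := (.skip : Prog (Reg k) α)) (T := 1) n
    (fun r => gridStore m (prefixPoint m 0) (0, n - r, out)) (by simp [gridStore, regs])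
    fun r hr => by
      refine ⟨n - (r + 1), by simp only [gridStore, regs]; omega, ?_⟩
      simp only [gridStore, update_regs_dst]
      exact Runs.skip _
  have h₂ := Runs.seqs_ofFn (p := fun i : Fin k => (.loop (.cnt i) .skip : Prog (Reg k) α))
    (T := m * (1 + 1) + 1)
    (fun c => ⟨regs (fun i : Fin k => if i.val < c then 0 else m) 0 0 0 0, out⟩) fun i => by
      have := Runs.loop (r := Reg.cnt i) (p := (.skip : Prog (Reg k) α)) (T := 1) m
        (fun r => ⟨regs (Function.update (fun l : Fin k => if l.val < i.val then 0 else m) i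
          (m - r)) 0 0 0 0, out⟩) (by simp [regs])
        fun r hr => by
          refine ⟨m - (r + 1), by simp only [regs, Function.update_self]; omega, ?_⟩
          simp only [update_regs_cnt, Function.update_idem]
          exact Runs.skip _
      beta_reduce at this
      convert this using 3
      · rw [Nat.sub_zero]
        refine (Function.update_eq_self_iff.2 ?_).symm
        rw [if_neg (lt_irrefl _)]
      · funext l
        by_cases hl : l = i
        · subst hl
          simp
        · have : (l : ℕ) ≠ i := fun e => hl (Fin.ext e)
          rw [Function.update_of_ne hl]
          congr 1
          simp only [eq_iff_iff]
          omega
  have e₁ : gridStore m (prefixPoint m 0) (0, n - n, out) =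
      ⟨regs (fun i : Fin k => if i.val < 0 then 0 else m) 0 0 0 0, out⟩ := by
    rw [prefixPoint_zero]
    simp [gridStore]
  have e₂ : (⟨regs (fun i : Fin k => if i.val < k then 0 else m) 0 0 0 0, out⟩ :
      Store (Reg k) α) = ⟨0, out⟩ := by
    simp only [Fin.is_lt, if_true]
    congr 1
    funext r
    cases r <;> rfl
  beta_reduce at h₁ h₂
  rw [e₁] at h₁
  rw [e₂] at h₂
  refine (h₁.seq h₂).weaken ?_
  unfold cleanUpCost
  have := Nat.mul_le_mul_left k (Nat.mul_le_mul_right 2 hm)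
  nlinarith

/-- The program that writes the circuit for the controlled operation. -/
def mainProg (j₀ : Fin k) : Prog (Reg k) (Letter A B) :=
  .seq (.loop .src (searchStep k (Letter A B)))
    (.seq (emitFlip j₀ (word (.flip, false)))
    (.seq (Prog.seqs (List.ofFn (emitMerge word)))
    (.seq (emitWord [] j₀ 0 1 (word (.control, false)))
    (.seq (Prog.seqs (List.ofFn fun i : Fin k => emitUnmerge word i.rev))
    (.seq (emitFlip j₀ (word (.flip, true))) (cleanUp k (Letter A B)))))))

/-- A bound for the running time of the program. -/
def mainCost (k L N : ℕ) : ℕ :=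
  searchCost k N + ((L * flipLayerCost k N + 1) + ((k * mergeCost k L N + 1) +
    (wordCost k L N + ((k * mergeCost k L N + 1) + ((L * flipLayerCost k N + 1) +
      cleanUpCost k N)))))

theorem runs_mainProg (hw : ∀ g, (word g).length ≤ L) (j₀ : Fin k) (n : ℕ) :
    Runs (mainProg word j₀) ⟨Function.update 0 .src n, []⟩
      ⟨0, Plan.encode word (mainPlan k (rootCeil k n) n j₀)⟩ (mainCost k L n) := by
  have hk : k ≠ 0 := fun e => by subst e; exact j₀.elim0
  have hm := rootCeil_le hk n
  have hmn := le_rootCeil_pow hk n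
  set m := rootCeil k n with hmdef
  have h := (runs_search hk n ([] : List (Letter A B))).seq
    ((runs_emitFlip hm le_rfl hmn j₀ (hw (.flip, false)) _).seq
    ((runs_emitMergeAll word hm hw 0 n _).seq
    -- With no coordinate to vary, the layer consists of one operation, at the corner reached by the
    -- merging loops.
    ((runs_emitWord hm List.nodup_nil (y := prefixPoint m k)
      (fun i => by simp [prefixPoint]) (fun i hi => by simp at hi) j₀ zero_le_two one_le_two
      (hw (.control, false)) 0 n _).seq
    ((runs_emitUnmergeAll word hm hw 0 n _).seq
    ((runs_emitFlip hm le_rfl hmn j₀ (hw (.flip, true)) _).seq (runs_cleanUp hm le_rfl _))))))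
  have e : Plan.encode word (mainPlan k m n j₀) =
      ((((([] ++ (wordLayers (word (.flip, false))
        (((cells k m).take n).map (sitePair j₀ 1 0))).encode) ++
        Plan.encode word (mergeAll k m)) ++ (wordLayers (word (.control, false))
          ((points m [] (prefixPoint m k)).map (sitePair j₀ 0 1))).encode) ++
        Plan.encode word ((mergeAll k m).inverse invertGate)) ++
        (wordLayers (word (.flip, true)) (((cells k m).take n).map (sitePair j₀ 1 0))).encode) := by
    have e₁ : preparation k m n j₀ =
        [((.flip, false), ((cells k m).take n).map (sitePair j₀ 1 0))] ++ mergeAll k m := rfl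
    have e₂ : (preparation k m n j₀).inverse invertGate = (mergeAll k m).inverse invertGate ++
        [((.flip, true), ((cells k m).take n).map (sitePair j₀ 1 0))] := by
      simp [preparation, Plan.inverse, invertGate]
    rw [mainPlan, e₂, e₁]
    simp only [Plan.encode_append, Plan.encode_singleton, points, List.map_cons, List.map_nil,
      List.nil_append, List.append_assoc]
  rw [e]
  exact h

end

/-! ### The running time is polynomial -/

/-- A function that is bounded by a polynomial. -/
def PolyBounded (f : ℕ → ℕ) : Prop := ∃ P : Polynomial ℕ, ∀ n, f n ≤ P.eval n

theorem PolyBounded.const (c : ℕ) : PolyBounded fun _ => c :=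
  ⟨Polynomial.C c, fun n => by simp⟩

theorem PolyBounded.id : PolyBounded fun n => n :=
  ⟨Polynomial.X, fun n => by simp⟩

theorem PolyBounded.add {f g : ℕ → ℕ} (hf : PolyBounded f) (hg : PolyBounded g) :
    PolyBounded fun n => f n + g n := by
  obtain ⟨P, hP⟩ := hf
  obtain ⟨Q, hQ⟩ := hg
  exact ⟨P + Q, fun n => by rw [Polynomial.eval_add]; exact Nat.add_le_add (hP n) (hQ n)⟩

theorem PolyBounded.mul {f g : ℕ → ℕ} (hf : PolyBounded f) (hg : PolyBounded g) :
    PolyBounded fun n => f n * g n := by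
  obtain ⟨P, hP⟩ := hf
  obtain ⟨Q, hQ⟩ := hg
  exact ⟨P * Q, fun n => by rw [Polynomial.eval_mul]; exact Nat.mul_le_mul (hP n) (hQ n)⟩

/-- The nesting depth `c` is fixed, and each level multiplies by a linear factor. -/
theorem polyBounded_nestCost {f : ℕ → ℕ} (hf : PolyBounded f) (c : ℕ) :
    PolyBounded fun n => nestCost n (f n) c := by
  induction c with
  | zero => exact hf
  | succ c ih => exact (PolyBounded.id.add (.const 1)).mul (ih.add (.const 5))

theorem polyBounded_mainCost (k L : ℕ) : PolyBounded (mainCost k L) := by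
  have c := PolyBounded.const
  have n := PolyBounded.id
  have hsite : PolyBounded (siteCost k) := ((c k).mul (((c 7).mul n).add (c 8))).add (c 1)
  have hop : PolyBounded (opCost k) := (c 1).add (hsite.add hsite)
  have hlayer : PolyBounded (layerCost k) := (c 1).add (polyBounded_nestCost hop k)
  have hword : PolyBounded (wordCost k L) := ((c L).mul hlayer).add (c 1)
  have hstep : PolyBounded (stepCost k L) := ((c 3).mul hword).add (c 1)
  have hmerge : PolyBounded (mergeCost k L) :=
    (n.mul (((c 1).add (hstep.add (c 2))).add (c 1))).add (c 1)
  have h2 : PolyBounded fun N => N * 2 + 1 := (n.mul (c 2)).add (c 1)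
  have hsearch : PolyBounded (searchCost k) :=
    (n.mul (((c 1).add (h2.add ((c (k * 1 + 1)).add (polyBounded_nestCost (c 2) k)))).add
      (c 1))).add (c 1)
  have hflip : PolyBounded (flipLayerCost k) :=
    (c 1).add ((polyBounded_nestCost (((c 1).add hop).add (c 1)) k).add h2)
  have hclean : PolyBounded (cleanUpCost k) := h2.add (((c k).mul h2).add (c 1))
  have hflips := ((c L).mul hflip).add (c 1)
  have hmerges := ((c k).mul hmerge).add (c 1)
  exact hsearch.add (hflips.add (hmerges.add (hword.add (hmerges.add (hflips.add hclean)))))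

/-! ### Words for the unitaries -/

/-- The gates in the lists suffice to induce `M` on a pair of qubits. -/
def Induced (l₁ : List U1) (l₂ : List U2) (M : Matrix (Bool × Bool) (Bool × Bool) ℂ) : Prop :=
  M ∈ GateSet.onPair ⟨{V | V ∈ l₁}, {V | V ∈ l₂}⟩

theorem Induced.mono {l₁ l₁' : List U1} {l₂ l₂' : List U2}
    {M : Matrix (Bool × Bool) (Bool × Bool) ℂ} (h : Induced l₁ l₂ M) (h₁ : l₁ ⊆ l₁')
    (h₂ : l₂ ⊆ l₂') : Induced l₁' l₂' M := by
  rcases h with ⟨V, hV, rfl⟩ | ⟨V, hV, rfl⟩ | ⟨V, hV, rfl⟩ | ⟨V, hV, rfl⟩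
  · exact Or.inl ⟨V, h₁ hV, rfl⟩
  · exact Or.inr (Or.inl ⟨V, h₁ hV, rfl⟩)
  · exact Or.inr (Or.inr (Or.inl ⟨V, h₂ hV, rfl⟩))
  · exact Or.inr (Or.inr (Or.inr ⟨V, h₂ hV, rfl⟩))

/-- Every letter of a word uses a single gate of `G`, so finitely many letters need only finite
lists of gates, as a family of circuits demands. -/
theorem exists_induced (G : GateSet) (l : List (Matrix (Bool × Bool) (Bool × Bool) ℂ))
    (h : ∀ M ∈ l, M ∈ G.onPair) : ∃ (l₁ : List U1) (l₂ : List U2), (∀ V ∈ l₁, V ∈ G.one) ∧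
      (∀ V ∈ l₂, V ∈ G.two) ∧ ∀ M ∈ l, Induced l₁ l₂ M := by
  induction l with
  | nil => exact ⟨[], [], by simp, by simp, by simp⟩
  | cons M l ih =>
    rw [List.forall_mem_cons] at h
    obtain ⟨l₁, l₂, h₁, h₂, h₃⟩ := ih h.2
    have key : ∀ (m₁ : List U1) (m₂ : List U2), (∀ V ∈ m₁, V ∈ G.one) → (∀ V ∈ m₂, V ∈ G.two) →
        Induced m₁ m₂ M → ∃ (l₁ : List U1) (l₂ : List U2), (∀ V ∈ l₁, V ∈ G.one) ∧
          (∀ V ∈ l₂, V ∈ G.two) ∧ ∀ M' ∈ M :: l, Induced l₁ l₂ M' := fun m₁ m₂ hm₁ hm₂ hm => by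
      refine ⟨m₁ ++ l₁, m₂ ++ l₂, fun V hV => (List.mem_append.1 hV).elim (hm₁ V) (h₁ V),
        fun V hV => (List.mem_append.1 hV).elim (hm₂ V) (h₂ V), ?_⟩
      rw [List.forall_mem_cons]
      exact ⟨hm.mono (List.subset_append_left _ _) (List.subset_append_left _ _), fun M' hM' =>
        (h₃ M' hM').mono (List.subset_append_right _ _) (List.subset_append_right _ _)⟩
    rcases h.1 with ⟨V, hV, rfl⟩ | ⟨V, hV, rfl⟩ | ⟨V, hV, rfl⟩ | ⟨V, hV, rfl⟩
    · exact key [V] [] (by simpa using hV) (by simp) (Or.inl ⟨V, by simp, rfl⟩)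
    · exact key [V] [] (by simpa using hV) (by simp) (Or.inr (Or.inl ⟨V, by simp, rfl⟩))
    · exact key [] [V] (by simp) (by simpa using hV)
        (Or.inr (Or.inr (Or.inl ⟨V, by simp, rfl⟩)))
    · exact key [] [V] (by simp) (by simpa using hV)
        (Or.inr (Or.inr (Or.inr ⟨V, by simp, rfl⟩)))

theorem Induced.mem_range {l₁ : List U1} {l₂ : List U2}
    {M : Matrix (Bool × Bool) (Bool × Bool) ℂ} (h : Induced l₁ l₂ M) :
    M ∈ Set.range (PairOp.mat l₁.get l₂.get) := by
  rcases h with ⟨V, hV, rfl⟩ | ⟨V, hV, rfl⟩ | ⟨V, hV, rfl⟩ | ⟨V, hV, rfl⟩ <;>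
    obtain ⟨i, rfl⟩ := List.mem_iff_get.1 hV
  · exact ⟨.fst i, rfl⟩
  · exact ⟨.snd i, rfl⟩
  · exact ⟨.two i, rfl⟩
  · exact ⟨.swapped i, rfl⟩

/-- Finitely many unitaries can be constructed from finitely many basic operations. -/
theorem exists_words {ι : Type} [Finite ι] (G : GateSet) (L : ℕ) (V : ι → U2)
    (h : ∀ i, G.Constructs L (V i)) :
    ∃ (g₁ g₂ : ℕ) (u₁ : Fin g₁ → U1) (u₂ : Fin g₂ → U2)
      (word : ι → List (PairOp (Fin g₁) (Fin g₂))), (∀ a, u₁ a ∈ G.one) ∧ (∀ b, u₂ b ∈ G.two) ∧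
      (∀ i, (word i).length ≤ L) ∧ ∀ i, ∃ c : ℂ, ‖c‖ = 1 ∧
        (V i : Matrix (Bool × Bool) (Bool × Bool) ℂ) = c • wordMat u₁ u₂ (word i) := by
  have := Fintype.ofFinite ι
  choose w hlen hmem c hc hV using h
  obtain ⟨l₁, l₂, h₁, h₂, h₃⟩ := exists_induced G ((Finset.univ : Finset ι).toList.flatMap w)
    fun M hM => by
      obtain ⟨i, -, hi⟩ := List.mem_flatMap.1 hM
      exact hmem i M hi
  -- Reversed, because the rightmost factor of a product is performed first.
  have hword : ∀ i, ∃ v : List (PairOp (Fin l₁.length) (Fin l₂.length)),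
      v.map (PairOp.mat l₁.get l₂.get) = (w i).reverse := fun i => by
    have : (w i).reverse ∈ Set.range (List.map (PairOp.mat l₁.get l₂.get)) := by
      rw [Set.range_list_map]
      intro M hM
      exact (h₃ M (List.mem_flatMap.2 ⟨i, by simp, List.mem_reverse.1 hM⟩)).mem_range
    exact this
  choose word hw using hword
  refine ⟨_, _, l₁.get, l₂.get, word, fun a => h₁ _ (List.get_mem _ _),
    fun b => h₂ _ (List.get_mem _ _), fun i => ?_, fun i => ⟨c i, hc i, ?_⟩⟩
  · have := congrArg List.length (hw i)
    rw [List.length_map, List.length_reverse] at this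
    exact this.trans_le (hlen i)
  · rw [wordMat, hw, seqProd_reverse, hV]

/-! ### Well-formedness and size of the circuit of a plan -/

theorem PairOp.support_instr {k : ℕ} {A B : Type} (l : PairOp A B) (p q : Site k) :
    (l.instr p q).support ⊆ {p, q} := by
  intro z
  cases l <;> simp [PairOp.instr, Instr.support] <;> tauto

theorem Plan.wellFormed_circuit {k : ℕ} {g A B : Type} (word : g → List (PairOp A B))
    (P : Plan k g) (hP : ∀ s ∈ P, Parallel s.2) : (P.circuit word).WellFormed := by
  intro S hS
  simp only [Plan.circuit, wordLayers, List.mem_flatMap, List.mem_map] at hS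
  obtain ⟨s, hs, l, -, rfl⟩ := hS
  obtain ⟨h₁, h₂⟩ := hP s hs
  constructor
  · intro o ho
    obtain ⟨a, ha, rfl⟩ := List.mem_map.1 ho
    cases l with
    | fst => trivial
    | snd => trivial
    | two => exact h₂ a ha
    | swapped => exact (h₂ a ha).symm
  · rw [List.pairwise_map]
    refine h₁.imp fun {a b} hab => ?_
    refine Disjoint.mono (l.support_instr _ _) (l.support_instr _ _) ?_
    obtain ⟨e₁, e₂, e₃, e₄⟩ := hab
    simp only [Finset.disjoint_insert_left, Finset.disjoint_singleton_left, Finset.mem_insert,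
      Finset.mem_singleton]
    tauto

theorem Plan.depth_circuit_le {k : ℕ} {g A B : Type} {L : ℕ} (word : g → List (PairOp A B))
    (hw : ∀ a, (word a).length ≤ L) (P : Plan k g) :
    (P.circuit word).depth ≤ L * P.length := by
  induction P with
  | nil => simp [Plan.circuit, Circuit.depth]
  | cons s P ih =>
    unfold Circuit.depth Plan.circuit at *
    rw [List.flatMap_cons, List.length_append, List.length_cons, wordLayers, List.length_map]
    have := hw s.1
    linarith

/-- The number of pairs of qubits in a plan. -/
def Plan.weight {k : ℕ} {g : Type} (P : Plan k g) : ℕ := (P.map fun s => s.2.length).sum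

theorem Plan.weight_append {k : ℕ} {g : Type} (P Q : Plan k g) :
    Plan.weight (P ++ Q) = P.weight + Q.weight := by
  simp [Plan.weight]

theorem Plan.weight_inverse {k : ℕ} {g : Type} (inv : g → g) (P : Plan k g) :
    (P.inverse inv).weight = P.weight := by
  unfold Plan.weight Plan.inverse
  rw [List.map_map, List.map_reverse, List.sum_reverse]
  rfl

theorem Plan.size_circuit_le {k : ℕ} {g A B : Type} {L : ℕ} (word : g → List (PairOp A B))
    (hw : ∀ a, (word a).length ≤ L) (P : Plan k g) :
    (P.circuit word).size ≤ L * P.weight := by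
  induction P with
  | nil => simp [Plan.circuit, Circuit.size]
  | cons s P ih =>
    have e : Circuit.size (Plan.circuit word (s :: P)) =
        (word s.1).length * s.2.length + Circuit.size (Plan.circuit word P) := by
      simp [Plan.circuit, Circuit.size, wordLayers, Function.comp_def]
    have e' : Plan.weight (s :: P) = s.2.length + Plan.weight P := by
      simp [Plan.weight]
    rw [e, e', Nat.mul_add]
    exact Nat.add_le_add (Nat.mul_le_mul_right _ (hw s.1)) ih

/-- An operation touches at most two qubits. -/
theorem Circuit.width_le {k : ℕ} {A B : Type} (c : Circuit k A B) : c.width ≤ 2 * c.size := by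
  have key : ∀ l : List (Instr k A B),
      ((l.map Instr.support).foldr (· ∪ ·) ∅).card ≤ 2 * l.length := fun l => by
    induction l with
    | nil => simp
    | cons o l ih =>
      have ho : o.support.card ≤ 2 := by
        cases o with
        | one => simp [Instr.support]
        | two b p q => exact Finset.card_le_two
        | meas => simp [Instr.support]
      rw [List.map_cons, List.foldr_cons, List.length_cons]
      have := Finset.card_union_le o.support ((l.map Instr.support).foldr (· ∪ ·) ∅)
      omega
  have := key c.flatten
  rwa [List.length_flatten] at this

theorem length_mergeAll (k m : ℕ) : (mergeAll k m).length = 3 * k * m := by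
  simp [mergeAll, mergeStep, List.length_flatMap]
  ring

theorem length_mainPlan (k m n : ℕ) (j₀ : Fin k) :
    (mainPlan k m n j₀).length = 6 * k * m + 3 := by
  simp [mainPlan, preparation, Plan.inverse, length_mergeAll]
  ring

/-- A timestep in direction `j` has `m` to the number of later coordinates many sources, and there
are `m` of them, so a direction has at most `m ^ k` junctions of three gates each. -/
theorem weight_mergeAll_le (k m : ℕ) : (mergeAll k m).weight ≤ 3 * k * m ^ k := by
  have hflat : ∀ {ι : Type} (l : List ι) (P : ι → Plan k (Gate × Bool)) (c : ℕ),
      (∀ i, (P i).weight ≤ c) → Plan.weight (l.flatMap P) ≤ l.length * c := fun l P c h => by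
    induction l with
    | nil => simp [Plan.weight]
    | cons i l ih =>
      rw [List.flatMap_cons, Plan.weight_append, List.length_cons]
      have := h i
      linarith
  have hstep : ∀ (j : Fin k) (r : ℕ), (mergeStep m j r).weight = 3 * m ^ (later j).length :=
    fun j r => by
      simp [mergeStep, Plan.weight, sources, length_points]
      ring
  have hdir : ∀ j : Fin k,
      Plan.weight ((List.range m).flatMap fun r => mergeStep m j r) ≤ 3 * m ^ k := fun j => by
    refine (hflat _ _ _ fun r => (hstep j r).le).trans ?_
    rw [List.length_range]
    rcases Nat.eq_zero_or_pos m with rfl | hm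
    · simp
    · calc m * (3 * m ^ (later j).length) = 3 * m ^ ((later j).length + 1) := by ring
        _ ≤ 3 * m ^ k := Nat.mul_le_mul_left 3 (Nat.pow_le_pow_right hm (length_later_lt j))
  refine (hflat _ _ _ hdir).trans ?_
  rw [List.length_finRange]
  linarith

theorem weight_mainPlan_le (k m n : ℕ) (j₀ : Fin k) :
    (mainPlan k m n j₀).weight ≤ 2 * n + 6 * k * m ^ k + 1 := by
  have h₁ : (preparation k m n j₀).weight ≤ n + 3 * k * m ^ k := by
    have e : preparation k m n j₀ =
        [((.flip, false), ((cells k m).take n).map (sitePair j₀ 1 0))] ++ mergeAll k m := rfl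
    rw [e, Plan.weight_append]
    refine Nat.add_le_add ?_ (weight_mergeAll_le k m)
    simp [Plan.weight]
  have h₂ : Plan.weight [((Gate.control, false), [sitePair j₀ 0 1 (prefixPoint m k)])] = 1 := rfl
  rw [mainPlan, Plan.weight_append, Plan.weight_append, Plan.weight_inverse, h₂]
  linarith

/-- Minimality gives `(m - 1) ^ k < n`, so `m` exceeds the root by at most one, and the root is at
least one. -/
theorem rootCeil_le_rpow {k : ℕ} (hk : k ≠ 0) {n : ℕ} (hn : 1 ≤ n) :
    (rootCeil k n : ℝ) ≤ 2 * (n : ℝ) ^ (1 / (k : ℝ)) := by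
  have hn' : (1 : ℝ) ≤ n := by exact_mod_cast hn
  have h1 : 1 ≤ (n : ℝ) ^ (1 / (k : ℝ)) := Real.one_le_rpow hn' (by positivity)
  rcases Nat.eq_zero_or_pos (rootCeil k n) with h | h
  · rw [h, Nat.cast_zero]
    positivity
  · have hlt := pow_lt_of_lt_rootCeil (Nat.sub_lt h one_pos)
    have hle : ((rootCeil k n - 1 : ℕ) : ℝ) ≤ (n : ℝ) ^ (1 / (k : ℝ)) := by
      rw [one_div]
      refine (Real.le_rpow_inv_iff_of_pos (by positivity) (by positivity)
        (by positivity)).2 ?_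
      rw [Real.rpow_natCast]
      exact_mod_cast hlt.le
    rw [Nat.cast_sub h, Nat.cast_one] at hle
    linarith

/-- For `m ≥ 2` one has `m ≤ 2 * (m - 1)`, and `(m - 1) ^ k < n` by minimality. -/
theorem rootCeil_pow_le {k n : ℕ} (hn : 1 ≤ n) : rootCeil k n ^ k ≤ 2 ^ k * n := by
  rcases Nat.lt_or_ge (rootCeil k n) 2 with h | h
  · calc rootCeil k n ^ k ≤ 1 ^ k := Nat.pow_le_pow_left (by omega) k
      _ ≤ 2 ^ k * n := by
        rw [one_pow]
        exact Nat.mul_pos (by positivity) hn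
  · calc rootCeil k n ^ k ≤ (2 * (rootCeil k n - 1)) ^ k := Nat.pow_le_pow_left (by omega) k
      _ = 2 ^ k * (rootCeil k n - 1) ^ k := mul_pow _ _ _
      _ ≤ 2 ^ k * n := Nat.mul_le_mul_left _
        (pow_lt_of_lt_rootCeil (Nat.sub_lt (by omega) one_pos)).le

/-! ### The family of circuits -/

instance {A B : Type} : Inhabited (Letter A B) := ⟨.layer⟩

instance {A B : Type} [Finite A] [Finite B] : Finite (Letter A B) :=
  Finite.of_surjective
    (fun x : (A ⊕ B) ⊕ Fin 5 => match x with
      | .inl (.inl a) => Letter.one a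
      | .inl (.inr b) => Letter.two b
      | .inr 0 => Letter.layer
      | .inr 1 => Letter.meas
      | .inr 2 => Letter.plus
      | .inr 3 => Letter.minus
      | .inr 4 => Letter.tick) fun l =>
    match l with
    | .one a => ⟨.inl (.inl a), rfl⟩
    | .two b => ⟨.inl (.inr b), rfl⟩
    | .layer => ⟨.inr 0, rfl⟩
    | .meas => ⟨.inr 1, rfl⟩
    | .plus => ⟨.inr 2, rfl⟩
    | .minus => ⟨.inr 3, rfl⟩
    | .tick => ⟨.inr 4, rfl⟩

/-- The plan has `6 * k * m + 3` steps and at most `2 * n + 6 * k * m ^ k + 1` pairs, each costing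
at most `L`. With `m ^ k ≤ 2 ^ k * n` the number of pairs is at most `(6 * k * 2 ^ k + 3) * n`; the
factor `2` in the constant serves the width, and also the depth, where `m` is at most twice the root
of `n`. -/
theorem exists_family {k : ℕ} (hk : k ≠ 0) (G : GateSet) (L : ℕ) (U : U1)
    (h : ∀ g, G.Constructs L (signedUnitary U g)) :
    ∃ F : Family k G, ∀ n : ℕ, F.ImplementsControlled U n ∧
      (1 ≤ n →
        ((F.circuit n).depth : ℝ) ≤ (2 * L * (6 * k * 2 ^ k + 3) : ℕ) * (n : ℝ) ^ (1 / (k : ℝ)) ∧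
        ((F.circuit n).size : ℝ) ≤ (2 * L * (6 * k * 2 ^ k + 3) : ℕ) * (n : ℝ) ∧
        ((F.circuit n).width : ℝ) ≤ (2 * L * (6 * k * 2 ^ k + 3) : ℕ) * (n : ℝ)) := by
  obtain ⟨g₁, g₂, u₁, u₂, word, h₁, h₂, hlen, hword⟩ := exists_words G L _ h
  let j₀ : Fin k := ⟨0, Nat.pos_of_ne_zero hk⟩
  obtain ⟨T, hT⟩ := polyBounded_mainCost k L
  refine ⟨{
    g₁ := g₁
    g₂ := g₂
    u₁ := u₁
    u₂ := u₂
    u₁_mem := h₁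
    u₂_mem := h₂
    circuit := fun n => (mainPlan k (rootCeil k n) n j₀).circuit word
    wellFormed := fun n => Plan.wellFormed_circuit word _ fun _ hs => parallel_mainPlan hs
    polyTime := nonempty_polyTime_of_runs (mainProg word j₀) Reg.src _ _ T fun n =>
      (runs_mainProg word hlen j₀ n).weaken (hT n) }, fun n => ⟨?_, fun hn => ?_⟩⟩
  · have hn := le_rootCeil_pow hk n
    refine ⟨mainLayout k (rootCeil k n) n j₀ hn, fun σ => ?_⟩
    rw [Layout.embed_eq_mix, Layout.embed_eq_mix, Plan.run_circuit_mix u₁ u₂ word (signedMat U)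
      hword _ fun _ hs => parallel_mainPlan hs]
    simp only [mainPlan_ket]
    exact mix_mul _ _ _
  · have hd := Plan.depth_circuit_le word hlen (mainPlan k (rootCeil k n) n j₀)
    have hs := Plan.size_circuit_le word hlen (mainPlan k (rootCeil k n) n j₀)
    have hw := Circuit.width_le ((mainPlan k (rootCeil k n) n j₀).circuit word)
    have hs' : ((mainPlan k (rootCeil k n) n j₀).circuit word).size ≤
        L * (6 * k * 2 ^ k + 3) * n := by
      refine hs.trans ?_
      rw [mul_assoc]
      refine Nat.mul_le_mul_left L ((weight_mainPlan_le k _ n j₀).trans ?_)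
      have := Nat.mul_le_mul_left (6 * k) (rootCeil_pow_le (k := k) hn)
      nlinarith
    refine ⟨?_, ?_, ?_⟩
    · rw [length_mainPlan] at hd
      have hn' : (1 : ℝ) ≤ n := by exact_mod_cast hn
      have hr := rootCeil_le_rpow hk hn
      have h1 : 1 ≤ (n : ℝ) ^ (1 / (k : ℝ)) := Real.one_le_rpow hn' (by positivity)
      have hd' : (((mainPlan k (rootCeil k n) n j₀).circuit word).depth : ℝ) ≤
          L * (6 * k * rootCeil k n + 3) := by exact_mod_cast hd
      refine hd'.trans ?_
      set x := (n : ℝ) ^ (1 / (k : ℝ)) with hx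
      push_cast
      have h2 : (1 : ℝ) ≤ 2 ^ k := one_le_pow₀ one_le_two
      calc (L : ℝ) * (6 * k * rootCeil k n + 3) ≤ L * (6 * k * (2 * x) + 3 * (2 * x)) := by
            gcongr
            linarith
        _ = 2 * L * (6 * k * 1 + 3) * x := by ring
        _ ≤ 2 * L * (6 * k * 2 ^ k + 3) * x := by gcongr
    · have : ((mainPlan k (rootCeil k n) n j₀).circuit word).size ≤
          2 * L * (6 * k * 2 ^ k + 3) * n := by nlinarith
      exact_mod_cast this
    · have : ((mainPlan k (rootCeil k n) n j₀).circuit word).width ≤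
          2 * L * (6 * k * 2 ^ k + 3) * n := by nlinarith
      exact_mod_cast this

end NANTC

end

theorem mainTheorem7 (k : ℕ) (hk : 1 ≤ k) :
    (∀ L : ℕ, ∃ C : ℝ, ∀ G : NANTC.GateSet, G.UniversalWithin L → ∀ U : NANTC.U1,
      ∃ F : NANTC.Family k G, ∀ n : ℕ, F.ImplementsControlled U n ∧
        (1 ≤ n → ((F.circuit n).depth : ℝ) ≤ C * (n : ℝ) ^ (1 / (k : ℝ)) ∧
          ((F.circuit n).size : ℝ) ≤ C * (n : ℝ) ∧
          ((F.circuit n).width : ℝ) ≤ C * (n : ℝ))) ∧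
    (∀ G : NANTC.GateSet, G.Universal → ∀ U : NANTC.U1, ∃ C : ℝ,
      ∃ F : NANTC.Family k G, ∀ n : ℕ, F.ImplementsControlled U n ∧
        (1 ≤ n → ((F.circuit n).depth : ℝ) ≤ C * (n : ℝ) ^ (1 / (k : ℝ)) ∧
          ((F.circuit n).size : ℝ) ≤ C * (n : ℝ) ∧
          ((F.circuit n).width : ℝ) ≤ C * (n : ℝ))) := by
  have hk' : k ≠ 0 := by omega
  -- The constant found by unification is the one of `exists_family`, which involves `k` and `L`
  -- only.
  refine ⟨fun L => ⟨_, fun G hG U => NANTC.exists_family hk' G L U fun g => hG _⟩,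
    fun G hG U => ?_⟩
  -- Without a uniform bound, the finitely many gates in use and their inverses still have a common
  -- one, which may depend on `G` and `U`.
  choose L hL using fun g => hG (NANTC.signedUnitary U g)
  obtain ⟨M, hM⟩ := (Set.finite_range L).bddAbove
  exact ⟨_, NANTC.exists_family hk' G M U fun g => by
    obtain ⟨w, hw, h⟩ := hL g
    exact ⟨w, hw.trans (hM ⟨g, rfl⟩), h⟩⟩
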